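/- Let $A$ and $B$ be Artin algebras, and write $A\text{-mod}$ for the category of finitely generated left $A$-modules. Let $F$ be an additive subbifunctor of $\mathrm{Ext}^1_A(-,-)$ on $A\text{-mod}$. A short exact sequence $0\to X\to Y\to Z\to 0$ is called $F$-exact if its class lies in $F(Z,X)$; a module $P$ (resp. $I$) is $F$-projective (resp. $F$-injective) if $\mathrm{Hom}_A(P,-)$ (resp. $\mathrm{Hom}_A(-,I)$) is exact on $F$-exact sequences. Assume that $F$ has enough projectives and enough injectives, i.e. for every $M$ there are $F$-exact sequences $0\to K\to P\to M\to 0$ and $0\to M\to I\to N\to 0$ with $P$ $F$-projective and $I$ $F$-injective, and that the category $\mathcal P(F)$ of $F$-projective modules equals $\mathrm{add}\,G$ for some $G\in A\text{-mod}$. A complex $X^\bullet$ over $A\text{-mod}$ is $F$-acyclic if all sequences $0\to \mathrm{Im}\,d^{i-1}\to X^i\to \mathrm{Im}\,d^i\to 0$ are $F$-exact, and $D_F^b(A)$ is the Verdier quotient of $K^b(A\text{-mod})$ by the $F$-acyclic complexes; for $F=\mathrm{Ext}^1$ this is the usual $D^b(A)$. A relative tilting complex is a bounded complex $T^\bullet$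 of $F$-projective modules with $\mathrm{Hom}_{K^b(\mathcal P(F))}(T^\bullet,T^\bullet[i])=0$ for $i\neq 0$ and such that $\mathrm{add}\,T^\bullet$ generates $K^b(\mathcal P(F))$ as a triangulated category. Its term length is $t(T^\bullet)=n$ if $T^\bullet$ is isomorphic in the homotopy category to a complex $0\to X^{m-n}\to\cdots\to X^m\to 0$ (for some $m\in\mathbb Z$) whose differentials are radical maps and with $X^{m-n}\neq 0\neq X^m$. Let $K_F(A)$ be the abelian group generated by the isomorphism classes $[M]$ of modules in $A\text{-mod}$, modulo $[N]=[X]+[Y]$ if $N\cong X\oplus Y$ and $[P]=0$ if $P$ is $F$-projective. Let $\Omega_F$ be the endomorphism of $K_F(A)$ sending $[M]$ to $[K]$ for any $F$-exact sequence $0\to K\to P\to M\to 0$ with $P$ $F$-projective, and let $\langle M\rangle\subseteq K_F(A)$ be the subgroup generated by the classes of the indecomposable non-$F$-projective direct summands of $M$. Let $\phi_F(M)$ be the least $k\ge 0$ such that $\Omega_F$ restricts to a bijection $\Omega_F^m\langle M\rangle\to\Omega_F^{m+1}\langle M\rangle$ for all $m\ge k$, and put $\phi\text{-dim}_F(A)=\sup_{M\in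 A\text{-mod}}\phi_F(M)\in\mathbb N\cup\{\infty\}$. Let $\phi\text{-dim}(B)=\phi\text{-dim}_{\mathrm{Ext}^1_B}(B)$. Let $L:D_F^b(A)\to D^b(B)$ be a triangle equivalence (a relative derived equivalence), and let $T^\bullet$ be an associated $F$-tilting complex, i.e. a relative tilting complex with $L(T^\bullet)\cong B$ in $D^b(B)$. Then $$\phi\text{-dim}_F(A)-t(T^\bullet)\le \phi\text{-dim}(B)\le \phi\text{-dim}_F(A)+t(T^\bullet)+2 .$$ -/

import Mathlib

open CategoryTheory Limits

universe w v u

namespace RelDer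

section Ext

variable (C : Type u) [Category.{v} C] [Abelian C] [HasExt.{w} C]

/-- An additive subbifunctor `F` of the bifunctor `Ext¹(-,-)` on an abelian category: a subgroup
of `Ext¹(Z, X)` for all `Z`, `X`, stable under the maps induced by morphisms in both variables. -/
structure ExtSubfunctor where
  /-- The subgroup `F(Z, X)` of `Ext¹(Z, X)`. -/
  obj (Z X : C) : AddSubgroup (Abelian.Ext.{w} Z X 1)
  precomp_mem {Z' Z X : C} (g : Z' ⟶ Z) {e : Abelian.Ext.{w} Z X 1} (he : e ∈ obj Z X) :
    (Abelian.Ext.mk₀ g).comp e (zero_add 1) ∈ obj Z' X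
  postcomp_mem {Z X X' : C} (g : X ⟶ X') {e : Abelian.Ext.{w} Z X 1} (he : e ∈ obj Z X) :
    e.comp (Abelian.Ext.mk₀ g) (add_zero 1) ∈ obj Z X'

/-- The subbifunctor `Ext¹(-,-)` itself. -/
noncomputable def ExtSubfunctor.full : ExtSubfunctor.{w} C where
  obj _ _ := ⊤
  precomp_mem _ _ _ := AddSubgroup.mem_top _
  postcomp_mem _ _ _ := AddSubgroup.mem_top _

end Ext

section Add

variable {C : Type u} [Category.{v} C] [Preadditive C] [HasFiniteBiproducts C]

/-- `add X`: the direct summands of finite direct sums of copies of `X`. -/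
def IsInAdd (X : C) : ObjectProperty C :=
  fun Y => ∃ n : ℕ, Nonempty (Retract Y (⨁ fun _ : Fin n => X))

end Add

section Complexes

variable {C : Type u} [Category.{v} C] [Preadditive C]

/-- Bounded cochain complexes. -/
def IsBoundedCpx (K : CochainComplex C ℤ) : Prop :=
  ∃ a b : ℤ, ∀ i : ℤ, i < a ∨ b < i → IsZero (K.X i)

variable (C) in
/-- The bounded complexes, as objects of the homotopy category `K(C)`. -/
def bounded : ObjectProperty (HomotopyCategory C (ComplexShape.up ℤ)) :=
  fun X => IsBoundedCpx X.as

open ZeroObject in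
instance [HasZeroObject C] : (bounded C).ContainsZero where
  exists_zero := ⟨(HomotopyCategory.quotient _ _).obj 0, Functor.map_isZero _ (isZero_zero _),
    ⟨0, 0, fun i _ => (HomologicalComplex.eval C (ComplexShape.up ℤ) i).map_isZero
      (isZero_zero _)⟩⟩

instance : (bounded C).IsStableUnderShift ℤ where
  isStableUnderShiftBy n :=
    { le_shift X := by
        obtain ⟨K, rfl⟩ := HomotopyCategory.quotient_obj_surjective X
        rintro ⟨a, b, h⟩
        rw [ObjectProperty.prop_shift_iff, HomotopyCategory.shift_quotient_obj]
        exact ⟨a - n, b - n, fun i hi => h (i + n) (by lia)⟩ }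

instance [HasZeroObject C] [HasBinaryBiproducts C] : (bounded C).IsTriangulatedClosed₃ where
  ext₃' T hT h₁ h₂ := by
    obtain ⟨a₁, b₁, h₁⟩ := h₁
    obtain ⟨a₂, b₂, h₂⟩ := h₂
    obtain ⟨f : T.obj₁.as ⟶ T.obj₂.as, hf⟩ :=
      (HomotopyCategory.quotient _ _).map_surjective T.mor₁
    refine ⟨(HomotopyCategory.quotient _ _).obj (CochainComplex.mappingCone f), ?_,
      ⟨Pretriangulated.Triangle.π₃.mapIso (Pretriangulated.isoTriangleOfIso₁₂ T _ hT
        (HomotopyCategory.mappingCone_triangleh_distinguished f)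
        (Iso.refl _) (Iso.refl _) ?_)⟩⟩
    · refine ⟨min (a₁ - 1) a₂, max b₁ b₂, fun i hi => ?_⟩
      refine (CochainComplex.mappingCone.isZero_X_iff f i).2 ⟨h₁ _ ?_, h₂ _ ?_⟩ <;> grind
    · exact (Category.comp_id _).trans (hf.symm.trans (Category.id_comp _).symm)

instance [HasZeroObject C] [HasBinaryBiproducts C] : (bounded C).IsTriangulated where
  toIsTriangulatedClosed₂ := .of_isTriangulatedClosed₃

variable (C) in
/-- The bounded homotopy category `K^b(C)`. -/
abbrev Kb := (bounded C).FullSubcategory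

/-- A radical morphism `f : X ⟶ Y`: `1 - f g` is invertible for every `g : Y ⟶ X`. -/
def IsRadical {X Y : C} (f : X ⟶ Y) : Prop :=
  ∀ g : Y ⟶ X, IsIso (𝟙 X - f ≫ g)

/-- `T` has term length `n`: up to isomorphism in the homotopy category, `T` is a complex
`0 ⟶ X^{m-n} ⟶ ⋯ ⟶ X^m ⟶ 0` with radical differential and nonzero end terms. -/
def HasTermLength (T : CochainComplex C ℤ) (n : ℕ) : Prop :=
  ∃ X : CochainComplex C ℤ, Nonempty (HomotopyEquiv T X) ∧
    (∀ i j : ℤ, IsRadical (X.d i j)) ∧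
    ∃ m : ℤ, ¬ IsZero (X.X (m - n)) ∧ ¬ IsZero (X.X m) ∧
      ∀ i : ℤ, i < m - n ∨ m < i → IsZero (X.X i)

end Complexes

section Abelian

variable {C : Type u} [Category.{v} C] [Abelian C]

lemma isBoundedCpx_single (X : C) :
    IsBoundedCpx ((HomologicalComplex.single C (ComplexShape.up ℤ) 0).obj X) :=
  ⟨0, 0, fun i hi => HomologicalComplex.isZero_single_obj_X _ _ _ _ (by lia)⟩

open CochainComplex.HomComplex in
lemma singleFunctor_map_eq_zero_iff (P : C) (K : CochainComplex C ℤ) (i j : ℤ) (hij : i + 1 = j)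
    (f : P ⟶ K.X j) (φ : (CochainComplex.singleFunctor C j).obj P ⟶ K)
    (hφ : Cochain.ofHom φ = Cochain.fromSingleMk f (add_zero j)) :
    (HomotopyCategory.quotient C (ComplexShape.up ℤ)).map φ = 0 ↔
      ∃ g : P ⟶ K.X i, g ≫ K.d i j = f := by
  constructor
  · intro h
    let z := Cochain.equivHomotopy _ _ (HomotopyCategory.homotopyOfEq φ 0 (by simpa using h))
    obtain ⟨g, hg⟩ := Cochain.fromSingleMk_surjective z.1 i (by lia)
    refine ⟨g, ?_⟩
    have h₁ := z.2
    rw [← hg, Cochain.δ_fromSingleMk g _ 0 j (by lia), hφ, Cochain.ofHom_zero, add_zero] at h₁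
    exact ((Cochain.fromSingleEquiv (add_zero j)).symm.injective h₁).symm
  · rintro ⟨g, rfl⟩
    have : Homotopy φ 0 := (Cochain.equivHomotopy _ _).symm
      ⟨Cochain.fromSingleMk g (n := -1) (by lia), by
        rw [Cochain.δ_fromSingleMk g _ 0 j (by lia), hφ, Cochain.ofHom_zero, add_zero]⟩
    rw [HomotopyCategory.eq_of_homotopy _ _ this, Functor.map_zero]

lemma nonempty_iso_pullback {K P M Q : C} (i : K ⟶ P) (p : P ⟶ M) (w : i ≫ p = 0)
    (h : (ShortComplex.mk i p w).ShortExact) (q : Q ⟶ M) (s : Q ⟶ P) (hs : s ≫ p = q) :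
    Nonempty (pullback q p ≅ K ⊞ Q) := by
  have := h.mono_f
  have hi : Mono i := this
  have hr : (pullback.snd q p - pullback.fst q p ≫ s) ≫ p = 0 := by
    rw [Preadditive.sub_comp, Category.assoc, hs, pullback.condition, sub_self]
  let r : pullback q p ⟶ K := h.exact.lift (pullback.snd q p - pullback.fst q p ≫ s) hr
  have hr' : r ≫ i = pullback.snd q p - pullback.fst q p ≫ s := h.exact.lift_f _ hr
  have hf : (0 : K ⟶ Q) ≫ q = i ≫ p := by simp [w]
  have hs' : 𝟙 Q ≫ q = s ≫ p := by simp [hs]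
  let a : K ⟶ pullback q p := pullback.lift 0 i hf
  let b : Q ⟶ pullback q p := pullback.lift (𝟙 Q) s hs'
  have a₁ : a ≫ pullback.fst q p = 0 := pullback.lift_fst _ _ _
  have a₂ : a ≫ pullback.snd q p = i := pullback.lift_snd _ _ _
  have b₁ : b ≫ pullback.fst q p = 𝟙 Q := pullback.lift_fst _ _ _
  have b₂ : b ≫ pullback.snd q p = s := pullback.lift_snd _ _ _
  have har : a ≫ r = 𝟙 K := by
    rw [← cancel_mono i, Category.assoc, hr', Preadditive.comp_sub, reassoc_of% a₁, a₂]
    simp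
  have hid : r ≫ a + pullback.fst q p ≫ b = 𝟙 _ := by
    apply pullback.hom_ext
    · simp [Preadditive.add_comp, a₁, b₁]
    · simp [Preadditive.add_comp, a₂, b₂, hr']
  let σ : (ShortComplex.mk a (pullback.fst q p) a₁).Splitting :=
    { r := r, s := b, f_r := har, s_g := b₁, id := hid }
  exact ⟨σ.isoBinaryBiproduct⟩

end Abelian

namespace ExtSubfunctor

variable {C : Type u} [Category.{v} C] [Abelian C] [HasExt.{w} C] (F : ExtSubfunctor.{w} C)

/-- The `F`-exact sequences `0 ⟶ X ⟶ Y ⟶ Z ⟶ 0`: the short exact sequences whose class lies in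
`F(Z, X)`. -/
def IsExact (S : ShortComplex C) : Prop :=
  ∃ h : S.ShortExact, h.extClass ∈ F.obj S.X₃ S.X₁

/-- `F`-projective objects: `Hom(P, -)` is exact on `F`-exact sequences. (As `Hom(P, -)` is left
exact, only surjectivity has to be required.) -/
def IsProj : ObjectProperty C :=
  fun P => ∀ S : ShortComplex C, F.IsExact S → ∀ f : P ⟶ S.X₃, ∃ g : P ⟶ S.X₂, g ≫ S.g = f

/-- `F`-injective objects: `Hom(-, I)` is exact on `F`-exact sequences. -/
def IsInj : ObjectProperty C :=
  fun I => ∀ S : ShortComplex C, F.IsExact S → ∀ f : S.X₁ ⟶ I, ∃ g : S.X₂ ⟶ I, S.f ≫ g = f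

/-- `F` has enough projectives: every `M` admits an `F`-exact sequence `0 ⟶ K ⟶ P ⟶ M ⟶ 0` with
`P` an `F`-projective object. -/
class EnoughProj : Prop where
  exists_isExact (M : C) : ∃ (K P : C) (i : K ⟶ P) (p : P ⟶ M) (w : i ≫ p = 0),
    F.IsExact (ShortComplex.mk i p w) ∧ F.IsProj P

/-- `F` has enough injectives: every `M` admits an `F`-exact sequence `0 ⟶ M ⟶ I ⟶ N ⟶ 0` with
`I` an `F`-injective object. -/
class EnoughInj : Prop where
  exists_isExact (M : C) : ∃ (I N : C) (i : M ⟶ I) (p : I ⟶ N) (w : i ≫ p = 0),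
    F.IsExact (ShortComplex.mk i p w) ∧ F.IsInj I

lemma isExact_full_iff (S : ShortComplex C) : (full C).IsExact S ↔ S.ShortExact :=
  ⟨fun h => h.1, fun h => ⟨h, AddSubgroup.mem_top _⟩⟩

lemma isExact_of_lift [F.EnoughProj] (S : ShortComplex C) (hS : S.ShortExact)
    (h : ∀ (P : C), F.IsProj P → ∀ f : P ⟶ S.X₃, ∃ g : P ⟶ S.X₂, g ≫ S.g = f) :
    F.IsExact S := by
  obtain ⟨K, P, i, p, w, ⟨hE, hE'⟩, hP⟩ := EnoughProj.exists_isExact (F := F) S.X₃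
  obtain ⟨g, hg⟩ := h P hP p
  have := hS.mono_f
  let k : K ⟶ S.X₁ := hS.exact.lift (i ≫ g) (by rw [Category.assoc, hg, w])
  let φ : ShortComplex.mk i p w ⟶ S :=
    { τ₁ := k, τ₂ := g, τ₃ := 𝟙 _
      comm₁₂ := hS.exact.lift_f _ _
      comm₂₃ := by simp [hg] }
  refine ⟨hS, ?_⟩
  have e := ShortComplex.ShortExact.extClass_naturality hE hS φ
  have e' : (Abelian.Ext.mk₀ φ.τ₃).comp hS.extClass (zero_add 1) = hS.extClass :=
    Abelian.Ext.mk₀_id_comp _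
  rw [← e', ← e]
  exact F.postcomp_mem _ hE'

attribute [local instance] Abelian.hasFiniteBiproducts in
/-- `P(F) = add G` for some object `G`. -/
def IsOfFiniteType : Prop :=
  ∃ G : C, ∀ M : C, F.IsProj M ↔ IsInAdd G M

/-! ### `F`-acyclic complexes and the relative bounded derived category -/

/-- A complex `K` is `F`-acyclic if for consecutive degrees `i`, `j`, `k` the induced sequence
`0 ⟶ Im d^i ⟶ K^j ⟶ Im d^j ⟶ 0` is `F`-exact. -/
def IsAcyclic (K : CochainComplex C ℤ) : Prop :=
  ∀ i j k : ℤ, i + 1 = j → j + 1 = k →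
    F.IsExact (ShortComplex.mk (image.ι (K.d i j)) (factorThruImage (K.d j k))
      (by simp [← cancel_epi (factorThruImage (K.d i j)), ← cancel_mono (image.ι (K.d j k))]))

/-- The `F`-acyclic complexes, as objects of the homotopy category `K(C)`. -/
def acyclic : ObjectProperty (HomotopyCategory C (ComplexShape.up ℤ)) :=
  fun X => F.IsAcyclic X.as

lemma isAcyclic_iff [F.EnoughProj] (K : CochainComplex C ℤ) :
    F.IsAcyclic K ↔ ∀ (P : C), F.IsProj P → ∀ i j k : ℤ, i + 1 = j → j + 1 = k →
      ∀ f : P ⟶ K.X j, f ≫ K.d j k = 0 → ∃ g : P ⟶ K.X i, g ≫ K.d i j = f := by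
  constructor
  · intro h P hP i j k hij hjk f hf
    obtain ⟨h₁, -⟩ := h i j k hij hjk
    have := h₁.mono_f
    obtain ⟨g, hg⟩ := hP _ (h (i - 1) i j (by lia) hij)
      (h₁.exact.lift f (by rw [← cancel_mono (image.ι (K.d j k))]; simpa using hf))
    refine ⟨g, ?_⟩
    have e := h₁.exact.lift_f f (by rw [← cancel_mono (image.ι (K.d j k))]; simpa using hf)
    rw [← hg] at e
    simpa using e
  · intro h i j k hij hjk
    refine F.isExact_of_lift _ ⟨?_⟩ ?_
    · rw [ShortComplex.exact_iff_exact_up_to_refinements]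
      intro A x hx
      obtain ⟨_, P, _, p, _, ⟨hE, -⟩, hP⟩ := EnoughProj.exists_isExact (F := F) A
      have hp : Epi p := hE.epi_g
      have hx' : x ≫ K.d j k = 0 := by
        have e : x ≫ factorThruImage (K.d j k) = 0 := hx
        simpa using e =≫ image.ι (K.d j k)
      obtain ⟨g, hg⟩ := h P hP i j k hij hjk (p ≫ x) (by simp [hx'])
      exact ⟨P, p, hp, g ≫ factorThruImage _, by simp [hg]⟩
    · intro P hP f
      obtain ⟨g, hg⟩ := h P hP j k (k + 1) hjk rfl (f ≫ image.ι _) (by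
        have : image.ι (K.d j k) ≫ K.d k (k + 1) = 0 := by
          simp [← cancel_epi (factorThruImage (K.d j k))]
        simp [this])
      exact ⟨g, by simpa [← cancel_mono (image.ι (K.d j k))] using hg⟩

/-- The stalk complexes `P[n]` of `F`-projective objects, in the homotopy category. -/
def stalkProj : ObjectProperty (HomotopyCategory C (ComplexShape.up ℤ)) :=
  fun X => ∃ (P : C) (n : ℤ), F.IsProj P ∧
    Nonempty (X ≅ (HomotopyCategory.singleFunctor C n).obj P)

instance : F.stalkProj.IsStableUnderShift ℤ where
  isStableUnderShiftBy m :=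
    { le_shift X := by
        rintro ⟨P, n, hP, ⟨e⟩⟩
        exact ⟨P, n - m, hP, ⟨(shiftFunctor _ m).mapIso e ≪≫
          ((HomotopyCategory.singleFunctors C).shiftIso m (n - m) n (by lia)).app P⟩⟩ }

open CochainComplex.HomComplex in
lemma acyclic_eq_rightOrthogonal [F.EnoughProj] :
    F.acyclic = F.stalkProj.rightOrthogonal := by
  ext X
  obtain ⟨K, rfl⟩ := HomotopyCategory.quotient_obj_surjective X
  refine (F.isAcyclic_iff K).trans ⟨?_, ?_⟩
  · rintro h Y f ⟨P, j, hP, ⟨e⟩⟩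
    rw [← cancel_epi e.inv, comp_zero]
    obtain ⟨φ, hφ⟩ := (HomotopyCategory.quotient C (ComplexShape.up ℤ)).map_surjective
      (X := (CochainComplex.singleFunctor C j).obj P) (Y := K) (e.inv ≫ f)
    obtain ⟨g, hg⟩ := Cochain.fromSingleMk_surjective (Cochain.ofHom φ) j (add_zero j)
    refine hφ.symm.trans ((singleFunctor_map_eq_zero_iff P K (j - 1) j (by lia) g φ hg.symm).2 ?_)
    refine h P hP (j - 1) j (j + 1) (by lia) rfl g ?_
    have e₁ := δ_ofHom φ (p := 1)
    rw [← hg, Cochain.δ_fromSingleMk g (add_zero j) 1 (j + 1) rfl] at e₁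
    exact (Cochain.fromSingleEquiv (K := K) (X := P) (n := 1) (p := j) rfl).symm.injective
      (e₁.trans (map_zero _).symm)
  · intro h P hP i j k hij hjk f hf
    let φ := (Cocycle.fromSingleMk f (add_zero j) k hjk hf).homOf
    exact (singleFunctor_map_eq_zero_iff P K i j hij f φ (by simp [φ])).1
      (h _ ⟨P, j, hP, ⟨Iso.refl _⟩⟩)

instance [F.EnoughProj] : F.acyclic.IsTriangulated := by
  rw [acyclic_eq_rightOrthogonal]; infer_instance

instance [F.EnoughProj] : F.acyclic.IsClosedUnderIsomorphisms := by
  rw [acyclic_eq_rightOrthogonal]; infer_instance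

/-- The relative bounded derived category `D_F^b(C)`: the Verdier quotient of `K^b(C)` by the
subcategory of `F`-acyclic complexes. -/
abbrev Db [F.EnoughProj] :=
  (F.acyclic.inverseImage (bounded C).ι).trW.Localization

/-- A bounded complex, as an object of `D_F^b(C)`. -/
noncomputable def toDb [F.EnoughProj] (K : CochainComplex C ℤ) (hK : IsBoundedCpx K) : F.Db :=
  (F.acyclic.inverseImage (bounded C).ι).trW.Q.obj
    ⟨(HomotopyCategory.quotient C (ComplexShape.up ℤ)).obj K, hK⟩

/-- A relative (`F`-)tilting complex. -/
structure IsTilting (T : CochainComplex C ℤ) : Prop where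
  isBounded : IsBoundedCpx T
  isProj (i : ℤ) : F.IsProj (T.X i)
  hom_shift_eq_zero (i : ℤ) (hi : i ≠ 0)
    (f : (HomotopyCategory.quotient C (ComplexShape.up ℤ)).obj T ⟶
      ((HomotopyCategory.quotient C (ComplexShape.up ℤ)).obj T)⟦i⟧) : f = 0
  /-- Every triangulated subcategory of `K(C)` that contains the objects of `K^b(P(F))` lying in
  `add T` contains `K^b(P(F))`. -/
  generates (Q : ObjectProperty (HomotopyCategory C (ComplexShape.up ℤ))) [Q.IsTriangulated]
    [Q.IsClosedUnderIsomorphisms]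
    (hQ : ∀ K : CochainComplex C ℤ, IsBoundedCpx K → (∀ i, F.IsProj (K.X i)) →
      IsInAdd ((HomotopyCategory.quotient C (ComplexShape.up ℤ)).obj T)
        ((HomotopyCategory.quotient C (ComplexShape.up ℤ)).obj K) →
      Q ((HomotopyCategory.quotient C (ComplexShape.up ℤ)).obj K))
    (K : CochainComplex C ℤ) (hK : IsBoundedCpx K) (hK' : ∀ i, F.IsProj (K.X i)) :
    Q ((HomotopyCategory.quotient C (ComplexShape.up ℤ)).obj K)

/-! ### The relative Igusa-Todorov function -/

/-- The relations defining the group `K_F`: `[N] = [X] + [Y]` if `N ≅ X ⊕ Y`, and `[P] = 0` if `P`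
is `F`-projective. -/
def relations : Set (FreeAbelianGroup C) :=
  {x | ∃ N X Y : C, Nonempty (N ≅ X ⊞ Y) ∧
    x = FreeAbelianGroup.of N - FreeAbelianGroup.of X - FreeAbelianGroup.of Y} ∪
  {x | ∃ P : C, F.IsProj P ∧ x = FreeAbelianGroup.of P}

/-- The abelian group `K_F`. -/
abbrev KGroup := FreeAbelianGroup C ⧸ AddSubgroup.closure F.relations

/-- The class `[M]` in `K_F`. -/
def cls (M : C) : F.KGroup := QuotientAddGroup.mk (FreeAbelianGroup.of M)

lemma cls_eq_add {N X Y : C} (e : N ≅ X ⊞ Y) : F.cls N = F.cls X + F.cls Y := by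
  have h : FreeAbelianGroup.of N - FreeAbelianGroup.of X - FreeAbelianGroup.of Y ∈
      AddSubgroup.closure F.relations :=
    AddSubgroup.subset_closure (Or.inl ⟨N, X, Y, ⟨e⟩, rfl⟩)
  have h' : F.cls N - F.cls X - F.cls Y = 0 := (QuotientAddGroup.eq_zero_iff _).2 h
  rw [← sub_eq_zero, ← h']
  abel

lemma cls_eq_zero {P : C} (hP : F.IsProj P) : F.cls P = 0 :=
  (QuotientAddGroup.eq_zero_iff _).2 (AddSubgroup.subset_closure (Or.inr ⟨P, hP, rfl⟩))

lemma cls_eq_of_isExact {K P K' P' M : C} (i : K ⟶ P) (p : P ⟶ M) (w : i ≫ p = 0)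
    (i' : K' ⟶ P') (p' : P' ⟶ M) (w' : i' ≫ p' = 0)
    (h : F.IsExact (ShortComplex.mk i p w)) (h' : F.IsExact (ShortComplex.mk i' p' w'))
    (hP : F.IsProj P) (hP' : F.IsProj P') : F.cls K = F.cls K' := by
  obtain ⟨s, hs⟩ := hP' _ h p'
  obtain ⟨s', hs'⟩ := hP _ h' p
  obtain ⟨e⟩ := nonempty_iso_pullback i p w h.1 p' s hs
  obtain ⟨e'⟩ := nonempty_iso_pullback i' p' w' h'.1 p s' hs'
  have h₁ := F.cls_eq_add e
  have h₂ := F.cls_eq_add ((pullbackSymmetry p' p) ≪≫ e')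
  rw [F.cls_eq_zero hP', add_zero] at h₁
  rw [F.cls_eq_zero hP, add_zero] at h₂
  rw [← h₁, ← h₂]

lemma isExact_biprod [F.EnoughProj] {K P M K' P' M' N : C} (i : K ⟶ P) (p : P ⟶ M)
    (w : i ≫ p = 0) (i' : K' ⟶ P') (p' : P' ⟶ M') (w' : i' ≫ p' = 0)
    (h : F.IsExact (ShortComplex.mk i p w)) (h' : F.IsExact (ShortComplex.mk i' p' w'))
    (e : M ⊞ M' ≅ N) :
    F.IsExact (ShortComplex.mk (biprod.map i i') (biprod.map p p' ≫ e.hom)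
      (by ext <;> simp [reassoc_of% w, reassoc_of% w'])) := by
  have m : Mono i := h.1.mono_f
  have m' : Mono i' := h'.1.mono_f
  have q : Epi p := h.1.epi_g
  have q' : Epi p' := h'.1.epi_g
  refine F.isExact_of_lift _ (.mk' ?_ inferInstance ?_) ?_
  · rw [ShortComplex.exact_iff_exact_up_to_refinements]
    intro A x hx
    have hx' : x ≫ biprod.map p p' = 0 := by
      exact (cancel_mono e.hom).1 ((Category.assoc _ _ _).trans (hx.trans zero_comp.symm))
    have h₁ : (x ≫ biprod.fst) ≫ p = 0 := by simpa using hx' =≫ biprod.fst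
    have h₂ : (x ≫ biprod.snd) ≫ p' = 0 := by simpa using hx' =≫ biprod.snd
    refine ⟨A, 𝟙 A, inferInstance,
      biprod.lift (h.1.exact.lift _ h₁) (h'.1.exact.lift _ h₂), ?_⟩
    have e₁ := h.1.exact.lift_f _ h₁
    have e₂ := h'.1.exact.lift_f _ h₂
    dsimp at e₁ e₂
    apply biprod.hom_ext
    · simp [e₁]
    · simp [e₂]
  · exact epi_comp _ _
  · intro Q hQ f
    obtain ⟨g, hg⟩ := hQ _ h (f ≫ e.inv ≫ biprod.fst)
    obtain ⟨g', hg'⟩ := hQ _ h' (f ≫ e.inv ≫ biprod.snd)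
    refine ⟨biprod.lift g g', ?_⟩
    dsimp at hg hg'
    rw [← cancel_mono e.inv]
    apply biprod.hom_ext
    · simp [hg]
    · simp [hg']

lemma isProj_biprod {P P' : C} (hP : F.IsProj P) (hP' : F.IsProj P') : F.IsProj (P ⊞ P') := by
  intro S hS f
  obtain ⟨g, hg⟩ := hP S hS (biprod.inl ≫ f)
  obtain ⟨g', hg'⟩ := hP' S hS (biprod.inr ≫ f)
  exact ⟨biprod.desc g g', by ext <;> simp [hg, hg']⟩

/-- A relative syzygy of `M`: the kernel of an `F`-epimorphism onto `M` from an `F`-projective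
object. Its class in `K_F` depends only on `M`, see `omega_cls`. -/
noncomputable def syzygy [F.EnoughProj] (M : C) : C :=
  (EnoughProj.exists_isExact (F := F) M).choose

lemma syzygy_spec [F.EnoughProj] (M : C) :
    ∃ (P : C) (i : F.syzygy M ⟶ P) (p : P ⟶ M) (w : i ≫ p = 0),
      F.IsExact (ShortComplex.mk i p w) ∧ F.IsProj P :=
  (EnoughProj.exists_isExact (F := F) M).choose_spec

lemma cls_syzygy_eq [F.EnoughProj] {K P M : C} (i : K ⟶ P) (p : P ⟶ M) (w : i ≫ p = 0)
    (h : F.IsExact (ShortComplex.mk i p w)) (hP : F.IsProj P) :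
    F.cls (F.syzygy M) = F.cls K := by
  obtain ⟨P', i', p', w', h', hP'⟩ := F.syzygy_spec M
  exact F.cls_eq_of_isExact i' p' w' i p w h' h hP' hP

/-- The endomorphism `Ω_F` of `K_F`, with `Ω_F [M] = [Ω_F M]`. -/
noncomputable def omega [F.EnoughProj] : F.KGroup →+ F.KGroup :=
  QuotientAddGroup.lift _ (FreeAbelianGroup.lift fun M => F.cls (F.syzygy M)) (by
    rw [AddSubgroup.closure_le]
    rintro _ (⟨N, X, Y, ⟨e⟩, rfl⟩ | ⟨Q, hQ, rfl⟩)
    · obtain ⟨P, i, p, w, h, hP⟩ := F.syzygy_spec X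
      obtain ⟨P', i', p', w', h', hP'⟩ := F.syzygy_spec Y
      have h₁ := F.cls_syzygy_eq _ _ _ (F.isExact_biprod i p w i' p' w' h h' e.symm)
        (F.isProj_biprod hP hP')
      rw [F.cls_eq_add (Iso.refl _)] at h₁
      simp [h₁]
    · obtain ⟨P, i, p, w, h, hP⟩ := F.syzygy_spec Q
      obtain ⟨s, hs⟩ := hQ _ h (𝟙 Q)
      obtain ⟨e⟩ := nonempty_iso_pullback i p w h.1 (𝟙 Q) s hs
      have h₁ := F.cls_eq_add ((asIso (pullback.snd (𝟙 Q) p)).symm ≪≫ e)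
      rw [F.cls_eq_zero hP, F.cls_eq_zero hQ, add_zero] at h₁
      simp [← h₁])

lemma omega_cls [F.EnoughProj] {K P M : C} (i : K ⟶ P) (p : P ⟶ M) (w : i ≫ p = 0)
    (h : F.IsExact (ShortComplex.mk i p w)) (hP : F.IsProj P) :
    F.omega (F.cls M) = F.cls K := by
  rw [← F.cls_syzygy_eq i p w h hP]
  exact FreeAbelianGroup.lift_apply_of _ _

/-- The subgroup `⟨M⟩` of `K_F` generated by the classes of the indecomposable non-`F`-projective
direct summands of `M`. -/
def summandSubgroup (M : C) : AddSubgroup F.KGroup :=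
  AddSubgroup.closure {x | ∃ N N' : C, Nonempty (M ≅ N ⊞ N') ∧ Indecomposable N ∧
    ¬ F.IsProj N ∧ x = F.cls N}

/-- The subgroup `Ω_F^m ⟨M⟩` of `K_F`. -/
noncomputable def omegaSubgroup [F.EnoughProj] (M : C) (m : ℕ) : AddSubgroup F.KGroup :=
  (AddSubgroup.map F.omega)^[m] (F.summandSubgroup M)

/-- The relative Igusa-Todorov function `φ_F`: the least `k` such that `Ω_F` restricts to a
bijection `Ω_F^m ⟨M⟩ ⟶ Ω_F^{m+1} ⟨M⟩` for every `m ≥ k` (such a `k` exists whenever `⟨M⟩` is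
finitely generated). -/
noncomputable def phi [F.EnoughProj] (M : C) : ℕ∞ :=
  ⨅ (k : ℕ) (_ : ∀ m : ℕ, k ≤ m →
    Set.BijOn F.omega (F.omegaSubgroup M m) (F.omegaSubgroup M (m + 1))), (k : ℕ∞)

/-- The relative `φ`-dimension: the supremum of `φ_F(M)` over all objects `M`. -/
noncomputable def phiDim [F.EnoughProj] : ℕ∞ := ⨆ M : C, F.phi M

end ExtSubfunctor

section Modules

/-- `A` is an Artin algebra: an algebra over a commutative artinian ring `R` that is finitely
generated as an `R`-module. (One may replace `R` by its image in `A`, so that there is no loss in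
taking `R` in the universe of `A`.) -/
class IsArtinAlgebra (A : Type u) [Ring A] : Prop where
  exists_algebra : ∃ (R : Type u) (_ : CommRing R) (_ : Algebra R A),
    IsArtinianRing R ∧ Module.Finite R A

instance (A : Type u) [Ring A] [IsArtinAlgebra A] : IsNoetherianRing A := by
  obtain ⟨R, _, _, _, _⟩ := IsArtinAlgebra.exists_algebra (A := A)
  have : IsNoetherian R A := isNoetherian_of_isNoetherianRing_of_finite R A
  exact isNoetherian_of_tower R this

/-- The category `A-mod` of finitely generated left `A`-modules. -/
abbrev ModFG (A : Type u) [Ring A] := FGModuleCat.{u} A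

instance (A : Type u) [Ring A] [IsNoetherianRing A] : HasExt.{u + 1} (ModFG A) :=
  HasExt.standard _

instance (A : Type u) [Ring A] [IsNoetherianRing A] :
    (ExtSubfunctor.full (ModFG A)).EnoughProj where
  exists_isExact M := by
    obtain ⟨n, p, hp⟩ := Module.Finite.exists_fin' A M
    let P : ModFG A := FGModuleCat.of A (Fin n → A)
    let p' : P ⟶ M := FGModuleCat.ofHom p
    have : Epi p' := ConcreteCategory.epi_of_surjective p' hp
    refine ⟨kernel p', P, kernel.ι p', p', kernel.condition p',
      (ExtSubfunctor.isExact_full_iff _).2 (.mk' (ShortComplex.exact_kernel p')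
        (inferInstanceAs (Mono (kernel.ι p'))) this), ?_⟩
    intro S hS f
    have : Epi S.g := hS.1.epi_g
    have hg : Function.Surjective S.g.hom.hom :=
      (ModuleCat.epi_iff_surjective _).1
        (inferInstanceAs (Epi ((forget₂ (ModFG A) (ModuleCat A)).map S.g)))
    obtain ⟨g, hg⟩ := Module.projective_lifting_property S.g.hom.hom f.hom.hom hg
    exact ⟨FGModuleCat.ofHom g, FGModuleCat.hom_ext hg⟩

end Modules

end RelDer

open CategoryTheory Limits
open scoped ZeroObject

universe v' u'

set_option linter.unusedSectionVars false

/-! ### The stable category, the group `K_F`, and `φ`-dimension as injectivity of `Ω_F`. -/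

namespace RelDer

namespace ExtSubfunctor

variable {C : Type u} [Category.{v} C] [Abelian C] [HasExt.{w} C] (F : ExtSubfunctor.{w} C)

/-! Since every element of `K_F` lies in some `⟨M⟩`, the bound `φ-dim ≤ n` says exactly that `Ω` is
injective on `Ω^n K_F` (`phiDim_le`, `omega_injective_of_phiDim_le`). It therefore suffices to
compare the pairs `(K_F, Ω)` of the two sides.

Index homologically and picture an object `Z` of the derived category as a complex of relative
projectives `Q_i`. Its class in degree `n` is that of `coker (Q_{n+1} ⟶ Q_n)`. `IsTop` characterises
this module, up to projectives, by the maps `Z ⟶ N⟦n⟧`. The class `topCls n` is additive, compatible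
with shifts, zero on objects of projective dimension at most `n`, unchanged when a piece of
projective dimension below `n` is split off by a triangle, and equal to `Ω^k [M]` on `M⟦n - k⟧`.

Let `L` and `L'` be inverse equivalences sending projectives to objects of projective dimension at
most `a` and `b`, with `a + b = t`. Then `L(M)` has homology in degrees at most `a`, so for a
suitable `k` it is a stalk `M'⟦a + k⟧` up to projective dimension `a + k - 1`. Put `Φ[M] = [M']`,
and let `Ψ` be the class in degree `b` of `L'`. Then `Φ Ω = Ω' Φ` and `Ψ Φ = Ω^(t+k)`, so
injectivity of `Ω'` on `Ω'^n` gives that of `Ω` on `Ω^(n+t+k)`; this is `phiDim_le_add`.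

For the absolute structure `k = 0` works (`exists_stalk`). In a relative structure an image need not
sit in an `F`-exact sequence, but the kernel of `Q_{n+1} ⟶ Q_n` is always resolved by the terms
above it, so `k = 2` works (`exists_stalk_add_two`). This is the asymmetry between the two
inequalities. The constants `a` and `b` are read off a radical representative of the tilting
complex, whose terms occupy degrees `m - t` to `m`.

All this is done for an abstract functor `s` satisfying `IsStalkFunctor`, which
`IsSplitStalkFunctor.isStalkFunctor` provides for the Verdier quotient. -/

/-- A morphism that factors through an `F`-projective object. -/
def FactorsProj {X Y : C} (f : X ⟶ Y) : Prop :=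
  ∃ (Q : C) (a : X ⟶ Q) (b : Q ⟶ Y), F.IsProj Q ∧ a ≫ b = f

variable {F}

lemma FactorsProj.comp_left {X Y Z : C} {f : Y ⟶ Z} (hf : F.FactorsProj f) (g : X ⟶ Y) :
    F.FactorsProj (g ≫ f) := by
  obtain ⟨Q, a, b, hQ, rfl⟩ := hf
  exact ⟨Q, g ≫ a, b, hQ, by simp⟩

lemma FactorsProj.comp_right {X Y Z : C} {f : X ⟶ Y} (hf : F.FactorsProj f) (g : Y ⟶ Z) :
    F.FactorsProj (f ≫ g) := by
  obtain ⟨Q, a, b, hQ, rfl⟩ := hf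
  exact ⟨Q, a, b ≫ g, hQ, by simp⟩

lemma FactorsProj.add {X Y : C} {f g : X ⟶ Y} (hf : F.FactorsProj f) (hg : F.FactorsProj g) :
    F.FactorsProj (f + g) := by
  obtain ⟨Q, a, b, hQ, rfl⟩ := hf
  obtain ⟨Q', a', b', hQ', rfl⟩ := hg
  exact ⟨Q ⊞ Q', biprod.lift a a', biprod.desc b b', F.isProj_biprod hQ hQ', by simp⟩

lemma IsProj.factorsProj_left {X Y : C} (hX : F.IsProj X) (f : X ⟶ Y) : F.FactorsProj f :=
  ⟨X, 𝟙 X, f, hX, by simp⟩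

lemma IsProj.factorsProj_right {X Y : C} (hY : F.IsProj Y) (f : X ⟶ Y) : F.FactorsProj f :=
  ⟨Y, f, 𝟙 Y, hY, by simp⟩

lemma IsProj.of_retract {X Y : C} (hY : F.IsProj Y) (i : X ⟶ Y) (r : Y ⟶ X) (h : i ≫ r = 𝟙 X) :
    F.IsProj X := by
  intro S hS f
  obtain ⟨g, hg⟩ := hY S hS (r ≫ f)
  exact ⟨i ≫ g, by rw [Category.assoc, hg, reassoc_of% h]⟩

lemma IsProj.of_iso {X Y : C} (hY : F.IsProj Y) (e : X ≅ Y) : F.IsProj X :=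
  hY.of_retract e.hom e.inv e.hom_inv_id

lemma FactorsProj.isProj {X : C} (h : F.FactorsProj (𝟙 X)) : F.IsProj X := by
  obtain ⟨Q, a, b, hQ, h⟩ := h
  exact hQ.of_retract a b h

lemma isProj_of_isZero {X : C} (h : IsZero X) : F.IsProj X :=
  fun _ _ _ => ⟨0, h.eq_of_src _ _⟩

/-- Objects that are isomorphic in the stable category have the same class. -/
lemma cls_eq_of_stable {M N : C} (f : M ⟶ N) (g : N ⟶ M) (h₁ : F.FactorsProj (𝟙 M - f ≫ g))
    (h₂ : F.FactorsProj (𝟙 N - g ≫ f)) : F.cls M = F.cls N := by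
  obtain ⟨Q, a, b, hQ, hab⟩ := h₁
  -- Adding `Q` to `N` makes `M` a split summand with retraction `r`. Once the complement `ker r` is
  -- shown projective, the two classes agree.
  let r : N ⊞ Q ⟶ M := biprod.desc g b
  let i : M ⟶ N ⊞ Q := biprod.lift f a
  have hir : i ≫ r = 𝟙 M := by simp [i, r, hab]
  let e := kernel.ι r
  have her : e ≫ r = 0 := kernel.condition r
  let p : N ⊞ Q ⟶ kernel r := kernel.lift r (𝟙 _ - r ≫ i) (by simp [hir])
  have hpe : p ≫ e = 𝟙 _ - r ≫ i := kernel.lift_ι _ _ _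
  have hep : e ≫ p = 𝟙 _ := by
    rw [← cancel_mono e, Category.assoc, hpe, Preadditive.comp_sub, reassoc_of% her]
    simp
  have hie : i ≫ p = 0 := by
    rw [← cancel_mono e, Category.assoc, hpe, Preadditive.comp_sub, reassoc_of% hir]
    simp
  have hK : F.IsProj (kernel r) := by
    apply FactorsProj.isProj
    have e₁ : 𝟙 (kernel r) = (e ≫ biprod.fst) ≫ (biprod.inl ≫ p) +
        (e ≫ biprod.snd) ≫ (biprod.inr ≫ p) := by
      rw [← hep, Category.assoc, Category.assoc, ← Preadditive.comp_add, ← Category.assoc biprod.fst,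
        ← Category.assoc biprod.snd, ← Preadditive.add_comp, biprod.total, Category.id_comp]
    have e₂ : (e ≫ biprod.fst) ≫ g = - ((e ≫ biprod.snd) ≫ b) := by
      rw [eq_neg_iff_add_eq_zero, ← her]
      simp [r, biprod.desc_eq]
    -- On `ker r` the component `1 - g f` factors through a projective by assumption, and the
    -- remainder factors through `Q`.
    have e₃ : e ≫ biprod.fst = (e ≫ biprod.fst) ≫ (𝟙 N - g ≫ f) +
        (e ≫ biprod.snd) ≫ (- (b ≫ f)) := by
      have := e₂ =≫ f
      simp only [Category.assoc, Preadditive.neg_comp] at this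
      simp [Preadditive.comp_sub, this]
    rw [e₁]
    refine FactorsProj.add ?_ ((hQ.factorsProj_left _).comp_left _)
    rw [e₃]
    exact ((h₂.comp_left _).add ((hQ.factorsProj_left _).comp_left _)).comp_right _
  have iso : N ⊞ Q ≅ M ⊞ kernel r :=
    { hom := biprod.lift r p
      inv := biprod.desc i e
      hom_inv_id := by simp [hpe]
      inv_hom_id := by ext <;> simp [hir, hie, her, hep] }
  have h := F.cls_eq_add iso
  have h' := F.cls_eq_add (Iso.refl (N ⊞ Q))
  rw [F.cls_eq_zero hK, add_zero] at h
  rw [F.cls_eq_zero hQ, add_zero] at h'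
  rw [← h, ← h']

variable (F) in
lemma factorsProj_zero (X Y : C) : F.FactorsProj (0 : X ⟶ Y) :=
  ⟨0, 0, 0, isProj_of_isZero (isZero_zero C), by simp⟩

/-- Every element of `K_F` is a difference of two classes. -/
lemma exists_cls_sub_cls (x : F.KGroup) : ∃ M N : C, x = F.cls M - F.cls N := by
  obtain ⟨x, rfl⟩ := QuotientAddGroup.mk_surjective x
  have h0 : F.cls (0 : C) = 0 := F.cls_eq_zero (isProj_of_isZero (isZero_zero C))
  have hadd : ∀ X Y : C, F.cls (X ⊞ Y) = F.cls X + F.cls Y := fun X Y => F.cls_eq_add (Iso.refl _)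
  induction x using FreeAbelianGroup.induction_on with
  | zero => exact ⟨0, 0, by simp [h0]⟩
  | of M => exact ⟨M, 0, by rw [h0, sub_zero]; rfl⟩
  | neg M h => exact ⟨0, M, by rw [h0, zero_sub]; rfl⟩
  | add x y hx hy =>
    obtain ⟨M, N, h⟩ := hx
    obtain ⟨M', N', h'⟩ := hy
    refine ⟨M ⊞ M', N ⊞ N', ?_⟩
    rw [QuotientAddGroup.mk_add, h, h', hadd, hadd]
    abel

lemma hom_ext_cls {G : Type*} [AddCommGroup G] {f g : F.KGroup →+ G}
    (h : ∀ M, f (F.cls M) = g (F.cls M)) : f = g := by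
  refine DFunLike.ext _ _ fun x => ?_
  obtain ⟨M, N, rfl⟩ := exists_cls_sub_cls x
  simp [h]

/-- An additive invariant of objects that kills `F`-projectives factors through `K_F`. -/
noncomputable def liftK (F : ExtSubfunctor.{w} C) {G : Type*} [AddCommGroup G] (c : C → G)
    (h₁ : ∀ N X Y : C, (N ≅ X ⊞ Y) → c N = c X + c Y) (h₂ : ∀ P, F.IsProj P → c P = 0) :
    F.KGroup →+ G :=
  QuotientAddGroup.lift _ (FreeAbelianGroup.lift c) (by
    rw [AddSubgroup.closure_le]
    rintro _ (⟨N, X, Y, ⟨e⟩, rfl⟩ | ⟨Q, hQ, rfl⟩)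
    · simp [h₁ _ _ _ e]
    · simp [h₂ _ hQ])

lemma liftK_cls {G : Type*} [AddCommGroup G] (c : C → G)
    (h₁ : ∀ N X Y : C, (N ≅ X ⊞ Y) → c N = c X + c Y) (h₂ : ∀ P, F.IsProj P → c P = 0) (M : C) :
    F.liftK c h₁ h₂ (F.cls M) = c M :=
  FreeAbelianGroup.lift_apply_of _ _

section Phi

variable (F) [F.EnoughProj]

lemma mem_omegaSubgroup_iff (M : C) (m : ℕ) (x : F.KGroup) :
    x ∈ F.omegaSubgroup M m ↔ ∃ y ∈ F.summandSubgroup M, F.omega^[m] y = x := by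
  induction m generalizing x with
  | zero => simp [omegaSubgroup]
  | succ m ih =>
    rw [omegaSubgroup, Function.iterate_succ_apply']
    simp only [Function.iterate_succ_apply', AddSubgroup.mem_map]
    constructor
    · rintro ⟨z, hz, rfl⟩
      obtain ⟨y, hy, rfl⟩ := (ih z).1 hz
      exact ⟨y, hy, rfl⟩
    · rintro ⟨y, hy, rfl⟩
      exact ⟨_, (ih _).2 ⟨y, hy, rfl⟩, rfl⟩

lemma omega_iterate_sub (n : ℕ) (x y : F.KGroup) :
    F.omega^[n] (x - y) = F.omega^[n] x - F.omega^[n] y :=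
  iterate_map_sub F.omega n x y

/-- If `Ω_F` is injective on `Ω_F^n K_F`, then the `φ`-dimension is at most `n`. -/
lemma phiDim_le (n : ℕ) (h : ∀ x : F.KGroup, F.omega^[n + 1] x = 0 → F.omega^[n] x = 0) :
    F.phiDim ≤ n := by
  refine iSup_le fun M => iInf₂_le n fun m hm => ⟨?_, ?_, ?_⟩
  · intro x hx
    obtain ⟨y, hy, rfl⟩ := (F.mem_omegaSubgroup_iff M m x).1 hx
    exact (F.mem_omegaSubgroup_iff M (m + 1) _).2 ⟨y, hy, Function.iterate_succ_apply' _ _ _⟩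
  · intro x hx x' hx' hxx
    obtain ⟨y, -, rfl⟩ := (F.mem_omegaSubgroup_iff M m x).1 hx
    obtain ⟨y', -, rfl⟩ := (F.mem_omegaSubgroup_iff M m x').1 hx'
    obtain ⟨k, rfl⟩ := Nat.exists_eq_add_of_le hm
    rw [← sub_eq_zero, ← omega_iterate_sub, Function.iterate_add_apply]
    apply h
    rw [← Function.iterate_add_apply, show n + 1 + k = (n + k) + 1 by ring,
      Function.iterate_succ_apply', omega_iterate_sub, map_sub, sub_eq_zero]
    exact hxx
  · intro x hx
    obtain ⟨y, hy, rfl⟩ := (F.mem_omegaSubgroup_iff M (m + 1) x).1 hx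
    exact ⟨F.omega^[m] y, (F.mem_omegaSubgroup_iff M m _).2 ⟨y, hy, rfl⟩,
      (Function.iterate_succ_apply' _ _ _).symm⟩

/-- A single `M` with `x ∈ ⟨M⟩` suffices: `φ_F(M) ≤ n` gives injectivity on `Ω^n ⟨M⟩`, which
contains both `Ω^n x` and `0`. -/
lemma omega_injective_of_phiDim_le (hF : ∀ x : F.KGroup, ∃ M, x ∈ F.summandSubgroup M) (n : ℕ)
    (h : F.phiDim ≤ n) (x : F.KGroup) (hx : F.omega^[n + 1] x = 0) : F.omega^[n] x = 0 := by
  obtain ⟨M, hM⟩ := hF x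
  -- A strict bound lets the infimum defining `phi` be unwound to an actual index.
  have h₁ : F.phi M < (n + 1 : ℕ) :=
    lt_of_le_of_lt ((le_iSup _ M).trans h) (by exact_mod_cast Nat.lt_succ_self n)
  simp only [phi, iInf_lt_iff] at h₁
  obtain ⟨k, hk, hkn⟩ := h₁
  have hkn' : k ≤ n := Nat.lt_succ_iff.1 (by exact_mod_cast hkn)
  refine (hk n hkn').injOn ((F.mem_omegaSubgroup_iff M n _).2 ⟨x, hM, rfl⟩)
    (zero_mem _) ?_
  rw [map_zero, ← Function.iterate_succ_apply' F.omega]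
  exact hx

end Phi

end ExtSubfunctor

end RelDer

/-! ### Triangles, extension closures and orthogonality. -/

namespace RelDer

open Pretriangulated Triangulated ObjectProperty

section Triangulated

variable {D : Type u} [Category.{v} D] [Preadditive D] [HasZeroObject D] [HasShift D ℤ]
  [∀ n : ℤ, (shiftFunctor D n).Additive] [Pretriangulated D]

/-- `X ⟶ Y ⟶ Z ⟶ X⟦1⟧` is a distinguished triangle. -/
def Dist {X Y Z : D} (f : X ⟶ Y) (g : Y ⟶ Z) (h : Z ⟶ X⟦(1 : ℤ)⟧) : Prop :=
  Triangle.mk f g h ∈ distTriang D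

namespace Dist

lemma exists_cone {X Y : D} (f : X ⟶ Y) : ∃ (Z : D) (g : Y ⟶ Z) (h : Z ⟶ X⟦(1 : ℤ)⟧), Dist f g h :=
  distinguished_cocone_triangle f

lemma of_iso {X Y Z X' Y' Z' : D} {f : X ⟶ Y} {g : Y ⟶ Z} {h : Z ⟶ X⟦(1 : ℤ)⟧}
    (hT : Dist f g h) {f' : X' ⟶ Y'} {g' : Y' ⟶ Z'} {h' : Z' ⟶ X'⟦(1 : ℤ)⟧}
    (e₁ : X' ≅ X) (e₂ : Y' ≅ Y) (e₃ : Z' ≅ Z) (c₁ : f' ≫ e₂.hom = e₁.hom ≫ f)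
    (c₂ : g' ≫ e₃.hom = e₂.hom ≫ g) (c₃ : h' ≫ e₁.hom⟦(1 : ℤ)⟧' = e₃.hom ≫ h) :
    Dist f' g' h' :=
  isomorphic_distinguished _ hT _ (Triangle.isoMk _ _ e₁ e₂ e₃ c₁ c₂ c₃)

variable {X Y Z W : D} {f : X ⟶ Y} {g : Y ⟶ Z} {h : Z ⟶ X⟦(1 : ℤ)⟧} (hT : Dist f g h)

include hT

lemma comp₁₂ : f ≫ g = 0 := comp_distTriang_mor_zero₁₂ _ hT

lemma comp₂₃ : g ≫ h = 0 := comp_distTriang_mor_zero₂₃ _ hT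

lemma comp₃₁ : h ≫ f⟦(1 : ℤ)⟧' = 0 := comp_distTriang_mor_zero₃₁ _ hT

lemma rot : Dist g h (-f⟦(1 : ℤ)⟧') := rot_of_distTriang _ hT

lemma lift₂ (a : W ⟶ Y) (ha : a ≫ g = 0) : ∃ b : W ⟶ X, b ≫ f = a := by
  obtain ⟨b, hb⟩ := Triangle.coyoneda_exact₂ _ hT a ha
  exact ⟨b, hb.symm⟩

lemma lift₃ (a : W ⟶ Z) (ha : a ≫ h = 0) : ∃ b : W ⟶ Y, b ≫ g = a := by
  obtain ⟨b, hb⟩ := Triangle.coyoneda_exact₃ _ hT a ha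
  exact ⟨b, hb.symm⟩

lemma lift₁ (a : W ⟶ X⟦(1 : ℤ)⟧) (ha : a ≫ f⟦(1 : ℤ)⟧' = 0) : ∃ b : W ⟶ Z, b ≫ h = a := by
  obtain ⟨b, hb⟩ := Triangle.coyoneda_exact₁ _ hT a ha
  exact ⟨b, hb.symm⟩

lemma desc₂ (a : Y ⟶ W) (ha : f ≫ a = 0) : ∃ b : Z ⟶ W, g ≫ b = a := by
  obtain ⟨b, hb⟩ := Triangle.yoneda_exact₂ _ hT a ha
  exact ⟨b, hb.symm⟩

lemma desc₃ (a : Z ⟶ W) (ha : g ≫ a = 0) : ∃ b : X⟦(1 : ℤ)⟧ ⟶ W, h ≫ b = a := by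
  obtain ⟨b, hb⟩ := Triangle.yoneda_exact₃ _ hT a ha
  exact ⟨b, hb.symm⟩

/-- Shifting a distinguished triangle, leaving the signs to the third morphism. -/
lemma shift (n : ℤ) : ∃ h' : Z⟦n⟧ ⟶ X⟦n⟧⟦(1 : ℤ)⟧, Dist (f⟦n⟧') (g⟦n⟧') h' := by
  have hε : n.negOnePow * n.negOnePow = 1 := Int.units_mul_self _
  -- The shifted triangle carries the sign `(-1)^n` on its morphisms; rescaling the two outer
  -- objects by that sign clears the first two.
  let e (W : D) : W ≅ W := ⟨n.negOnePow • 𝟙 W, n.negOnePow • 𝟙 W,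
    by simp [smul_smul, hε], by simp [smul_smul, hε]⟩
  obtain ⟨k, hk⟩ : ∃ k : Z⟦n⟧ ⟶ X⟦n⟧⟦(1 : ℤ)⟧,
      Dist (n.negOnePow • f⟦n⟧') (n.negOnePow • g⟦n⟧') k :=
    ⟨_, Triangle.shift_distinguished _ hT n⟩
  refine ⟨(e _).hom ≫ k ≫ (e _).inv⟦(1 : ℤ)⟧', hk.of_iso (e _) (Iso.refl _) (e _) ?_ ?_ ?_⟩
  · simp [e, smul_smul, hε]
  · simp [e]
  · simp [← Functor.map_comp]

end Dist

/-- The extension closure of a class of objects (including the zero objects). -/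
inductive ExtClosure (S : ObjectProperty D) : ObjectProperty D
  | of (X : D) (h : S X) : ExtClosure S X
  | zero (X : D) (h : IsZero X) : ExtClosure S X
  | ext (T : Triangle D) (hT : T ∈ distTriang D) (h₁ : ExtClosure S T.obj₁)
      (h₃ : ExtClosure S T.obj₃) : ExtClosure S T.obj₂

variable {S S' Q : ObjectProperty D}

instance : (ExtClosure S).IsClosedUnderIsomorphisms where
  of_iso {X Y} e h := by
    have hT : Dist e.hom (0 : Y ⟶ 0) 0 := Dist.of_iso (contractible_distinguished X) (Iso.refl _)
      e.symm (Iso.refl _) (by simp) (by simp) (by simp)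
    exact ExtClosure.ext _ hT h (.zero _ (isZero_zero D))

instance : (ExtClosure S).IsTriangulatedClosed₂ := .mk' fun T hT h₁ h₃ => .ext T hT h₁ h₃

instance : (ExtClosure S).ContainsZero := ⟨⟨0, isZero_zero D, .zero _ (isZero_zero D)⟩⟩

lemma extClosure_le [Q.IsClosedUnderIsomorphisms] [Q.IsTriangulatedClosed₂] [Q.ContainsZero]
    (h : S ≤ Q) : ExtClosure S ≤ Q := by
  intro X hX
  induction hX with
  | of X hX => exact h _ hX
  | zero X hX => exact Q.prop_of_isZero hX
  | ext T hT _ _ h₁ h₃ => exact Q.ext_of_isTriangulatedClosed₂ T hT h₁ h₃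

lemma le_extClosure : S ≤ ExtClosure S := fun X h => .of X h

lemma extClosure_mono (h : S ≤ S') : ExtClosure S ≤ ExtClosure S' :=
  extClosure_le (h.trans le_extClosure)

/-- The triangle splits, so its ends can be exchanged. This is what allows the factors of an
iterated extension to be sorted. -/
lemma Dist.swap {X Y Z : D} {f : X ⟶ Y} {g : Y ⟶ Z} {h : Z ⟶ X⟦(1 : ℤ)⟧} (hT : Dist f g h)
    (h₀ : h = 0) : ∃ (f' : Z ⟶ Y) (g' : Y ⟶ X) (h' : X ⟶ Z⟦(1 : ℤ)⟧), Dist f' g' h' := by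
  obtain ⟨e⟩ : Nonempty (Y ≅ X ⊞ Z) :=
    ⟨(exists_iso_binaryBiproduct_of_distTriang _ hT h₀).choose⟩
  have hT' : Dist (biprod.inl : Z ⟶ Z ⊞ X) biprod.snd 0 := binaryBiproductTriangle_distinguished Z X
  refine ⟨biprod.inr ≫ e.inv, e.hom ≫ biprod.fst, 0, hT'.of_iso (Iso.refl _)
    (e ≪≫ biprod.braiding _ _) (Iso.refl _) ?_ ?_ ?_⟩
  · simp
    ext <;> simp
  · simp
  · simp

/-- The octahedral axiom. -/
lemma Dist.octahedron [IsTriangulated D] {X Y Z A B : D} {f : X ⟶ Y} {g : Y ⟶ Z}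
    {f₁ : Y ⟶ A} {f₂ : A ⟶ X⟦(1 : ℤ)⟧} {g₁ : Z ⟶ B} {g₂ : B ⟶ Y⟦(1 : ℤ)⟧} (hf : Dist f f₁ f₂)
    (hg : Dist g g₁ g₂) :
    ∃ (E : D) (c : Z ⟶ E) (d : E ⟶ X⟦(1 : ℤ)⟧) (a : A ⟶ E) (b : E ⟶ B), Dist (f ≫ g) c d ∧
      Dist a b (g₂ ≫ f₁⟦(1 : ℤ)⟧') := by
  obtain ⟨E, c, d, hE⟩ := exists_cone (f ≫ g)
  let o := someOctahedron rfl hf hg hE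
  exact ⟨E, c, d, o.m₁, o.m₃, hE, o.mem⟩

/-- If there are no nonzero maps from objects of `P` to shifts of objects of `W`, the class
`P * W` is closed under extensions. -/
lemma isTriangulatedClosed₂_extensionProduct [IsTriangulated D] (P W : ObjectProperty D)
    [P.IsClosedUnderIsomorphisms] [P.IsTriangulatedClosed₂]
    [W.IsClosedUnderIsomorphisms] [W.IsTriangulatedClosed₂]
    (h : ∀ X Y, P X → W Y → ∀ f : X ⟶ Y⟦(1 : ℤ)⟧, f = 0) :
    (extensionProduct P W).IsTriangulatedClosed₂ := by
  have swap : extensionProduct W P ≤ extensionProduct P W := by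
    rintro X ⟨A, B, f, g, k, hT, hA, hB⟩
    obtain ⟨f', g', k', hT'⟩ := Dist.swap hT (h _ _ hB hA _)
    exact ⟨_, _, f', g', k', hT', hB, hA⟩
  have hP : extensionProduct P P ≤ P :=
    extensionProduct_le_of_isTriangulatedClosed₂ le_rfl le_rfl
  have hW : extensionProduct W W ≤ W :=
    extensionProduct_le_of_isTriangulatedClosed₂ le_rfl le_rfl
  refine .mk' fun T hT h₁ h₃ => ?_
  -- `(P * W) * (P * W)` is reassociated as `P * (W * P) * W`; swapping the middle puts it inside
  -- `(P * P) * (W * W)`, hence inside `P * W`.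
  have h₂ : extensionProduct (extensionProduct P W) (extensionProduct P W) T.obj₂ :=
    ⟨_, _, T.mor₁, T.mor₂, T.mor₃, hT, h₁, h₃⟩
  rw [extensionProduct_assoc, ← extensionProduct_assoc W] at h₂
  have h₄ := monotone_extensionProduct_right P (monotone_extensionProduct_left W swap) _ h₂
  rw [extensionProduct_assoc, ← extensionProduct_assoc P] at h₄
  exact monotone_extensionProduct_left _ hP _ (monotone_extensionProduct_right _ hW _ h₄)

/-- There is no nonzero morphism `X ⟶ Y`. -/
def Orth (X Y : D) : Prop := ∀ f : X ⟶ Y, f = 0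

lemma Orth.of_iso_left {X X' Y : D} (h : Orth X Y) (e : X ≅ X') : Orth X' Y := fun f => by
  rw [← cancel_epi e.hom, comp_zero]; exact h _

lemma Orth.of_iso_right {X Y Y' : D} (h : Orth X Y) (e : Y ≅ Y') : Orth X Y' := fun f => by
  rw [← cancel_mono e.inv, zero_comp]; exact h _

lemma Orth.shift {X Y : D} (h : Orth X Y) (n : ℤ) : Orth (X⟦n⟧) (Y⟦n⟧) := fun f => by
  obtain ⟨g, rfl⟩ := (shiftFunctor D n).map_surjective f
  rw [h g, Functor.map_zero]

lemma Orth.of_shift {X Y : D} (n : ℤ) (h : Orth (X⟦n⟧) (Y⟦n⟧)) : Orth X Y := fun f =>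
  (shiftFunctor D n).map_injective (by rw [h (f⟦n⟧'), Functor.map_zero])

lemma orth_shift_iff (X Y : D) (n m k : ℤ) (hk : m = n + k) :
    Orth (X⟦n⟧) (Y⟦m⟧) ↔ Orth X (Y⟦k⟧) := by
  have e : Y⟦m⟧ ≅ (Y⟦k⟧)⟦n⟧ := (shiftFunctorAdd' D k n m (by lia)).app Y
  exact ⟨fun h => .of_shift n (h.of_iso_right e), fun h => (h.shift n).of_iso_right e.symm⟩

lemma orth_shift_left_iff (X Y : D) (n m k : ℤ) (hk : m = n + k) :
    Orth (X⟦m⟧) (Y⟦n⟧) ↔ Orth (X⟦k⟧) Y := by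
  have e : X⟦m⟧ ≅ (X⟦k⟧)⟦n⟧ := (shiftFunctorAdd' D k n m (by lia)).app X
  exact ⟨fun h => .of_shift n (h.of_iso_left e), fun h => (h.shift n).of_iso_left e.symm⟩

lemma Orth.of_retract_left {X X' Y : D} (h : Orth X Y) (i : X' ⟶ X) (r : X ⟶ X')
    (hir : i ≫ r = 𝟙 _) : Orth X' Y := fun f => by
  rw [← Category.id_comp f, ← hir, Category.assoc, h (r ≫ f), comp_zero]

lemma Orth.of_retract_right {X Y Y' : D} (h : Orth X Y) (i : Y' ⟶ Y) (r : Y ⟶ Y')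
    (hir : i ≫ r = 𝟙 _) : Orth X Y' := fun f => by
  rw [← Category.comp_id f, ← hir, ← Category.assoc, h (f ≫ i), zero_comp]

lemma Dist.orth_right {X Y Z W : D} {f : X ⟶ Y} {g : Y ⟶ Z} {h : Z ⟶ X⟦(1 : ℤ)⟧}
    (hT : Dist f g h) (h₁ : Orth W X) (h₃ : Orth W Z) : Orth W Y := fun a => by
  obtain ⟨b, rfl⟩ := hT.lift₂ a (h₃ _)
  rw [h₁ b, zero_comp]

lemma Dist.orth_left {X Y Z W : D} {f : X ⟶ Y} {g : Y ⟶ Z} {h : Z ⟶ X⟦(1 : ℤ)⟧}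
    (hT : Dist f g h) (h₁ : Orth X W) (h₃ : Orth Z W) : Orth Y W := fun a => by
  obtain ⟨b, rfl⟩ := hT.desc₂ a (h₁ _)
  rw [h₃ b, comp_zero]

lemma orth_extClosure_left {X Y : D} (hX : ExtClosure S X)
    (h : ∀ X, S X → Orth X Y) : Orth X Y := by
  induction hX with
  | of X hX => exact h _ hX
  | zero X hX => exact fun f => hX.eq_of_src _ _
  | ext T hT _ _ h₁ h₃ => exact Dist.orth_left hT h₁ h₃

lemma orth_extClosure_right {X Y : D} (hY : ExtClosure S Y)
    (h : ∀ Y, S Y → Orth X Y) : Orth X Y := by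
  induction hY with
  | of X hX => exact h _ hX
  | zero X hX => exact fun f => hX.eq_of_tgt _ _
  | ext T hT _ _ h₁ h₃ => exact Dist.orth_right hT h₁ h₃

end Triangulated

end RelDer

/-! ### Axioms for stalk functors and weight truncation. -/

namespace RelDer

open Pretriangulated Triangulated ObjectProperty

/-- An additive functor commutes with binary biproducts. -/
noncomputable def additiveMapBiprod {C : Type u} [Category.{v} C] [Preadditive C]
    [HasBinaryBiproducts C] {D : Type u'} [Category.{v'} D] [Preadditive D] [HasBinaryBiproducts D]
    (G : C ⥤ D) [G.Additive] (X Y : C) : G.obj (X ⊞ Y) ≅ G.obj X ⊞ G.obj Y where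
  hom := biprod.lift (G.map biprod.fst) (G.map biprod.snd)
  inv := biprod.desc (G.map biprod.inl) (G.map biprod.inr)
  hom_inv_id := by
    rw [biprod.lift_desc, ← G.map_comp, ← G.map_comp, ← G.map_add, biprod.total, G.map_id]
  inv_hom_id := by ext <;> simp [← G.map_comp]

variable {C : Type u} [Category.{v} C] [Abelian C] [HasExt.{w} C] (F : ExtSubfunctor.{w} C)
  {D : Type u'} [Category.{v'} D] [Preadditive D] [HasZeroObject D] [HasShift D ℤ]
  [∀ n : ℤ, (shiftFunctor D n).Additive] [Pretriangulated D]

/-- The objects `s(M)⟦n⟧` for `M` satisfying `P` and `n` satisfying `I`. -/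
def stalks (s : C ⥤ D) (P : ObjectProperty C) (I : ℤ → Prop) : ObjectProperty D :=
  fun X => ∃ (M : C) (n : ℤ), P M ∧ I n ∧ Nonempty (X ≅ (s.obj M)⟦n⟧)

/-- `s` has the properties of the functor that sends an object to its stalk complex in the
relative bounded derived category. -/
structure IsStalkFunctor (s : C ⥤ D) : Prop where
  exists_dist {X Y Z : C} (i : X ⟶ Y) (p : Y ⟶ Z) (w : i ≫ p = 0)
    (hE : F.IsExact (ShortComplex.mk i p w)) :
    ∃ δ : s.obj Z ⟶ (s.obj X)⟦(1 : ℤ)⟧, Dist (s.map i) (s.map p) δ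
  map_bijective (Q N : C) (hQ : F.IsProj Q) : Function.Bijective (s.map : (Q ⟶ N) → _)
  orth (Q N : C) (hQ : F.IsProj Q) (n : ℤ) (hn : n ≠ 0) : Orth (s.obj Q) ((s.obj N)⟦n⟧)
  -- This encodes resolving `M` by projectives. The resolution may be infinite, so a finite
  -- dévissage of `M` does not give it; the Verdier quotient obtains it from boundedness in
  -- `map_eq_zero`.
  orth_of_proj (Z : D) (n : ℤ) (h : ∀ Q, F.IsProj Q → ∀ k, n ≤ k → Orth ((s.obj Q)⟦k⟧) Z)
    (M : C) : Orth ((s.obj M)⟦n⟧) Z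
  generates (Z : D) : ExtClosure (stalks s ⊤ fun _ => True) Z

lemma exists_cover [F.EnoughProj] (M : C) : ∃ (K Q : C) (i : K ⟶ Q) (p : Q ⟶ M) (w : i ≫ p = 0),
    F.IsExact (ShortComplex.mk i p w) ∧ F.IsProj Q ∧ Epi p := by
  obtain ⟨K, Q, i, p, w, h, hQ⟩ := ExtSubfunctor.EnoughProj.exists_isExact (F := F) M
  exact ⟨K, Q, i, p, w, h, hQ, h.1.epi_g⟩

namespace IsStalkFunctor

variable {F} [F.EnoughProj] {s : C ⥤ D} [s.Additive] (h : IsStalkFunctor F s)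

include h

lemma proj_orth {Q N : C} (hQ : F.IsProj Q) {k n : ℤ} (hkn : k ≠ n) :
    Orth ((s.obj Q)⟦k⟧) ((s.obj N)⟦n⟧) :=
  (orth_shift_iff _ _ k n (n - k) (by lia)).2 (h.orth Q N hQ _ (by lia))

lemma stalk_orth (M N : C) {k n : ℤ} (hkn : n < k) : Orth ((s.obj M)⟦k⟧) ((s.obj N)⟦n⟧) :=
  h.orth_of_proj _ _ (fun _ hQ _ hk => h.proj_orth hQ (by lia)) _

lemma faithful : s.Faithful where
  map_injective {M N} g g' hg := by
    obtain ⟨K, Q, i, p, w, hE, hQ, hp⟩ := exists_cover F M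
    rw [← cancel_epi p]
    apply (h.map_bijective _ _ hQ).1
    rw [s.map_comp, s.map_comp, hg]

/-- On a cover `Q` of `M` the map is `s(g₀)`, and `g₀` descends to `g : M ⟶ N`. The error factors
through `s(K)⟦1⟧`, which has no maps to `s(N)`. -/
lemma full : s.Full where
  map_surjective {M N} f := by
    have := h.faithful
    obtain ⟨K, Q, i, p, w, hE, hQ, hp⟩ := exists_cover F M
    obtain ⟨g₀, hg₀⟩ := (h.map_bijective _ N hQ).2 (s.map p ≫ f)
    have hi : i ≫ g₀ = 0 := s.map_injective (by
      rw [s.map_comp, hg₀, ← Category.assoc, ← s.map_comp, w, s.map_zero, s.map_zero, zero_comp])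
    obtain ⟨g, hg⟩ : ∃ g, p ≫ g = g₀ := ⟨hE.1.exact.desc g₀ hi, hE.1.exact.g_desc g₀ hi⟩
    obtain ⟨δ, hδ⟩ := h.exists_dist i p w hE
    obtain ⟨t, ht⟩ := hδ.desc₃ (f - s.map g) (by
      rw [Preadditive.comp_sub, ← s.map_comp, hg, hg₀, sub_self])
    refine ⟨g, ?_⟩
    have h₀ : Orth ((s.obj K)⟦(1 : ℤ)⟧) (s.obj N) :=
      (h.stalk_orth K N (show (0 : ℤ) < 1 by lia)).of_iso_right ((shiftFunctorZero D ℤ).app _)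
    rw [h₀ t, comp_zero, eq_comm, sub_eq_zero] at ht
    exact ht.symm

/-- Dimension shifting: modulo a projective in degree `n`, the stalk of `M` in degree `n` becomes
that of its syzygy in degree `n + 1`. -/
lemma exists_cover_distTriang (M : C) (n : ℤ) :
    ∃ (K Q : C) (i : K ⟶ Q) (p : Q ⟶ M) (w : i ≫ p = 0) (δ : (s.obj M)⟦n⟧ ⟶ (s.obj K)⟦n + 1⟧)
      (ε : (s.obj K)⟦n + 1⟧ ⟶ (s.obj Q)⟦n⟧⟦(1 : ℤ)⟧),
      F.IsExact (ShortComplex.mk i p w) ∧ F.IsProj Q ∧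
      Dist ((s.map p)⟦n⟧') δ ε := by
  obtain ⟨K, Q, i, p, w, hE, hQ, -⟩ := exists_cover F M
  obtain ⟨δ, hδ⟩ := h.exists_dist i p w hE
  obtain ⟨ε, hε⟩ := hδ.rot.shift n
  let e : (s.obj K)⟦n + 1⟧ ≅ (s.obj K)⟦(1 : ℤ)⟧⟦n⟧ :=
    (shiftFunctorAdd' D 1 n (n + 1) (by lia)).app _
  refine ⟨K, Q, i, p, w, δ⟦n⟧' ≫ e.inv, e.hom ≫ ε, hE, hQ,
    hε.of_iso (Iso.refl _) (Iso.refl _) e (by simp) (by simp) (by simp)⟩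

lemma closed₂_trunc [IsTriangulated D] (n : ℤ) :
    (extensionProduct (ExtClosure (stalks s F.IsProj (· ≤ n)))
      (ExtClosure (stalks s ⊤ (n < ·)))).IsTriangulatedClosed₂ := by
  refine isTriangulatedClosed₂_extensionProduct _ _ fun X Y hX hY => ?_
  refine orth_extClosure_left hX ?_
  rintro _ ⟨Q, k, hQ, hk, ⟨e⟩⟩
  refine Orth.of_iso_left (X := (s.obj Q)⟦k⟧) ?_ e.symm
  rw [orth_shift_left_iff _ _ 1 k (k - 1) (by lia)]
  refine orth_extClosure_right hY ?_
  rintro _ ⟨N, l, -, hl, ⟨e⟩⟩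
  exact (h.proj_orth hQ (by lia)).of_iso_right e.symm

/-- Weight truncations. -/
lemma trunc [IsTriangulated D] (n : ℤ) (Z : D) :
    extensionProduct (ExtClosure (stalks s F.IsProj (· ≤ n)))
      (ExtClosure (stalks s ⊤ (n < ·))) Z := by
  have := h.closed₂_trunc n
  have : (extensionProduct (ExtClosure (stalks s F.IsProj (· ≤ n)))
      (ExtClosure (stalks s ⊤ (n < ·)))).ContainsZero :=
    ⟨⟨0, isZero_zero D, le_extensionProduct_left _ _ (.zero _ (isZero_zero D))⟩⟩
  refine extClosure_le (S := stalks s ⊤ fun _ => True) ?_ _ (h.generates Z)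
  -- Here `d` bounds how far `k` lies below `n + 1`; each cover puts a projective in degree `k ≤ n`
  -- into the first factor and raises the remaining degree by one.
  suffices ∀ (d : ℕ) (k : ℤ) (_ : n + 1 ≤ k + d) (M : C),
      extensionProduct (ExtClosure (stalks s F.IsProj (· ≤ n)))
        (ExtClosure (stalks s ⊤ (n < ·))) ((s.obj M)⟦k⟧) by
    rintro _ ⟨M, k, -, -, ⟨e⟩⟩
    exact prop_of_iso _ e.symm (this (n + 1 - k).toNat k (by lia) M)
  intro d
  induction d with
  | zero =>
    intro k hk M
    exact le_extensionProduct_right _ _ (.of _ ⟨M, k, trivial, by lia, ⟨Iso.refl _⟩⟩)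
  | succ d ih =>
    intro k hk M
    by_cases hkn : n < k
    · exact le_extensionProduct_right _ _ (.of _ ⟨M, k, trivial, by lia, ⟨Iso.refl _⟩⟩)
    obtain ⟨K, Q, i, p, w, δ, ε, hE, hQ, hT⟩ := h.exists_cover_distTriang M k
    exact ext_of_isTriangulatedClosed₂ _ _ hT
      (le_extensionProduct_left _ _ (.of _ ⟨Q, k, hQ, by lia, ⟨Iso.refl _⟩⟩))
      (ih (k + 1) (by lia) K)

/-- The top term of a bounded complex of projectives. -/
lemma split_top [IsTriangulated D] (n : ℤ) {P : D}
    (hP : ExtClosure (stalks s F.IsProj (· ≤ n)) P) :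
    ∃ (P' : D) (Q : C) (a : P' ⟶ P) (e : P ⟶ (s.obj Q)⟦n⟧) (d : (s.obj Q)⟦n⟧ ⟶ P'⟦(1 : ℤ)⟧),
      Dist a e d ∧ F.IsProj Q ∧
      ExtClosure (stalks s F.IsProj (· ≤ n - 1)) P' := by
  have iso : (stalks s F.IsProj (· = n)).IsClosedUnderIsomorphisms := ⟨by
    rintro X Y e ⟨Q, k, hQ, hk, ⟨e'⟩⟩
    exact ⟨Q, k, hQ, hk, ⟨e.symm ≪≫ e'⟩⟩⟩
  -- Projectives have no self-extensions, so extensions of stalks in one degree split and are again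
  -- single stalks.
  have closed : (stalks s F.IsProj (· = n)).IsTriangulatedClosed₂ := .mk' (by
    rintro T hT ⟨Q₁, n, hQ₁, h₁, ⟨e₁⟩⟩ ⟨Q₃, k, hQ₃, h₃, ⟨e₃⟩⟩
    obtain rfl : n = k := h₁.trans h₃.symm
    have h₀ : T.mor₃ = 0 := by
      refine (Orth.of_iso_left (Orth.of_iso_right
        (Y := (s.obj Q₁)⟦n + 1⟧) (h.proj_orth hQ₃ (N := Q₁) (k := n) (n := n + 1) (by lia))
        ?_) e₃.symm) _
      exact (shiftFunctorAdd' D n 1 (n + 1) rfl).app _ ≪≫ (shiftFunctor D (1 : ℤ)).mapIso e₁.symm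
    obtain ⟨e, -, -⟩ := exists_iso_binaryBiproduct_of_distTriang T hT h₀
    exact ⟨Q₁ ⊞ Q₃, n, F.isProj_biprod hQ₁ hQ₃, h₁,
      ⟨e ≪≫ biprod.mapIso e₁ e₃ ≪≫ (additiveMapBiprod (s ⋙ shiftFunctor D n) Q₁ Q₃).symm⟩⟩)
  have closed' : (extensionProduct (ExtClosure (stalks s F.IsProj (· ≤ n - 1)))
      (stalks s F.IsProj (· = n))).IsTriangulatedClosed₂ := by
    refine isTriangulatedClosed₂_extensionProduct _ _ fun X Y hX hY => ?_
    obtain ⟨Q', _, hQ', rfl, ⟨e'⟩⟩ := hY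
    refine orth_extClosure_left hX ?_
    rintro _ ⟨Q, k, hQ, hk, ⟨e⟩⟩
    refine Orth.of_iso_left (X := (s.obj Q)⟦k⟧) ?_ e.symm
    rw [orth_shift_left_iff _ _ 1 k (k - 1) (by lia)]
    exact (h.proj_orth hQ (by lia)).of_iso_right e'.symm
  have zero : (stalks s F.IsProj (· = n)).ContainsZero :=
    ⟨⟨(s.obj 0)⟦n⟧, (s ⋙ shiftFunctor D n).map_isZero (isZero_zero C), 0, n,
      ExtSubfunctor.isProj_of_isZero (isZero_zero C), rfl, ⟨Iso.refl _⟩⟩⟩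
  have zero' : (extensionProduct (ExtClosure (stalks s F.IsProj (· ≤ n - 1)))
      (stalks s F.IsProj (· = n))).ContainsZero :=
    ⟨⟨0, isZero_zero D, le_extensionProduct_left _ _ (.zero _ (isZero_zero D))⟩⟩
  have key : ExtClosure (stalks s F.IsProj (· ≤ n)) ≤
      extensionProduct (ExtClosure (stalks s F.IsProj (· ≤ n - 1)))
        (stalks s F.IsProj (· = n)) := by
    refine extClosure_le ?_
    rintro X ⟨Q, k, hQ, hk, ⟨e⟩⟩
    by_cases hkn : k = n
    · exact le_extensionProduct_right _ _ ⟨Q, k, hQ, hkn, ⟨e⟩⟩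
    · exact le_extensionProduct_left _ _ (.of _ ⟨Q, k, hQ, by lia, ⟨e⟩⟩)
  obtain ⟨P', W, f, g, k, hT, hP', Q, _, hQ, rfl, ⟨e⟩⟩ := key _ hP
  replace hT : Dist f g k := hT
  exact ⟨P', Q, f, g ≫ e.hom, e.inv ≫ k,
    hT.of_iso (Iso.refl _) (Iso.refl _) e.symm (by simp) (by simp) (by simp), hQ, hP'⟩

end IsStalkFunctor

end RelDer

/-! ### Homological bounds and top approximations. -/

namespace RelDer

open Pretriangulated Triangulated ObjectProperty

namespace Dist

variable {D : Type u} [Category.{v} D] [Preadditive D] [HasZeroObject D] [HasShift D ℤ]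
  [∀ n : ℤ, (shiftFunctor D n).Additive] [Pretriangulated D] {X Y Z W : D}

lemma unrot {f : X ⟶ Y} {g : Y ⟶ Z} {h : Z ⟶ X⟦(1 : ℤ)⟧} (hT : Dist g h (f⟦(1 : ℤ)⟧')) :
    Dist (-f) g h := by
  refine (rotate_distinguished_triangle _).2 ?_
  change Dist g h (-(-f)⟦(1 : ℤ)⟧')
  rwa [Functor.map_neg, neg_neg]

lemma exists_unrot {f : X⟦(1 : ℤ)⟧ ⟶ Y⟦(1 : ℤ)⟧} {g : Y ⟶ Z} {h : Z ⟶ X⟦(1 : ℤ)⟧}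
    (hT : Dist g h f) : ∃ f' : X ⟶ Y, Dist f' g h := by
  obtain ⟨f', rfl⟩ := (shiftFunctor D (1 : ℤ)).map_surjective f
  exact ⟨_, hT.unrot⟩

variable {f : X ⟶ Y} {g : Y ⟶ Z} {h : Z ⟶ X⟦(1 : ℤ)⟧} (hT : Dist f g h)

include hT

lemma desc₁ (a : X ⟶ W) (ha : h ≫ a⟦(1 : ℤ)⟧' = 0) : ∃ b : Y ⟶ W, f ≫ b = a := by
  obtain ⟨b, hb⟩ := hT.rot.desc₃ _ ha
  obtain ⟨b, rfl⟩ := (shiftFunctor D (1 : ℤ)).map_surjective b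
  refine ⟨-b, (shiftFunctor D (1 : ℤ)).map_injective ?_⟩
  rw [← hb]
  simp

lemma cone_iso {Z' : D} {g' : Y ⟶ Z'} {h' : Z' ⟶ X⟦(1 : ℤ)⟧} (hT' : Dist f g' h') :
    Nonempty (Z ≅ Z') :=
  ⟨Triangle.π₃.mapIso (isoTriangleOfIso₁₂ _ _ hT hT' (Iso.refl _) (Iso.refl _)
    ((Category.comp_id _).trans (Category.id_comp _).symm))⟩

lemma isIso₁_of_isZero (hZ : IsZero Z) : IsIso f :=
  (Triangle.isZero₃_iff_isIso₁ _ hT).1 hZ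

end Dist

section

variable {C : Type u} [Category.{v} C] [Abelian C] [HasExt.{w} C] (F : ExtSubfunctor.{w} C)
  {D : Type u'} [Category.{v'} D] [Preadditive D] [HasZeroObject D] [HasShift D ℤ]
  [∀ n : ℤ, (shiftFunctor D n).Additive] [Pretriangulated D] (s : C ⥤ D)

/-- The objects whose relative homology is concentrated in (homological) degrees `≥ n`. -/
def HGE (n : ℤ) (W : D) : Prop := ∀ Q, F.IsProj Q → ∀ k, k < n → Orth ((s.obj Q)⟦k⟧) W

/-- The objects whose relative homology is concentrated in (homological) degrees `≤ n`. -/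
def HLE (n : ℤ) (Z : D) : Prop := ∀ Q, F.IsProj Q → ∀ k, n < k → Orth ((s.obj Q)⟦k⟧) Z

/-- The objects of relative projective dimension `≤ n`. -/
def PLE (n : ℤ) (P : D) : Prop := ∀ N k, n < k → Orth P ((s.obj N)⟦k⟧)

/-- `s(M)⟦n⟧` is the best approximation of `Z` by a stalk complex in degree `n`, up to
projectives. -/
def IsTop (n : ℤ) (Z : D) (M : C) : Prop :=
  ∃ q : Z ⟶ (s.obj M)⟦n⟧,
    (∀ (N : C) (f : Z ⟶ (s.obj N)⟦n⟧), ∃ g : M ⟶ N, q ≫ (s.map g)⟦n⟧' = f) ∧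
    ∀ (N : C) (g : M ⟶ N), q ≫ (s.map g)⟦n⟧' = 0 → F.FactorsProj g

end

variable {C : Type u} [Category.{v} C] [Abelian C] [HasExt.{w} C] {F : ExtSubfunctor.{w} C}
  {D : Type u'} [Category.{v'} D] [Preadditive D] [HasZeroObject D] [HasShift D ℤ]
  [∀ n : ℤ, (shiftFunctor D n).Additive] [Pretriangulated D] {s : C ⥤ D}

lemma PLE.mono {n m : ℤ} {P : D} (hP : PLE s n P) (hnm : n ≤ m) : PLE s m P :=
  fun N k hk => hP N k (by lia)

lemma HLE.mono {n m : ℤ} {P : D} (hP : HLE F s n P) (hnm : n ≤ m) : HLE F s m P :=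
  fun Q hQ k hk => hP Q hQ k (by lia)

lemma PLE.shift {n : ℤ} {P : D} (hP : PLE s n P) (k m : ℤ) (h : m = n + k) : PLE s m (P⟦k⟧) :=
  fun N l hl => (orth_shift_iff _ _ k l (l - k) (by lia)).2 (hP N _ (by lia))

lemma HLE.shift {n : ℤ} {P : D} (hP : HLE F s n P) (k m : ℤ) (h : m = n + k) :
    HLE F s m (P⟦k⟧) :=
  fun Q hQ l hl => (orth_shift_left_iff _ _ k l (l - k) (by lia)).2 (hP Q hQ _ (by lia))

lemma HGE.shift {n : ℤ} {P : D} (hP : HGE F s n P) (k m : ℤ) (h : m = n + k) :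
    HGE F s m (P⟦k⟧) :=
  fun Q hQ l hl => (orth_shift_left_iff _ _ k l (l - k) (by lia)).2 (hP Q hQ _ (by lia))

lemma PLE.of_iso {n : ℤ} {P P' : D} (hP : PLE s n P) (e : P ≅ P') : PLE s n P' :=
  fun N k hk => (hP N k hk).of_iso_left e

lemma IsTop.of_iso {n : ℤ} {Z Z' : D} {M : C} (h : IsTop F s n Z M) (e : Z ≅ Z') :
    IsTop F s n Z' M := by
  obtain ⟨q, h₁, h₂⟩ := h
  refine ⟨e.inv ≫ q, fun N f => ?_, fun N g hg => h₂ N g ?_⟩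
  · obtain ⟨g, hg⟩ := h₁ N (e.hom ≫ f)
    exact ⟨g, by rw [Category.assoc, hg, e.inv_hom_id_assoc]⟩
  · rw [Category.assoc] at hg
    rw [← cancel_epi e.inv, hg, comp_zero]

lemma IsTop.shift {n : ℤ} {Z : D} {M : C} (h : IsTop F s n Z M) (k m : ℤ) (hm : m = n + k) :
    IsTop F s m (Z⟦k⟧) M := by
  obtain ⟨q, h₁, h₂⟩ := h
  let σ : shiftFunctor D m ≅ shiftFunctor D n ⋙ shiftFunctor D k := shiftFunctorAdd' D n k m hm.symm
  have hσ : ∀ {N : C} (g : M ⟶ N), (q⟦k⟧' ≫ σ.inv.app _) ≫ (s.map g)⟦m⟧' =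
      (q ≫ (s.map g)⟦n⟧')⟦k⟧' ≫ σ.inv.app _ := fun g => by
    rw [Category.assoc, Functor.map_comp, Category.assoc]
    congr 1
    exact (σ.inv.naturality (s.map g)).symm
  refine ⟨q⟦k⟧' ≫ σ.inv.app _, fun N f => ?_, fun N g hg => h₂ N g ?_⟩
  · obtain ⟨f', hf'⟩ := (shiftFunctor D k).map_surjective (f ≫ σ.hom.app _)
    obtain ⟨g, rfl⟩ := h₁ N f'
    refine ⟨g, ?_⟩
    rw [hσ, hf', Category.assoc, ← NatTrans.comp_app, σ.hom_inv_id]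
    exact Category.comp_id _
  · rw [hσ, ← cancel_mono (σ.hom.app _), Category.assoc, ← NatTrans.comp_app, σ.inv_hom_id] at hg
    apply (shiftFunctor D k).map_injective
    simpa using hg

variable [s.Additive]

/-- Two tops map to each other compatibly, and the second clause of `IsTop` makes the composites
identities modulo projectives. -/
lemma IsTop.cls_eq {n : ℤ} {Z : D} {M M' : C} (h : IsTop F s n Z M)
    (h' : IsTop F s n Z M') : F.cls M = F.cls M' := by
  obtain ⟨q, h₁, h₂⟩ := h
  obtain ⟨q', h₁', h₂'⟩ := h'
  obtain ⟨f, hf⟩ := h₁ _ q'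
  obtain ⟨g, hg⟩ := h₁' _ q
  refine ExtSubfunctor.cls_eq_of_stable f g (h₂ _ _ ?_) (h₂' _ _ ?_)
  · simp only [Functor.map_sub, CategoryTheory.Functor.map_id, Functor.map_comp, Preadditive.comp_sub,
      Category.comp_id]
    rw [← Category.assoc, hf, hg, sub_self]
  · simp only [Functor.map_sub, CategoryTheory.Functor.map_id, Functor.map_comp, Preadditive.comp_sub,
      Category.comp_id]
    rw [← Category.assoc, hg, hf, sub_self]

lemma IsTop.biprod {n : ℤ} {Z Z' : D} {M M' : C} (h : IsTop F s n Z M)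
    (h' : IsTop F s n Z' M') : IsTop F s n (Z ⊞ Z') (M ⊞ M') := by
  obtain ⟨q, h₁, h₂⟩ := h
  obtain ⟨q', h₁', h₂'⟩ := h'
  have key : ∀ {N : C} (g : M ⊞ M' ⟶ N),
      biprod.desc (q ≫ (s.map biprod.inl)⟦n⟧') (q' ≫ (s.map biprod.inr)⟦n⟧') ≫ (s.map g)⟦n⟧' =
        biprod.desc (q ≫ (s.map (biprod.inl ≫ g))⟦n⟧') (q' ≫ (s.map (biprod.inr ≫ g))⟦n⟧') :=
    fun g => by ext <;> simp
  refine ⟨biprod.desc (q ≫ (s.map biprod.inl)⟦n⟧') (q' ≫ (s.map biprod.inr)⟦n⟧'),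
    fun N f => ?_, fun N g hg => ?_⟩
  · obtain ⟨g, hg⟩ := h₁ N (biprod.inl ≫ f)
    obtain ⟨g', hg'⟩ := h₁' N (biprod.inr ≫ f)
    refine ⟨biprod.desc g g', ?_⟩
    rw [key]
    ext <;> simp [hg, hg']
  · rw [key] at hg
    have e₁ := h₂ _ (biprod.inl ≫ g) ((by simp : _ = biprod.inl ≫ biprod.desc _ _).trans
      ((biprod.inl ≫= hg).trans comp_zero))
    have e₂ := h₂' _ (biprod.inr ≫ g) ((by simp : _ = biprod.inr ≫ biprod.desc _ _).trans
      ((biprod.inr ≫= hg).trans comp_zero))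
    have : g = biprod.fst ≫ (biprod.inl ≫ g) + biprod.snd ≫ (biprod.inr ≫ g) := by
      ext <;> simp
    rw [this]
    exact (e₁.comp_left _).add (e₂.comp_left _)

namespace IsStalkFunctor

variable [F.EnoughProj] (h : IsStalkFunctor F s)

include h

lemma ple_stalk {Q : C} (hQ : F.IsProj Q) (n : ℤ) : PLE s n ((s.obj Q)⟦n⟧) :=
  fun _ _ hk => h.proj_orth hQ hk.ne

lemma ple_of_extClosure {n : ℤ} {P : D} (hP : ExtClosure (stalks s F.IsProj (· ≤ n)) P) :
    PLE s n P := fun N k hk => orth_extClosure_left hP (by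
  rintro _ ⟨Q, l, hQ, hl, ⟨e⟩⟩
  exact (h.proj_orth hQ (by lia)).of_iso_left e.symm)

lemma hle_of_extClosure {n : ℤ} {P : D} (hP : ExtClosure (stalks s F.IsProj (· ≤ n)) P) :
    HLE F s n P := fun Q hQ k hk => orth_extClosure_right hP (by
  rintro _ ⟨Q', l, hQ', hl, ⟨e⟩⟩
  exact (h.proj_orth hQ (by lia)).of_iso_right e.symm)

lemma stalk_orth_hle {n k : ℤ} {Z : D} (hZ : HLE F s n Z) (hk : n < k) (M : C) :
    Orth ((s.obj M)⟦k⟧) Z :=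
  h.orth_of_proj _ _ (fun Q hQ l hl => hZ Q hQ l (by lia)) M

lemma isZero_of_orth {Z : D} (hZ : ∀ Q, F.IsProj Q → ∀ k : ℤ, Orth ((s.obj Q)⟦k⟧) Z) :
    IsZero Z := by
  have : Orth Z Z := orth_extClosure_left (h.generates Z) (by
    rintro _ ⟨M, k, -, -, ⟨e⟩⟩
    exact (h.orth_of_proj _ _ (fun Q hQ l _ => hZ Q hQ l) M).of_iso_left e.symm)
  exact (IsZero.iff_id_eq_zero Z).2 (this _)

variable [IsTriangulated D]

/-- The part `P` of the weight truncation has no maps to `W`, so `W ⟶ W'` is a split monomorphism.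
Orthogonality against `W` can then be tested on stalks. -/
lemma exists_retract_of_hge {n : ℤ} {W : D} (hW : HGE F s (n + 1) W) :
    ∃ (W' : D) (i : W ⟶ W') (r : W' ⟶ W), i ≫ r = 𝟙 W ∧
      ExtClosure (stalks s ⊤ (n < ·)) W' := by
  obtain ⟨P, W', a, b, c, hT, hP, hW'⟩ := h.trunc n W
  have h₀ : Orth P W := orth_extClosure_left hP (by
    rintro _ ⟨Q, l, hQ, hl, ⟨e⟩⟩
    exact (hW Q hQ l (by lia)).of_iso_left e.symm)
  obtain ⟨r, hr⟩ := Dist.desc₂ hT (𝟙 W) (h₀ _)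
  exact ⟨W', b, r, hr, hW'⟩

lemma ple_orth_hge {n : ℤ} {P W : D} (hP : PLE s n P) (hW : HGE F s (n + 1) W) : Orth P W := by
  obtain ⟨W', i, r, hir, hW'⟩ := h.exists_retract_of_hge hW
  refine Orth.of_retract_right (orth_extClosure_right hW' ?_) i r hir
  rintro _ ⟨N, l, -, hl, ⟨e⟩⟩
  exact (hP N l hl).of_iso_right e.symm

lemma hge_orth_hle {n : ℤ} {W Z : D} (hW : HGE F s (n + 1) W) (hZ : HLE F s n Z) : Orth W Z := by
  obtain ⟨W', i, r, hir, hW'⟩ := h.exists_retract_of_hge hW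
  refine Orth.of_retract_left (orth_extClosure_left hW' ?_) i r hir
  rintro _ ⟨N, l, -, hl, ⟨e⟩⟩
  exact (h.stalk_orth_hle hZ hl N).of_iso_left e.symm

/-- The obstruction to lifting along a cover lies in `Hom(P, s(K)⟦n + 1⟧)`, which vanishes. -/
lemma lift_cover {n : ℤ} {P : D} (hP : PLE s n P) {N : C} (f : P ⟶ (s.obj N)⟦n⟧) :
    ∃ (Q : C) (p : Q ⟶ N) (g : P ⟶ (s.obj Q)⟦n⟧), F.IsProj Q ∧ g ≫ (s.map p)⟦n⟧' = f := by
  obtain ⟨K, Q, i, p, w, δ, ε, hE, hQ, hT⟩ := h.exists_cover_distTriang N n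
  obtain ⟨g, hg⟩ := hT.lift₂ f (hP K (n + 1) (by lia) _)
  exact ⟨Q, p, g, hQ, hg⟩

/-- Maps from `P` to stalks in degree `n` vanish, so maps out of `Z` come from `Z'`. The resulting
ambiguity factors through `P⟦1⟧`, of projective dimension at most `n`, hence through a projective in
degree `n` by `lift_cover`. -/
lemma isTop_of_dist {n : ℤ} {P Z Z' : D} {a : P ⟶ Z} {b : Z ⟶ Z'} {c : Z' ⟶ P⟦(1 : ℤ)⟧}
    (hT : Dist a b c) (hP : PLE s (n - 1) P) {M : C} (hM : IsTop F s n Z' M) :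
    IsTop F s n Z M := by
  obtain ⟨q, h₁, h₂⟩ := hM
  refine ⟨b ≫ q, fun N f => ?_, fun N g hg => ?_⟩
  · obtain ⟨f', rfl⟩ := hT.desc₂ f (hP N n (by lia) _)
    obtain ⟨g, rfl⟩ := h₁ N f'
    exact ⟨g, by simp⟩
  · obtain ⟨v, hv⟩ := hT.desc₃ (q ≫ (s.map g)⟦n⟧') (by simpa using hg)
    obtain ⟨Q, p, u, hQ, rfl⟩ := h.lift_cover (hP.shift 1 n (by lia)) v
    obtain ⟨g', hg'⟩ := h₁ Q (c ≫ u)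
    have e : F.FactorsProj (g - g' ≫ p) := h₂ _ _ (by
      simp only [Functor.map_sub, Functor.map_comp, Preadditive.comp_sub]
      rw [← hv, ← Category.assoc q, hg', Category.assoc, sub_self])
    simpa using e.add ((hQ.factorsProj_right g').comp_right p)

/-- The universal map lifts through a cover of `M`; by universality the identity of `M` then factors
through a projective. -/
lemma isTop_ple {n : ℤ} {P : D} (hP : PLE s n P) {M : C} (hM : IsTop F s n P M) :
    F.IsProj M := by
  obtain ⟨q, h₁, h₂⟩ := hM
  obtain ⟨Q, p, u, hQ, hu⟩ := h.lift_cover hP q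
  obtain ⟨g, rfl⟩ := h₁ Q u
  apply ExtSubfunctor.FactorsProj.isProj
  have e : F.FactorsProj (𝟙 M - g ≫ p) := h₂ _ _ (by
    simp only [Functor.map_sub, Functor.map_comp, Preadditive.comp_sub, CategoryTheory.Functor.map_id]
    rw [← Category.assoc q, hu, Category.comp_id, sub_self])
  simpa using e.add ((hQ.factorsProj_right g).comp_right p)

lemma isTop_stalk (n : ℤ) (M : C) : IsTop F s n ((s.obj M)⟦n⟧) M := by
  have := h.full
  have := h.faithful
  refine ⟨𝟙 _, fun N f => ?_, fun N g hg => ?_⟩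
  · obtain ⟨g, hg⟩ := (s ⋙ shiftFunctor D n).map_surjective f
    exact ⟨g, by rw [Category.id_comp]; exact hg⟩
  · have : g = 0 := (s ⋙ shiftFunctor D n).map_injective (by simpa using hg)
    rw [this]
    exact F.factorsProj_zero _ _

/-- A rotation of `split_top` exposing the attaching map `u` of the top term, from which the
differential `α` is read off below. -/
lemma split_top' (n : ℤ) {P : D} (hP : ExtClosure (stalks s F.IsProj (· ≤ n + 1)) P) :
    ∃ (P' : D) (Q : C) (u : (s.obj Q)⟦n⟧ ⟶ P') (a : P' ⟶ P) (e : P ⟶ (s.obj Q)⟦n⟧⟦(1 : ℤ)⟧),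
      Dist u a e ∧ F.IsProj Q ∧ ExtClosure (stalks s F.IsProj (· ≤ n)) P' := by
  obtain ⟨P', Q, a, e, d, hT, hQ, hP'⟩ := h.split_top _ hP
  rw [add_sub_cancel_right] at hP'
  let σ : (s.obj Q)⟦n⟧⟦(1 : ℤ)⟧ ≅ (s.obj Q)⟦n + 1⟧ := (shiftFunctorAdd' D n 1 (n + 1) rfl).symm.app _
  have hT' : Dist a (e ≫ σ.inv) (σ.hom ≫ d) :=
    hT.of_iso (Iso.refl _) (Iso.refl _) σ (by simp) (by simp) (by simp)
  obtain ⟨u, hu⟩ := hT'.exists_unrot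
  exact ⟨P', Q, u, a, _, hu, hQ, hP'⟩

end IsStalkFunctor

end RelDer

/-! ### Existence of tops, their classes, and reduction to stalks. -/

namespace RelDer

open Pretriangulated Triangulated ObjectProperty

variable {C : Type u} [Category.{v} C] [Abelian C] [HasExt.{w} C] {F : ExtSubfunctor.{w} C}
  {D : Type u'} [Category.{v'} D] [Preadditive D] [HasZeroObject D] [HasShift D ℤ]
  [∀ n : ℤ, (shiftFunctor D n).Additive] [Pretriangulated D] {s : C ⥤ D}
  [s.Additive] [F.EnoughProj] [IsTriangulated D]

namespace IsStalkFunctor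

variable (h : IsStalkFunctor F s)

include h

/-- The top is `coker α`, where `α : Q₁ ⟶ Q₀` is the differential from degree `n + 1` to degree `n`
in a weight truncation of `Z`. -/
lemma exists_isTop (n : ℤ) (Z : D) : ∃ M, IsTop F s n Z M := by
  have := h.full
  have := h.faithful
  obtain ⟨P, W, a, b, c, hT, hP, hW⟩ := h.trunc (n + 1) Z
  replace hT : Dist a b c := hT
  obtain ⟨P₁, Q₁, u, a₁, e₁, hT₁, hQ₁, hP₁⟩ := h.split_top' n hP
  obtain ⟨P₀, Q₀, a₀, e₀, d₀, hT₀, hQ₀, hP₀⟩ := h.split_top n hP₁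
  obtain ⟨α, hα⟩ : ∃ α : Q₁ ⟶ Q₀, (s.map α)⟦n⟧' = u ≫ e₀ :=
    (s ⋙ shiftFunctor D n).map_surjective (u ≫ e₀)
  have hinj : ∀ {X Y : C} (f : X ⟶ Y), (s.map f)⟦n⟧' = 0 → f = 0 := fun f hf =>
    (s ⋙ shiftFunctor D n).map_injective (by simpa using hf)
  -- Vanishing in degree `n + 1` extends maps from `P` to `Z`; vanishing in degree `n` makes the
  -- extension unique.
  have hW' : ∀ (N : C) (k : ℤ) (_ : k ≤ n + 1), Orth W ((s.obj N)⟦k⟧) := fun N k hk =>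
    orth_extClosure_left hW (by
      rintro _ ⟨M, l, -, hl, ⟨e⟩⟩
      exact (h.stalk_orth M N (by lia)).of_iso_left e.symm)
  have hsh : ∀ N : C, (s.obj N)⟦n⟧⟦(1 : ℤ)⟧ ≅ (s.obj N)⟦n + 1⟧ := fun N =>
    (shiftFunctorAdd' D n 1 (n + 1) rfl).symm.app _
  let π := cokernel.π α
  have hαπ : α ≫ π = 0 := cokernel.condition α
  obtain ⟨q₁, hq₁⟩ := hT₁.desc₂ (e₀ ≫ (s.map π)⟦n⟧') (by
    rw [← Category.assoc, ← hα, ← Functor.map_comp, ← s.map_comp, hαπ, s.map_zero,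
      Functor.map_zero])
  obtain ⟨q, hq⟩ := hT.desc₁ q₁ (((hW' _ _ le_rfl).of_iso_right (hsh _).symm) _)
  have hq₀ : ∀ {N : C} (g : cokernel α ⟶ N),
      a₁ ≫ a ≫ q ≫ (s.map g)⟦n⟧' = e₀ ≫ (s.map (π ≫ g))⟦n⟧' := fun g => by
    rw [reassoc_of% hq, reassoc_of% hq₁, s.map_comp, Functor.map_comp]
  refine ⟨cokernel α, q, fun N f => ?_, fun N g hg => ?_⟩
  · obtain ⟨k, hk⟩ := hT₀.desc₂ (a₁ ≫ a ≫ f) (h.ple_of_extClosure hP₀ N n (by lia) _)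
    obtain ⟨g₀, rfl⟩ : ∃ g₀ : Q₀ ⟶ N, (s.map g₀)⟦n⟧' = k :=
      (s ⋙ shiftFunctor D n).map_surjective k
    have hg₀ : α ≫ g₀ = 0 := hinj _ (by
      rw [s.map_comp, Functor.map_comp, hα, Category.assoc, hk, reassoc_of% hT₁.comp₁₂, zero_comp])
    let g : cokernel α ⟶ N := cokernel.desc α g₀ hg₀
    have hg : π ≫ g = g₀ := cokernel.π_desc _ _ _
    refine ⟨g, ?_⟩
    have z₁ : a₁ ≫ a ≫ (q ≫ (s.map g)⟦n⟧' - f) = 0 := by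
      rw [Preadditive.comp_sub, Preadditive.comp_sub, hq₀, hg, hk, sub_self]
    have z₂ : a ≫ (q ≫ (s.map g)⟦n⟧' - f) = 0 := by
      obtain ⟨t, ht⟩ := hT₁.desc₃ _ z₁
      rw [← ht, ((h.stalk_orth Q₁ N (show n < n + 1 by lia)).of_iso_left (hsh _).symm) t, comp_zero]
    obtain ⟨t, ht⟩ := hT.desc₂ _ z₂
    rw [hW' N n (by lia) t, comp_zero] at ht
    exact sub_eq_zero.1 ht.symm
  · have hz : e₀ ≫ (s.map (π ≫ g))⟦n⟧' = 0 := by rw [← hq₀, hg, comp_zero, comp_zero]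
    obtain ⟨v, hv⟩ := hT₀.desc₃ _ hz
    obtain ⟨Q, p, w, hQ, rfl⟩ := h.lift_cover
      ((h.ple_of_extClosure hP₀).shift 1 n (by lia)) v
    obtain ⟨u₀, hu₀⟩ : ∃ u₀ : Q₀ ⟶ Q, (s.map u₀)⟦n⟧' = d₀ ≫ w :=
      (s ⋙ shiftFunctor D n).map_surjective (d₀ ≫ w)
    have hu₁ : α ≫ u₀ = 0 := hinj _ (by
      rw [s.map_comp, Functor.map_comp, hα, hu₀, Category.assoc, reassoc_of% hT₀.comp₂₃,
        zero_comp, comp_zero])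
    have hp : π ≫ cokernel.desc α u₀ hu₁ = u₀ := cokernel.π_desc _ _ _
    refine ⟨Q, cokernel.desc α u₀ hu₁, p, hQ, ?_⟩
    rw [← cancel_epi π, reassoc_of% hp]
    apply (s ⋙ shiftFunctor D n).map_injective
    change (s.map _)⟦n⟧' = (s.map _)⟦n⟧'
    rw [← hv, s.map_comp, Functor.map_comp, hu₀, Category.assoc]

/-- The class in `K_F` of the `n`-th relative syzygy-like invariant of `Z`. -/
noncomputable def topCls (n : ℤ) (Z : D) : F.KGroup := F.cls (h.exists_isTop n Z).choose

lemma topCls_eq {n : ℤ} {Z : D} {M : C} (hM : IsTop F s n Z M) : h.topCls n Z = F.cls M :=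
  (h.exists_isTop n Z).choose_spec.cls_eq hM

lemma topCls_iso (n : ℤ) {Z Z' : D} (e : Z ≅ Z') : h.topCls n Z = h.topCls n Z' := by
  obtain ⟨M, hM⟩ := h.exists_isTop n Z
  rw [h.topCls_eq hM, h.topCls_eq (hM.of_iso e)]

lemma topCls_shift (n k m : ℤ) (hm : m = n + k) (Z : D) :
    h.topCls m (Z⟦k⟧) = h.topCls n Z := by
  obtain ⟨M, hM⟩ := h.exists_isTop n Z
  rw [h.topCls_eq hM, h.topCls_eq (hM.shift k m hm)]

lemma topCls_biprod (n : ℤ) (Z Z' : D) :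
    h.topCls n (Z ⊞ Z') = h.topCls n Z + h.topCls n Z' := by
  obtain ⟨M, hM⟩ := h.exists_isTop n Z
  obtain ⟨M', hM'⟩ := h.exists_isTop n Z'
  rw [h.topCls_eq hM, h.topCls_eq hM', h.topCls_eq (hM.biprod hM'), F.cls_eq_add (Iso.refl _)]

lemma topCls_of_dist {n : ℤ} {P Z Z' : D} {a : P ⟶ Z} {b : Z ⟶ Z'} {c : Z' ⟶ P⟦(1 : ℤ)⟧}
    (hT : Dist a b c) (hP : PLE s (n - 1) P) : h.topCls n Z = h.topCls n Z' := by
  obtain ⟨M, hM⟩ := h.exists_isTop n Z'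
  rw [h.topCls_eq hM, h.topCls_eq (h.isTop_of_dist hT hP hM)]

lemma topCls_eq_zero {n : ℤ} {P : D} (hP : PLE s n P) : h.topCls n P = 0 := by
  obtain ⟨M, hM⟩ := h.exists_isTop n P
  rw [h.topCls_eq hM, F.cls_eq_zero (h.isTop_ple hP hM)]

/-- Each cover triangle removes a projective in degree `n`, invisible in degrees above `n`, and
replaces `M` by its syzygy one degree higher. -/
lemma topCls_stalk (n : ℤ) (k : ℕ) (M : C) :
    h.topCls (n + k) ((s.obj M)⟦n⟧) = F.omega^[k] (F.cls M) := by
  induction k generalizing n M with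
  | zero =>
    rw [Nat.cast_zero, add_zero]
    exact h.topCls_eq (h.isTop_stalk n M)
  | succ k ih =>
    obtain ⟨K, Q, i, p, w, δ, ε, hE, hQ, hT⟩ := h.exists_cover_distTriang M n
    rw [h.topCls_of_dist hT ((h.ple_stalk hQ n).mono (by push_cast; lia)),
      show n + ((k + 1 : ℕ) : ℤ) = n + 1 + k by push_cast; ring, ih,
      Function.iterate_succ_apply, F.omega_cls i p w hE hQ]

/-- An object whose relative homology is concentrated in degrees `≤ n` is, up to an object of
relative projective dimension `≤ n + 1`, a stalk complex in degree `n + 2`. -/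
lemma exists_stalk_add_two {n : ℤ} {Z : D} (hZ : HLE F s n Z) :
    ∃ (P : D) (M : C) (a : P ⟶ Z) (b : Z ⟶ (s.obj M)⟦n + 2⟧)
      (c : (s.obj M)⟦n + 2⟧ ⟶ P⟦(1 : ℤ)⟧), Dist a b c ∧
      ExtClosure (stalks s F.IsProj (· ≤ n + 1)) P := by
  have := h.full
  have := h.faithful
  obtain ⟨P, W, a, b, c, hT, hP, hW⟩ := h.trunc (n + 1) Z
  replace hT : Dist a b c := hT
  obtain ⟨P₁, Q₁, u, a₁, e₁, hT₁, hQ₁, hP₁⟩ := h.split_top' n hP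
  obtain ⟨P₀, Q₀, a₀, e₀, d₀, hT₀, hQ₀, hP₀⟩ := h.split_top n hP₁
  obtain ⟨α, hα⟩ : ∃ α : Q₁ ⟶ Q₀, (s.map α)⟦n⟧' = u ≫ e₀ :=
    (s ⋙ shiftFunctor D n).map_surjective (u ≫ e₀)
  let ι := kernel.ι α
  have hια : ι ≫ α = 0 := kernel.condition α
  have hsh : ∀ N : C, (s.obj N)⟦n⟧⟦(1 : ℤ)⟧ ≅ (s.obj N)⟦n + 1⟧ := fun N =>
    (shiftFunctorAdd' D n 1 (n + 1) rfl).symm.app _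
  have hsh' : ∀ N : C, (s.obj N)⟦n⟧⟦(1 : ℤ)⟧⟦(1 : ℤ)⟧ ≅ (s.obj N)⟦n + 2⟧ := fun N =>
    (shiftFunctor D (1 : ℤ)).mapIso (hsh N) ≪≫
      (shiftFunctorAdd' D (n + 1) 1 (n + 2) (by lia)).symm.app _
  -- The inclusion of `ker α` is lifted successively to `P` and to `W`. The first obstruction
  -- vanishes because `P₀` lives below degree `n`, the second because `Z` has no homology in degree
  -- `n + 1`. The result is `μ`, from `ker α` in degree `n + 2` to `W`.
  have hιu : (s.map ι)⟦n⟧' ≫ u = 0 := by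
    obtain ⟨t, ht⟩ := hT₀.lift₂ ((s.map ι)⟦n⟧' ≫ u) (by
      rw [Category.assoc, ← hα, ← Functor.map_comp, ← s.map_comp, hια, s.map_zero,
        Functor.map_zero])
    rw [← ht, h.stalk_orth_hle (h.hle_of_extClosure hP₀) (show n - 1 < n by lia) _ t, zero_comp]
  obtain ⟨μ₀, hμ₀⟩ := hT₁.lift₁ ((s.map ι)⟦n⟧'⟦(1 : ℤ)⟧') (by
    rw [← Functor.map_comp, hιu, Functor.map_zero])
  obtain ⟨μ, hμ⟩ := hT.lift₁ (μ₀⟦(1 : ℤ)⟧') (by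
    rw [← Functor.map_comp, ((h.stalk_orth_hle hZ (show n < n + 1 by lia) _).of_iso_left
      (hsh _).symm) (μ₀ ≫ a), Functor.map_zero])
  -- Relative homology of `W` is confined to degree `n + 2`: below by the truncation, above by the
  -- bounds on `Z` and `P⟦1⟧`.
  have hW₁ : ∀ Q, F.IsProj Q → ∀ k : ℤ, k ≠ n + 2 → Orth ((s.obj Q)⟦k⟧) W := fun Q hQ k hk => by
    rcases lt_or_gt_of_ne hk with hk | hk
    · refine orth_extClosure_right hW ?_
      rintro _ ⟨N, l, -, hl, ⟨e⟩⟩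
      exact (h.proj_orth hQ (by lia)).of_iso_right e.symm
    · refine hT.rot.orth_right (hZ Q hQ k (by lia)) ?_
      rw [orth_shift_left_iff _ _ 1 k (k - 1) (by lia)]
      exact h.hle_of_extClosure hP Q hQ _ (by lia)
  have hinj : ∀ Q, F.IsProj Q → ∀ x : (s.obj Q)⟦n⟧⟦(1 : ℤ)⟧⟦(1 : ℤ)⟧ ⟶ W,
      x ≫ c ≫ e₁⟦(1 : ℤ)⟧' = 0 → x = 0 := fun Q hQ x hx => by
    obtain ⟨τ, hτ⟩ := hT₁.rot.shift 1
    obtain ⟨y, hy⟩ := hτ.lift₂ (x ≫ c) (by rwa [Category.assoc])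
    have hy₀ : y = 0 := (((h.hle_of_extClosure hP₁).shift 1 (n + 1) rfl) Q hQ (n + 2)
      (by lia)).of_iso_left (hsh' Q).symm y
    obtain ⟨z, hz⟩ := hT.lift₃ x (by rw [← hy, hy₀, zero_comp])
    rw [← hz, (hZ Q hQ (n + 2) (by lia)).of_iso_left (hsh' Q).symm z, zero_comp]
  have hS : ∀ {X Y : C} (f : X ⟶ Y), (s.map f)⟦n⟧'⟦(1 : ℤ)⟧'⟦(1 : ℤ)⟧' = 0 → f = 0 := fun f hf =>
    (s ⋙ shiftFunctor D n ⋙ shiftFunctor D (1 : ℤ) ⋙ shiftFunctor D (1 : ℤ)).map_injective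
      (by simpa using hf)
  have hS' : ∀ {X Y : C} (f : (s.obj X)⟦n⟧⟦(1 : ℤ)⟧⟦(1 : ℤ)⟧ ⟶ (s.obj Y)⟦n⟧⟦(1 : ℤ)⟧⟦(1 : ℤ)⟧),
      ∃ g : X ⟶ Y, (s.map g)⟦n⟧'⟦(1 : ℤ)⟧'⟦(1 : ℤ)⟧' = f := fun f =>
    (s ⋙ shiftFunctor D n ⋙ shiftFunctor D (1 : ℤ) ⋙ shiftFunctor D (1 : ℤ)).map_surjective f
  have hμ' : ∀ {X : C} (g : X ⟶ kernel α), (s.map g)⟦n⟧'⟦(1 : ℤ)⟧'⟦(1 : ℤ)⟧' ≫ μ ≫ c ≫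
      e₁⟦(1 : ℤ)⟧' = (s.map (g ≫ ι))⟦n⟧'⟦(1 : ℤ)⟧'⟦(1 : ℤ)⟧' := fun g => by
    rw [reassoc_of% hμ, ← Functor.map_comp, hμ₀]
    simp only [Functor.map_comp]
  have hmono : ∀ Q, F.IsProj Q → ∀ x : (s.obj Q)⟦n⟧⟦(1 : ℤ)⟧⟦(1 : ℤ)⟧ ⟶
      (s.obj (kernel α))⟦n⟧⟦(1 : ℤ)⟧⟦(1 : ℤ)⟧, x ≫ μ = 0 → x = 0 := fun Q hQ x hx => by
    obtain ⟨g, rfl⟩ := hS' x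
    have hg : g ≫ ι = 0 := hS _ (by rw [← hμ', reassoc_of% hx, zero_comp])
    rw [← zero_comp (f := ι), cancel_mono] at hg
    simp [hg]
  have hepi : ∀ Q, F.IsProj Q → ∀ y : (s.obj Q)⟦n⟧⟦(1 : ℤ)⟧⟦(1 : ℤ)⟧ ⟶ W, ∃ x, x ≫ μ = y :=
      fun Q hQ y => by
    obtain ⟨φ, hφ⟩ := hS' (y ≫ c ≫ e₁⟦(1 : ℤ)⟧')
    have hφα : φ ≫ α = 0 := hS _ (by
      rw [s.map_comp, Functor.map_comp, Functor.map_comp, Functor.map_comp, hφ, hα,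
        Functor.map_comp, Functor.map_comp, Category.assoc, Category.assoc,
        ← Functor.map_comp_assoc, hT₁.comp₃₁, Functor.map_zero, zero_comp, comp_zero, comp_zero])
    have hι : kernel.lift α φ hφα ≫ ι = φ := kernel.lift_ι _ _ _
    refine ⟨(s.map (kernel.lift α φ hφα))⟦n⟧'⟦(1 : ℤ)⟧'⟦(1 : ℤ)⟧', sub_eq_zero.1 (hinj Q hQ _ ?_)⟩
    rw [Preadditive.sub_comp, Category.assoc, hμ', hι, hφ, sub_self]
  obtain ⟨E, μ₁, μ₂, hE⟩ := Dist.exists_cone μ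
  -- By `hmono` and `hepi`, `μ` is bijective on maps from projectives in degree `n + 2`. Its cone
  -- receives no maps from projective stalks, and these detect zero objects; degree `n + 3` is where
  -- injectivity is needed.
  have hE₀ : IsZero E := h.isZero_of_orth fun Q hQ k f => by
    have hf : f ≫ μ₂ = 0 := by
      by_cases hk : k = n + 3
      · subst hk
        let e : (s.obj Q)⟦n + 3⟧ ≅ (s.obj Q)⟦n⟧⟦(1 : ℤ)⟧⟦(1 : ℤ)⟧⟦(1 : ℤ)⟧ :=
          (shiftFunctorAdd' D (n + 2) 1 (n + 3) (by lia)).app _ ≪≫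
            (shiftFunctor D (1 : ℤ)).mapIso (hsh' Q).symm
        obtain ⟨g, hg⟩ := (shiftFunctor D (1 : ℤ)).map_surjective (e.inv ≫ f ≫ μ₂)
        have hg₀ : g = 0 := hmono Q hQ g ((shiftFunctor D (1 : ℤ)).map_injective (by
          rw [Functor.map_comp, hg, Category.assoc, Category.assoc, hE.comp₃₁, comp_zero,
            comp_zero, Functor.map_zero]))
        rw [← cancel_epi e.inv, ← hg, hg₀, comp_zero, Functor.map_zero]
      · have : Orth ((s.obj Q)⟦k⟧) ((s.obj (kernel α))⟦n + 3⟧) := h.proj_orth hQ hk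
        exact this.of_iso_right ((shiftFunctorAdd' D (n + 2) 1 (n + 3) (by lia)).app _ ≪≫
            (shiftFunctor D (1 : ℤ)).mapIso (hsh' _).symm) _
    obtain ⟨y, rfl⟩ := hE.lift₃ f hf
    by_cases hk : k = n + 2
    · subst hk
      obtain ⟨x, hx⟩ := hepi Q hQ ((hsh' Q).hom ≫ y)
      rw [← cancel_epi (hsh' Q).hom, ← Category.assoc, ← hx, Category.assoc, hE.comp₁₂, comp_zero,
        comp_zero]
    · rw [hW₁ Q hQ k hk y, zero_comp]
  have := hE.isIso₁_of_isZero hE₀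
  let e : W ≅ (s.obj (kernel α))⟦n + 2⟧ := (asIso μ).symm ≪≫ hsh' _
  exact ⟨P, kernel α, a, b ≫ e.hom, e.inv ≫ c,
    hT.of_iso (Iso.refl _) (Iso.refl _) e.symm (by simp) (by simp) (by simp), hP⟩

/-- Let `Q` be the top term of `P`. Vanishing homology in degree `n + 1` makes the attaching map `β
: L ⟶ Q` a monomorphism. As every short exact sequence is `F`-exact, its cone is the stalk of `coker
β`, which absorbs both terms in degree `n`. -/
lemma exists_stalk_step (hF : ∀ S : ShortComplex C, S.ShortExact → F.IsExact S) {n : ℤ} {Z : D}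
    (hZ : HLE F s n Z) {P : D} {L : C} {a : P ⟶ Z} {b : Z ⟶ (s.obj L)⟦n + 1⟧}
    {c : (s.obj L)⟦n + 1⟧ ⟶ P⟦(1 : ℤ)⟧} (hT : Dist a b c)
    (hP : ExtClosure (stalks s F.IsProj (· ≤ n)) P) :
    ∃ (P : D) (M : C) (a : P ⟶ Z) (b : Z ⟶ (s.obj M)⟦n⟧)
      (c : (s.obj M)⟦n⟧ ⟶ P⟦(1 : ℤ)⟧), Dist a b c ∧
      ExtClosure (stalks s F.IsProj (· ≤ n - 1)) P := by
  have := h.full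
  have := h.faithful
  have hinj : ∀ {X Y : C} (f : X ⟶ Y), (s.map f)⟦n⟧' = 0 → f = 0 := fun f hf =>
    (s ⋙ shiftFunctor D n).map_injective (by simpa using hf)
  have hsh : ∀ N : C, (s.obj N)⟦n⟧⟦(1 : ℤ)⟧ ≅ (s.obj N)⟦n + 1⟧ := fun N =>
    (shiftFunctorAdd' D n 1 (n + 1) rfl).symm.app _
  have hT' : Dist a (b ≫ (hsh L).inv) ((hsh L).hom ≫ c) :=
    hT.of_iso (Iso.refl _) (Iso.refl _) (hsh L) (by simp) (by simp) (by simp)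
  obtain ⟨u, hu⟩ := hT'.exists_unrot
  obtain ⟨P₀, Q, a₀, e₀, d₀, hT₀, hQ, hP₀⟩ := h.split_top n hP
  obtain ⟨β, hβ⟩ : ∃ β : L ⟶ Q, (s.map β)⟦n⟧' = u ≫ e₀ :=
    (s ⋙ shiftFunctor D n).map_surjective (u ≫ e₀)
  -- After precomposing with a projective cover `R`, a map killed by `β` yields a map from `R` in
  -- degree `n + 1` to `Z`, which is zero.
  have hmono : Mono β := Preadditive.mono_of_cancel_zero _ fun {X} x hx => by
    obtain ⟨K, R, i, p, w, -, hR, hp⟩ := exists_cover F X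
    rw [← cancel_epi p, comp_zero]
    apply hinj
    obtain ⟨y, hy⟩ := hT₀.lift₂ ((s.map (p ≫ x))⟦n⟧' ≫ u) (by
      rw [Category.assoc, ← hβ, ← Functor.map_comp, ← s.map_comp, Category.assoc, hx, comp_zero,
        s.map_zero, Functor.map_zero])
    rw [h.hle_of_extClosure hP₀ R hR n (by lia) y, zero_comp] at hy
    obtain ⟨z, hz⟩ := hu.lift₁ ((s.map (p ≫ x))⟦n⟧'⟦(1 : ℤ)⟧') (by
      rw [← Functor.map_comp, ← hy, Functor.map_zero])
    rw [(hZ R hR (n + 1) (by lia)).of_iso_left (hsh R).symm z, zero_comp] at hz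
    exact (shiftFunctor D (1 : ℤ)).map_injective (by rw [← hz, Functor.map_zero])
  obtain ⟨δ, hδ⟩ := h.exists_dist β (cokernel.π β) (cokernel.condition β)
    (hF _ (.mk' (ShortComplex.exact_cokernel β) hmono inferInstance))
  obtain ⟨ε, hε⟩ := hδ.shift n
  -- The octahedron on `u` followed by `e₀` relates their cones `Z` and `P₀⟦1⟧` to the cone `E` of
  -- `β` in degree `n`.
  obtain ⟨E, c', d', x, y, hE, hxy⟩ := hu.octahedron hT₀.rot
  rw [← hβ] at hE
  obtain ⟨e⟩ := hE.cone_iso hε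
  have hxy' := hxy.of_iso (f' := x ≫ e.hom) (g' := e.inv ≫ y)
    (h' := (-a₀⟦(1 : ℤ)⟧') ≫ a⟦(1 : ℤ)⟧') (Iso.refl _) e.symm (Iso.refl _)
    (by simp) (by simp) (by simp)
  obtain ⟨w, hw⟩ := hxy'.exists_unrot
  exact ⟨P₀, _, w, _, _, hw, hP₀⟩

/-- In the absolute case, an object whose homology is concentrated in degrees `≤ n` is a stalk
complex in degree `n`, up to an object of projective dimension `≤ n - 1`. -/
lemma exists_stalk (hF : ∀ S : ShortComplex C, S.ShortExact → F.IsExact S) {n : ℤ} {Z : D}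
    (hZ : HLE F s n Z) :
    ∃ (P : D) (M : C) (a : P ⟶ Z) (b : Z ⟶ (s.obj M)⟦n⟧)
      (c : (s.obj M)⟦n⟧ ⟶ P⟦(1 : ℤ)⟧), Dist a b c ∧
      ExtClosure (stalks s F.IsProj (· ≤ n - 1)) P := by
  obtain ⟨P, M, a, b, c, hT, hP⟩ := h.exists_stalk_add_two hZ
  obtain ⟨P', M', a', b', c', hT', hP'⟩ := h.exists_stalk_step (n := n + 1) hF
    (hZ.mono (by lia)) (b := b ≫ eqToHom (by congr 1; lia)) (c := eqToHom (by congr 1; lia) ≫ c)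
    (hT.of_iso (f' := a) (Iso.refl _) (Iso.refl _) (eqToIso (by congr 1; lia)) (by simp) (by simp)
      (by simp)) hP
  rw [add_sub_cancel_right] at hP'
  exact h.exists_stalk_step hF hZ hT' hP'

end IsStalkFunctor

end RelDer

/-! ### Comparison of `φ`-dimensions along inverse equivalences. -/

namespace RelDer

open Pretriangulated Triangulated ObjectProperty

section

variable {D : Type*} [Category D] [Preadditive D] [HasZeroObject D] [HasShift D ℤ]
  [∀ n : ℤ, (shiftFunctor D n).Additive] [Pretriangulated D]
  {D' : Type*} [Category D'] [Preadditive D'] [HasZeroObject D'] [HasShift D' ℤ]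
  [∀ n : ℤ, (shiftFunctor D' n).Additive] [Pretriangulated D']

lemma Dist.map (L : D ⥤ D') [L.CommShift ℤ] [L.IsTriangulated] {X Y Z : D} {f : X ⟶ Y} {g : Y ⟶ Z}
    {h : Z ⟶ X⟦(1 : ℤ)⟧} (hT : Dist f g h) :
    Dist (L.map f) (L.map g) (L.map h ≫ (L.commShiftIso (1 : ℤ)).hom.app X) :=
  L.map_distinguished _ hT

/-- `L'` is faithful and a left inverse of `L` on objects. -/
structure IsRetraction (L : D ⥤ D') (L' : D' ⥤ D) : Prop where
  faithful : L'.Faithful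
  nonempty_iso (X : D) : Nonempty (L'.obj (L.obj X) ≅ X)

variable {L : D ⥤ D'} {L' : D' ⥤ D} [L'.Additive]

lemma IsRetraction.orth_left (I : IsRetraction L L') {X : D} {Y : D'} (h : Orth X (L'.obj Y)) :
    Orth (L.obj X) Y := fun f => by
  have := I.faithful
  obtain ⟨e⟩ := I.nonempty_iso X
  exact L'.map_injective (((h.of_iso_left e.symm) _).trans (L'.map_zero _ _).symm)

lemma IsRetraction.orth_right (I : IsRetraction L L') {X : D} {Y : D'} (h : Orth (L'.obj Y) X) :
    Orth Y (L.obj X) := fun f => by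
  have := I.faithful
  obtain ⟨e⟩ := I.nonempty_iso X
  exact L'.map_injective (((h.of_iso_right e.symm) _).trans (L'.map_zero _ _).symm)

end

section Compare

variable {C : Type*} [Category C] [Abelian C] [HasExt.{w} C] {F : ExtSubfunctor.{w} C}
  [F.EnoughProj] {D : Type*} [Category D] [Preadditive D] [HasZeroObject D] [HasShift D ℤ]
  [∀ n : ℤ, (shiftFunctor D n).Additive] [Pretriangulated D] [IsTriangulated D] {s : C ⥤ D}
  [s.Additive] (h : IsStalkFunctor F s)
  {C' : Type*} [Category C'] [Abelian C'] [HasExt.{v} C'] {F' : ExtSubfunctor.{v} C'}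
  [F'.EnoughProj] {D' : Type*} [Category D'] [Preadditive D'] [HasZeroObject D'] [HasShift D' ℤ]
  [∀ n : ℤ, (shiftFunctor D' n).Additive] [Pretriangulated D'] [IsTriangulated D'] {s' : C' ⥤ D'}
  [s'.Additive] (h' : IsStalkFunctor F' s')
  {L : D ⥤ D'} {L' : D' ⥤ D} [L.CommShift ℤ] [L.IsTriangulated] [L.Additive] [L'.CommShift ℤ]
  [L'.IsTriangulated] [L'.Additive] (I : IsRetraction L L') (I' : IsRetraction L' L)
  {a b : ℤ} (ha : ∀ Q, F.IsProj Q → PLE s' a (L.obj (s.obj Q)))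
  (hb : ∀ Q, F'.IsProj Q → PLE s b (L'.obj (s'.obj Q)))

include I hb in
-- Maps from `Q⟦k⟧` to `L(M)` correspond to maps from `L'(Q)⟦k⟧` to `M`, and the source has
-- projective dimension at most `b + k < 0`.
lemma hge_map_stalk (M : C) : HGE F' s' (-b) (L.obj (s.obj M)) := fun Q hQ k hk => by
  refine I.orth_right (Orth.of_iso_left ?_ ((L'.commShiftIso k).app _).symm)
  exact (((hb Q hQ).shift k (b + k) rfl) M 0 (by lia)).of_iso_right
    ((shiftFunctorZero D ℤ).app _)

include h h' I I' ha

/-- By the dual comparison `L'(Q)` has homology in degrees at least `-a`. Shifted by `k > a` it lies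
in positive degrees, so it has no maps to `M`. -/
lemma hle_map_stalk (M : C) : HLE F' s' a (L.obj (s.obj M)) := fun Q hQ k hk => by
  refine I.orth_right (Orth.of_iso_left ?_ ((L'.commShiftIso k).app _).symm)
  have h₁ : HGE F s (-a) (L'.obj (s'.obj Q)) := fun R hR j hj => by
    refine I'.orth_right (Orth.of_iso_left ?_ ((L.commShiftIso j).app _).symm)
    exact (((ha R hR).shift j (a + j) rfl) Q 0 (by lia)).of_iso_right
      ((shiftFunctorZero D' ℤ).app _)
  refine h.hge_orth_hle (n := 0) (fun R hR j hj =>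
    (h₁.shift k (k - a) (by lia)) R hR j (by lia)) (fun R hR j hj => ?_)
  exact (h.proj_orth hR (by lia)).of_iso_right ((shiftFunctorZero D ℤ).app _)

include hb

/-- `L(N)` has homology in degrees at least `-b`; for `k > n + b` its `k`-th shift lies above degree
`n`, out of reach of `P`. -/
lemma ple_map {n : ℤ} {P : D'} (hP : PLE s' n P) (m : ℤ) (hm : m = n + b) :
    PLE s m (L'.obj P) := fun N k hk => by
  refine I'.orth_left (Orth.of_iso_right ?_ ((L.commShiftIso k).app _).symm)
  refine h'.ple_orth_hge hP fun Q hQ j hj => ?_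
  exact ((hge_map_stalk I hb N).shift k (k - b) (by lia)) Q hQ j (by lia)

/-- Comparison of relative `φ`-dimensions along an equivalence of triangulated categories. -/
theorem phiDim_le_add (hF' : ∀ x : F'.KGroup, ∃ M, x ∈ F'.summandSubgroup M) (t k : ℕ)
    (ht : a + b = t)
    (hE : ∀ (n : ℤ) (Z : D'), HLE F' s' n Z → ∃ (P : D') (M : C') (f : P ⟶ Z)
      (g : Z ⟶ (s'.obj M)⟦n + k⟧) (e : (s'.obj M)⟦n + k⟧ ⟶ P⟦(1 : ℤ)⟧), Dist f g e ∧
      PLE s' (n + k - 1) P) :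
    F.phiDim ≤ F'.phiDim + (t + k : ℕ) := by
  -- Degree `a + k` is the one in which `hE` makes `L(M)` a stalk; projectives are killed because
  -- their images have dimension at most `a`.
  let Φ : F.KGroup →+ F'.KGroup := F.liftK (fun M => h'.topCls (a + k) (L.obj (s.obj M)))
    (fun N X Y e => by
      rw [← h'.topCls_biprod]
      exact h'.topCls_iso _ ((s ⋙ L).mapIso e ≪≫ additiveMapBiprod (s ⋙ L) X Y))
    (fun Q hQ => h'.topCls_eq_zero ((ha Q hQ).mono (by lia)))
  have hΦ : ∀ M, Φ (F.cls M) = h'.topCls (a + k) (L.obj (s.obj M)) :=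
    fun M => ExtSubfunctor.liftK_cls _ _ _ M
  let Ψ : F'.KGroup →+ F.KGroup := F'.liftK (fun M => h.topCls b (L'.obj (s'.obj M)))
    (fun N X Y e => by
      rw [← h.topCls_biprod]
      exact h.topCls_iso _ ((s' ⋙ L').mapIso e ≪≫ additiveMapBiprod (s' ⋙ L') X Y))
    (fun Q hQ => h.topCls_eq_zero (hb Q hQ))
  have hΨ : ∀ M, Ψ (F'.cls M) = h.topCls b (L'.obj (s'.obj M)) :=
    fun M => ExtSubfunctor.liftK_cls _ _ _ M
  -- The class of `L(M)` in degree `a + k + 1` is computed twice: from its stalk approximation `M'`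
  -- it is `Ω'[M']`, and from the cover triangle of `M` it is `Φ[K]`.
  have hcomm : Φ.comp F.omega = F'.omega.comp Φ := ExtSubfunctor.hom_ext_cls fun M => by
    obtain ⟨K, Q, i, p, w, δ, ε, hE₁, hQ, hT⟩ := h.exists_cover_distTriang M 0
    obtain ⟨P, M', f, g, e, hT', hP⟩ := hE a _ (hle_map_stalk h h' I I' ha M)
    have h₁ : h'.topCls (a + k + 1) (L.obj (s.obj M)) = F'.omega (F'.cls M') := by
      rw [h'.topCls_of_dist hT' (hP.mono (by lia)), ← Nat.cast_one, h'.topCls_stalk]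
      rfl
    have h₂ : h'.topCls (a + k) (L.obj (s.obj M)) = F'.cls M' := by
      rw [h'.topCls_of_dist hT' hP]
      exact h'.topCls_eq (h'.isTop_stalk _ _)
    have h₃ : h'.topCls (a + k + 1) (L.obj (s.obj M)) = h'.topCls (a + k) (L.obj (s.obj K)) := by
      rw [← h'.topCls_shift (a + k) 1 (a + k + 1) rfl,
        ← h'.topCls_iso _ (show L.obj ((s.obj K)⟦(1 : ℤ)⟧) ≅ (L.obj (s.obj K))⟦(1 : ℤ)⟧ from
          (L.commShiftIso (1 : ℤ)).app _),
        ← h'.topCls_iso _ (L.mapIso (show (s.obj M)⟦(0 : ℤ)⟧ ≅ s.obj M from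
          (shiftFunctorZero D ℤ).app _)),
        h'.topCls_of_dist (hT.map L)
          (((ha Q hQ).of_iso (L.mapIso ((shiftFunctorZero D ℤ).symm.app _))).mono (by lia))]
      exact h'.topCls_iso _ (L.mapIso (eqToIso (by simp)))
    change Φ (F.omega (F.cls M)) = F'.omega (Φ (F.cls M))
    rw [F.omega_cls i p w hE₁ hQ, hΦ, hΦ, h₂, ← h₁, h₃]
  -- Applying `L'` to the stalk approximation leaves an error of dimension below `a + k + b = t +
  -- k`. In that degree the class of `M` is `Ω^(t+k) [M]`, and that of `L'(M'⟦a + k⟧)` is `Ψ[M']`.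
  have hcomp : ∀ x, Ψ (Φ x) = F.omega^[t + k] x := by
    let O : F.KGroup →+ F.KGroup := ⟨⟨F.omega^[t + k], iterate_map_zero F.omega _⟩,
      iterate_map_add F.omega _⟩
    refine fun x => DFunLike.congr_fun (?_ : Ψ.comp Φ = O) x
    refine ExtSubfunctor.hom_ext_cls fun M => ?_
    obtain ⟨P, M', f, g, e, hT', hP⟩ := hE a _ (hle_map_stalk h h' I I' ha M)
    obtain ⟨e₀⟩ := I.nonempty_iso (s.obj M)
    have h₁ := h.topCls_of_dist (n := a + k + b) (hT'.map L')
      (ple_map h h' I I' ha hb hP _ (by lia))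
    rw [h.topCls_iso _ e₀, h.topCls_iso _ (show L'.obj ((s'.obj M')⟦a + k⟧) ≅ (L'.obj (s'.obj M'))⟦a + k⟧ from
        (L'.commShiftIso (a + k)).app _),
      h.topCls_shift b _ _ (by lia), ← hΨ] at h₁
    have h₂ : Φ (F.cls M) = F'.cls M' := by
      rw [hΦ, h'.topCls_of_dist hT' hP]
      exact h'.topCls_eq (h'.isTop_stalk _ _)
    have h₃ := h.topCls_stalk 0 (t + k) M
    rw [h.topCls_iso _ (show (s.obj M)⟦(0 : ℤ)⟧ ≅ s.obj M from (shiftFunctorZero D ℤ).app _)] at h₃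
    change Ψ (Φ (F.cls M)) = F.omega^[t + k] (F.cls M)
    rw [h₂, ← h₁, ← h₃]
    congr 1
    push_cast
    lia
  have hiter : ∀ (n : ℕ) x, Φ (F.omega^[n] x) = F'.omega^[n] (Φ x) := fun n x => by
    induction n with
    | zero => rfl
    | succ n ih =>
      rw [Function.iterate_succ_apply', Function.iterate_succ_apply', ← ih]
      exact DFunLike.congr_fun hcomm _
  induction hn : F'.phiDim using ENat.recTopCoe with
  | top => simp
  | coe n =>
    have hinj := F'.omega_injective_of_phiDim_le hF' n hn.le
    have hinj' : ∀ (d : ℕ) y, F'.omega^[n + d] y = 0 → F'.omega^[n] y = 0 := fun d => by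
      induction d with
      | zero => exact fun y hy => hy
      | succ d ih =>
        intro y hy
        apply ih
        rw [Function.iterate_add_apply]
        apply hinj
        rw [← Function.iterate_add_apply, ← hy, add_right_comm, add_assoc]
    rw [← Nat.cast_add]
    refine F.phiDim_le _ fun x hx => ?_
    have h₁ : F'.omega^[n] (Φ x) = 0 := by
      apply hinj' (t + k + 1)
      rw [← hiter, ← add_assoc, hx, map_zero]
    rw [← hiter] at h₁
    rw [add_comm n, Function.iterate_add_apply, ← hcomp, h₁, map_zero]

end Compare

end RelDer

/-! ### Passing from split stalk functors to the Verdier quotient. -/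

namespace RelDer

open Pretriangulated Triangulated ObjectProperty

lemma extClosure_map {D D' : Type*} [Category D] [Preadditive D] [HasZeroObject D] [HasShift D ℤ]
    [∀ n : ℤ, (shiftFunctor D n).Additive] [Pretriangulated D]
    [Category D'] [Preadditive D'] [HasZeroObject D'] [HasShift D' ℤ]
    [∀ n : ℤ, (shiftFunctor D' n).Additive] [Pretriangulated D']
    (L : D ⥤ D') [L.CommShift ℤ] [L.IsTriangulated] {S : ObjectProperty D} {S' : ObjectProperty D'}
    (h : ∀ X, S X → S' (L.obj X)) {X : D} (hX : ExtClosure S X) : ExtClosure S' (L.obj X) := by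
  induction hX with
  | of X hX => exact .of _ (h _ hX)
  | zero X hX => exact .zero _ (L.map_isZero hX)
  | ext T hT _ _ h₁ h₃ => exact .ext _ (L.map_distinguished _ hT) h₁ h₃

section

variable {C : Type*} [Category C] [Abelian C] [HasExt.{w} C] {F : ExtSubfunctor.{w} C}
  [F.EnoughProj] {D : Type*} [Category D] [Preadditive D] [HasZeroObject D] [HasShift D ℤ]
  [∀ n : ℤ, (shiftFunctor D n).Additive] [Pretriangulated D] [IsTriangulated D]
  {D' : Type*} [Category D'] [Preadditive D'] [HasZeroObject D'] [HasShift D' ℤ]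
  [∀ n : ℤ, (shiftFunctor D' n).Additive] [Pretriangulated D']

/-- `s` has the properties of the functor that sends an object to its stalk complex in the
bounded homotopy category. -/
structure IsSplitStalkFunctor (s : C ⥤ D) : Prop where
  map_bijective (M N : C) : Function.Bijective (s.map : (M ⟶ N) → _)
  orth (M N : C) (n : ℤ) (hn : n ≠ 0) : Orth (s.obj M) ((s.obj N)⟦n⟧)
  generates (Z : D) : ExtClosure (stalks s ⊤ fun _ => True) Z

namespace IsSplitStalkFunctor

variable {s : C ⥤ D} [s.Additive] (h : IsSplitStalkFunctor s)

include h

lemma stalk_orth (M N : C) {k n : ℤ} (hkn : k ≠ n) : Orth ((s.obj M)⟦k⟧) ((s.obj N)⟦n⟧) :=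
  (orth_shift_iff _ _ k n (n - k) (by lia)).2 (h.orth M N _ (by lia))

/-- Boundedness of every object, which terminates the induction in `map_eq_zero`. -/
lemma exists_orth (U : D) : ∃ n : ℤ, ∀ (M : C) (k : ℤ), n ≤ k → Orth ((s.obj M)⟦k⟧) U := by
  have hU := h.generates U
  induction hU with
  | of X hX =>
    obtain ⟨N, n, -, -, ⟨e⟩⟩ := hX
    exact ⟨n + 1, fun M k hk => (h.stalk_orth M N (by lia)).of_iso_right e.symm⟩
  | zero X hX => exact ⟨0, fun M k _ f => hX.eq_of_tgt _ _⟩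
  | ext T hT _ _ h₁ h₃ =>
    obtain ⟨n₁, h₁⟩ := h₁
    obtain ⟨n₃, h₃⟩ := h₃
    exact ⟨max n₁ n₃, fun M k hk => Dist.orth_right hT (h₁ M k (le_of_max_le_left hk))
      (h₃ M k (le_of_max_le_right hk))⟩

variable {𝒜 : ObjectProperty D} [𝒜.IsTriangulated]
  (h𝒜 : ∀ W, 𝒜 W ↔ ∀ Q, F.IsProj Q → ∀ k : ℤ, Orth ((s.obj Q)⟦k⟧) W)

include h𝒜

/-- For an `F`-exact sequence, the comparison morphism from the cone of the first morphism has an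
`F`-acyclic cone. -/
lemma exists_factor {X Y Z : C} (i : X ⟶ Y) (p : Y ⟶ Z) (w : i ≫ p = 0)
    (hE : F.IsExact (ShortComplex.mk i p w)) :
    ∃ (E W : D) (j : s.obj Y ⟶ E) (c : E ⟶ (s.obj X)⟦(1 : ℤ)⟧) (e : E ⟶ s.obj Z) (g : s.obj Z ⟶ W)
      (k : W ⟶ E⟦(1 : ℤ)⟧), Dist (s.map i) j c ∧ j ≫ e = s.map p ∧ Dist e g k ∧ 𝒜 W := by
  have hi : Mono i := hE.1.mono_f
  obtain ⟨E, j, c, hT⟩ := Dist.exists_cone (s.map i)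
  obtain ⟨e, he⟩ := hT.desc₂ (s.map p) (by rw [← s.map_comp, w, s.map_zero])
  obtain ⟨W, g, k, hT'⟩ := Dist.exists_cone e
  refine ⟨E, W, j, c, e, g, k, hT, he, hT', (h𝒜 W).2 fun Q hQ n f => ?_⟩
  have z (N : C) : (s.obj N)⟦(0 : ℤ)⟧ ≅ s.obj N := (shiftFunctorZero D ℤ).app _
  -- `e` is bijective on maps from projective stalks: surjective by `F`-exactness, injective by left
  -- exactness. Hence its cone `W` is acyclic.
  have hsurj : ∀ (n : ℤ) (a : (s.obj Q)⟦n⟧ ⟶ s.obj Z), ∃ b, b ≫ e = a := fun n a => by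
    by_cases hn : n = 0
    · subst hn
      obtain ⟨a', ha'⟩ := (h.map_bijective Q Z).2 ((z Q).inv ≫ a)
      obtain ⟨b, hb⟩ := hQ _ hE a'
      refine ⟨(z Q).hom ≫ s.map b ≫ j, ?_⟩
      rw [Category.assoc, Category.assoc, he, ← s.map_comp]
      dsimp at hb
      rw [hb, ha', Iso.hom_inv_id_assoc]
    · exact ⟨0, by rw [((h.stalk_orth Q Z hn).of_iso_right (z Z)) a, zero_comp]⟩
  have hinj : ∀ (n : ℤ) (a : (s.obj Q)⟦n⟧ ⟶ E), a ≫ e = 0 → a = 0 := fun n a ha => by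
    have h₁ : a ≫ c = 0 := by
      by_cases hn : n = 1
      · subst hn
        obtain ⟨b, hb⟩ := (shiftFunctor D (1 : ℤ)).map_surjective (a ≫ c)
        obtain ⟨u, rfl⟩ := (h.map_bijective Q X).2 b
        have h₂ : u ≫ i = 0 := (h.map_bijective Q Y).1 ((shiftFunctor D (1 : ℤ)).map_injective (by
          rw [s.map_comp, Functor.map_comp, hb, Category.assoc, hT.comp₃₁, comp_zero, s.map_zero,
            Functor.map_zero]))
        rw [← hb, zero_of_comp_mono i h₂, s.map_zero, Functor.map_zero]
      · exact h.stalk_orth Q X hn _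
    obtain ⟨b, rfl⟩ := hT.lift₃ a h₁
    by_cases hn : n = 0
    · subst hn
      obtain ⟨v, hv⟩ := (h.map_bijective Q Y).2 ((z Q).inv ≫ b)
      have h₂ : v ≫ p = 0 := (h.map_bijective Q Z).1 (by
        rw [s.map_comp, hv, ← he, s.map_zero, Category.assoc, ← Category.assoc b, ha, comp_zero])
      obtain ⟨u, hu⟩ : ∃ u, u ≫ i = v := ⟨hE.1.exact.lift v h₂, hE.1.exact.lift_f v h₂⟩
      rw [← cancel_epi (z Q).inv, ← Category.assoc, ← hv, ← hu, s.map_comp, Category.assoc,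
        hT.comp₁₂, comp_zero, comp_zero]
    · rw [((h.stalk_orth Q Y hn).of_iso_right (z Y)) b, zero_comp]
  have h₀ : f ≫ k = 0 := by
    have σ : (s.obj Q)⟦n⟧ ≅ (s.obj Q)⟦n - 1⟧⟦(1 : ℤ)⟧ :=
      (shiftFunctorAdd' D (n - 1) 1 n (by lia)).app _
    obtain ⟨a, ha⟩ := (shiftFunctor D (1 : ℤ)).map_surjective (σ.inv ≫ f ≫ k)
    rw [← cancel_epi σ.inv, comp_zero, ← ha, hinj _ a, Functor.map_zero]
    apply (shiftFunctor D (1 : ℤ)).map_injective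
    rw [Functor.map_comp, ha, Category.assoc, Category.assoc, hT'.comp₃₁, comp_zero, comp_zero,
      Functor.map_zero]
  obtain ⟨b, rfl⟩ := hT'.lift₃ f h₀
  obtain ⟨a, rfl⟩ := hsurj n b
  rw [Category.assoc, hT'.comp₁₂, comp_zero]

variable (q : D ⥤ D') [q.CommShift ℤ] [q.IsTriangulated] [q.IsLocalization 𝒜.trW]

/-- Projective stalks are left orthogonal to `𝒜`, so the quotient does not change the maps out of
them. -/
lemma map_bijective_localization {Q : C} (hQ : F.IsProj Q) (k : ℤ) (U : D) :
    Function.Bijective (q.map : ((s.obj Q)⟦k⟧ ⟶ U) → _) :=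
  leftOrthogonal.map_bijective_of_isTriangulated (P := 𝒜)
    (fun W f hW => (h𝒜 W).1 hW Q hQ k f) q U

/-- `f` vanishes on a projective cover, so in the quotient it factors through the syzygy one degree
higher. Repeating this reaches a degree from which nothing maps to the bounded object `U`. -/
lemma map_eq_zero (U : D) (n : ℤ) (hU : ∀ Q, F.IsProj Q → ∀ k, n ≤ k → Orth ((s.obj Q)⟦k⟧) U)
    {M : C} (f : (s.obj M)⟦n⟧ ⟶ U) : q.map f = 0 := by
  obtain ⟨m, hm⟩ := h.exists_orth U
  obtain ⟨d, hd⟩ : ∃ d : ℕ, m ≤ n + d := ⟨(m - n).toNat, by lia⟩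
  induction d generalizing n M with
  | zero => rw [hm M n (by simpa using hd) f, q.map_zero]
  | succ d ih =>
    obtain ⟨K, Q, i, p, w, hE, hQ, -⟩ := exists_cover F M
    obtain ⟨E, W, j, c, e, g, k, hT, he, hT', hW⟩ := h.exists_factor h𝒜 i p w hE
    -- `V` is the cone of `s(p)`, and the octahedron compares it with `s(K)⟦1⟧` by a map `a` whose
    -- cone `W` is acyclic; `a` becomes invertible under `q`.
    obtain ⟨V, c', d', a, b, hT₁, hT₂⟩ := hT.rot.octahedron hT'
    obtain ⟨_, hT₃⟩ := hT₁.shift n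
    obtain ⟨_, hT₄⟩ := hT₂.shift n
    obtain ⟨f', rfl⟩ := hT₃.desc₂ f (by rw [he]; exact hU Q hQ n le_rfl _)
    have : IsIso (q.map (a⟦n⟧')) :=
      Localization.inverts q 𝒜.trW _ (trW.mk 𝒜 hT₄ (𝒜.le_shift n _ hW))
    have σ : (s.obj K)⟦n + 1⟧ ≅ (s.obj K)⟦(1 : ℤ)⟧⟦n⟧ :=
      (shiftFunctorAdd' D 1 n (n + 1) (by lia)).app _
    have h₀ := ih (n + 1) (fun Q hQ l hl => hU Q hQ l (by lia)) (σ.hom ≫ a⟦n⟧' ≫ f')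
      (by push_cast at hd; lia)
    have h₁ : q.map f' = 0 := by
      rw [← cancel_epi (q.map (a⟦n⟧')), ← cancel_epi (q.map σ.hom), ← q.map_comp, ← q.map_comp, h₀,
        comp_zero, comp_zero]
    rw [q.map_comp, h₁, comp_zero]

/-- The stalk functor to the Verdier quotient by the `F`-acyclic objects. -/
theorem isStalkFunctor : IsStalkFunctor F (s ⋙ q) where
  exists_dist i p w hE := by
    obtain ⟨E, W, j, c, e, g, k, hT, he, hT', hW⟩ := h.exists_factor h𝒜 i p w hE
    have : IsIso (q.map e) := Localization.inverts q 𝒜.trW _ (trW.mk 𝒜 hT' hW)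
    refine ⟨inv (q.map e) ≫ q.map c ≫ (q.commShiftIso (1 : ℤ)).hom.app _,
      (hT.map q).of_iso (Iso.refl _) (Iso.refl _) (asIso (q.map e)).symm ?_ ?_ ?_⟩
    · simp
    · simp [← he]
    · simp
  map_bijective Q N hQ := by
    have e : (s.obj Q)⟦(0 : ℤ)⟧ ≅ s.obj Q := (shiftFunctorZero D ℤ).app _
    have hq : Function.Bijective (q.map : (s.obj Q ⟶ s.obj N) → _) := by
      have h₁ := h.map_bijective_localization h𝒜 q hQ 0 (s.obj N)
      refine ⟨fun a b hab => ?_, fun b => ?_⟩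
      · rw [← cancel_epi e.hom]
        exact h₁.1 (by rw [q.map_comp, hab, q.map_comp])
      · obtain ⟨a, ha⟩ := h₁.2 (q.map e.hom ≫ b)
        exact ⟨e.inv ≫ a, by rw [q.map_comp, ha, ← q.map_comp_assoc, e.inv_hom_id, q.map_id,
          Category.id_comp]⟩
    exact hq.comp (h.map_bijective Q N)
  orth Q N hQ n hn := by
    have h₁ : Orth (q.obj ((s.obj Q)⟦(0 : ℤ)⟧)) (q.obj ((s.obj N)⟦n⟧)) := fun f => by
      obtain ⟨a, rfl⟩ := (h.map_bijective_localization h𝒜 q hQ 0 _).2 f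
      rw [h.stalk_orth Q N hn.symm a, q.map_zero]
    exact (h₁.of_iso_left (q.mapIso ((shiftFunctorZero D ℤ).app _))).of_iso_right
      ((q.commShiftIso n).app _)
  orth_of_proj Z n hZ M := by
    refine Orth.of_iso_left ?_ ((q.commShiftIso n).app (s.obj M))
    have := Localization.essSurj q 𝒜.trW
    let e : q.obj (q.objPreimage Z) ≅ Z := q.objObjPreimageIso Z
    refine Orth.of_iso_right (fun f => ?_) e
    -- Clearing the denominator leaves the image of a genuine map. Its target satisfies the
    -- hypothesis of `map_eq_zero`, since maps from projective stalks are unchanged by `q`.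
    obtain ⟨φ, hφ⟩ := Localization.exists_leftFraction q 𝒜.trW f
    have : IsIso (q.map φ.s) := Localization.inverts q 𝒜.trW _ φ.hs
    rw [hφ, ← cancel_mono (q.map φ.s), MorphismProperty.LeftFraction.map_comp_map_s, zero_comp]
    refine h.map_eq_zero h𝒜 q _ n (fun Q hQ k hk g => ?_) _
    apply (h.map_bijective_localization h𝒜 q hQ k _).1
    rw [q.map_zero]
    exact (((hZ Q hQ k hk).of_iso_left ((q.commShiftIso k).app (s.obj Q)).symm).of_iso_right
      (e.symm ≪≫ asIso (q.map φ.s))) _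
  generates Z := by
    have := Localization.essSurj q 𝒜.trW
    refine (ExtClosure _).prop_of_iso (q.objObjPreimageIso Z)
      (extClosure_map q ?_ (h.generates (q.objPreimage Z)))
    rintro _ ⟨M, n, -, -, ⟨e⟩⟩
    exact ⟨M, n, trivial, trivial, ⟨q.mapIso e ≪≫ (q.commShiftIso n).app _⟩⟩

end IsSplitStalkFunctor

end

end RelDer

/-! ### Stalk complexes in `K^b` and in the relative derived category. -/

namespace RelDer

open Pretriangulated Triangulated ObjectProperty

section

variable {C : Type u} [Category.{v} C] [Abelian C]

open CochainComplex.HomComplex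

variable (C) in
/-- The functor sending an object to its stalk complex, in the bounded homotopy category. -/
noncomputable def stalkKb : C ⥤ Kb C :=
  (bounded C).lift (HomotopyCategory.singleFunctor C 0) isBoundedCpx_single

instance : (stalkKb C).Additive where
  map_add := (bounded C).ι.map_injective
    ((HomotopyCategory.singleFunctor C 0).map_add)

/-- A bounded complex, as an object of the bounded homotopy category. -/
def toKb (K : CochainComplex C ℤ) (hK : IsBoundedCpx K) : Kb C :=
  ⟨(HomotopyCategory.quotient C (ComplexShape.up ℤ)).obj K, hK⟩

/-- The shifts of stalk complexes, in the homotopy category. -/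
noncomputable def stalkKbShiftIso (M : C) (n m : ℤ) (h : n + m = 0) :
    (bounded C).ι.obj (((stalkKb C).obj M)⟦n⟧) ≅ (HomotopyCategory.singleFunctor C m).obj M :=
  ((bounded C).ι.commShiftIso n).app _ ≪≫
    ((HomotopyCategory.singleFunctors C).shiftIso n m 0 h).app M

lemma orth_ι_iff {X Y : Kb C} : Orth ((bounded C).ι.obj X) ((bounded C).ι.obj Y) ↔ Orth X Y :=
  ⟨fun h f => (bounded C).ι.map_injective ((h _).trans ((bounded C).ι.map_zero _ _).symm),
    fun h f => by
      obtain ⟨g, rfl⟩ := (bounded C).ι.map_surjective f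
      rw [h g, Functor.map_zero]⟩

lemma orth_singleFunctor (M N : C) (m n : ℤ) (h : m ≠ n) :
    Orth ((HomotopyCategory.singleFunctor C m).obj M)
      ((HomotopyCategory.singleFunctor C n).obj N) := fun f => by
  obtain ⟨φ, rfl⟩ := (HomotopyCategory.quotient C (ComplexShape.up ℤ)).map_surjective
    (X := (CochainComplex.singleFunctor C m).obj M)
    (Y := (CochainComplex.singleFunctor C n).obj N) f
  have hφ : φ = 0 := HomologicalComplex.from_single_hom_ext
    ((HomologicalComplex.isZero_single_obj_X (ComplexShape.up ℤ) n N m h).eq_of_tgt _ _)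
  rw [hφ, Functor.map_zero]
  rfl

lemma map_bijective_stalkKb (M N : C) :
    Function.Bijective ((stalkKb C).map : (M ⟶ N) → _) := by
  constructor
  · refine (injective_iff_map_eq_zero (stalkKb C).mapAddHom).2 fun f hf => ?_
    let φ := (CochainComplex.singleFunctor C 0).map f
    have h₁ : (HomotopyCategory.quotient C (ComplexShape.up ℤ)).map φ = 0 :=
      congr_arg (bounded C).ι.map hf
    obtain ⟨g, hg⟩ := Cochain.fromSingleMk_surjective (Cochain.ofHom φ) 0 (add_zero 0)
    obtain ⟨k, hk⟩ := (singleFunctor_map_eq_zero_iff M _ (-1) 0 (by lia) g φ hg.symm).1 h₁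
    have h₂ : φ = 0 := (Cochain.ofHom_injective (by
      rw [← hg, ← hk, CochainComplex.singleFunctor_obj_d, comp_zero, Cochain.fromSingleMk_zero,
        Cochain.ofHom_zero]))
    exact (CochainComplex.singleFunctor C 0).map_injective (h₂.trans (Functor.map_zero _ _ _).symm)
  · intro f
    obtain ⟨φ, hφ⟩ := (HomotopyCategory.quotient C (ComplexShape.up ℤ)).map_surjective
      (X := (CochainComplex.singleFunctor C 0).obj M)
      (Y := (CochainComplex.singleFunctor C 0).obj N) ((bounded C).ι.map f)
    obtain ⟨g, rfl⟩ := (CochainComplex.singleFunctor C 0).map_surjective φ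
    exact ⟨g, (bounded C).ι.map_injective hφ⟩

lemma exists_dist_of_dist_ι {X Y Z : Kb C} {f : (bounded C).ι.obj X ⟶ (bounded C).ι.obj Y}
    {g : (bounded C).ι.obj Y ⟶ (bounded C).ι.obj Z}
    {h : (bounded C).ι.obj Z ⟶ ((bounded C).ι.obj X)⟦(1 : ℤ)⟧} (hT : Dist f g h) :
    ∃ (f' : X ⟶ Y) (g' : Y ⟶ Z) (h' : Z ⟶ X⟦(1 : ℤ)⟧), Dist f' g' h' := by
  obtain ⟨f', rfl⟩ := (bounded C).ι.map_surjective f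
  obtain ⟨g', rfl⟩ := (bounded C).ι.map_surjective g
  obtain ⟨h', hh'⟩ := (bounded C).ι.map_surjective
    (h ≫ ((bounded C).ι.commShiftIso (1 : ℤ)).inv.app X)
  refine ⟨f', g', h', ?_⟩
  have e : (bounded C).ι.map h' ≫ ((bounded C).ι.commShiftIso (1 : ℤ)).hom.app X = h := by
    rw [hh', Category.assoc, Iso.inv_hom_id_app]
    exact Category.comp_id _
  have : Dist ((bounded C).ι.map f') ((bounded C).ι.map g')
    ((bounded C).ι.map h' ≫ ((bounded C).ι.commShiftIso (1 : ℤ)).hom.app X) := by rwa [e]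
  exact this

lemma exists_dist_of_splitting {S : ShortComplex (CochainComplex C ℤ)}
    (σ : ∀ n, (S.map (HomologicalComplex.eval C _ n)).Splitting)
    (h₁ : IsBoundedCpx S.X₁) (h₂ : IsBoundedCpx S.X₂) (h₃ : IsBoundedCpx S.X₃) :
    ∃ (f : toKb S.X₁ h₁ ⟶ toKb S.X₂ h₂) (g : toKb S.X₂ h₂ ⟶ toKb S.X₃ h₃)
      (k : toKb S.X₃ h₃ ⟶ (toKb S.X₁ h₁)⟦(1 : ℤ)⟧), Dist f g k := by
  exact exists_dist_of_dist_ι (X := toKb S.X₁ h₁) (Y := toKb S.X₂ h₂) (Z := toKb S.X₃ h₃)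
    ((HomotopyCategory.distinguished_iff_iso_trianglehOfDegreewiseSplit _).2
      ⟨S, σ, ⟨Iso.refl _⟩⟩)

/-- A bounded complex is an iterated extension of its terms. -/
lemma extClosure_toKb {P : ObjectProperty C} [P.IsClosedUnderIsomorphisms]
    (K : CochainComplex C ℤ) (a : ℤ) (d : ℕ) (hK : ∀ i, i < a ∨ a + d ≤ i → IsZero (K.X i))
    (hP : ∀ i, a ≤ i → i < a + d → P (K.X i)) (hK' : IsBoundedCpx K) :
    ExtClosure (stalks (stalkKb C) P (fun n => -(a + d) < n ∧ n ≤ -a)) (toKb K hK') := by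
  induction d generalizing K with
  | zero =>
    refine .zero _ ?_
    have hK₀ : IsZero K := by
      rw [IsZero.iff_id_eq_zero]
      ext i
      exact (hK i (by lia)).eq_of_src _ _
    rw [IsZero.iff_id_eq_zero]
    apply (bounded C).ι.map_injective
    exact ((HomotopyCategory.quotient C (ComplexShape.up ℤ)).map_isZero hK₀).eq_of_src _ _
  | succ d ih =>
    -- The last term of `K` is a subcomplex, degreewise split, with one term fewer in the quotient.
    -- A stalk in cohomological degree `b` is a shift by `-b`, hence the signs in the range.
    let b : ℤ := a + d
    let φ : (CochainComplex.singleFunctor C b).obj (K.X b) ⟶ K :=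
      (Cocycle.fromSingleMk (𝟙 (K.X b)) (add_zero b) (b + 1) rfl
        ((hK (b + 1) (by push_cast; lia)).eq_of_tgt _ _)).homOf
    have hφ : IsIso (φ.f b) := by
      have h₁ : φ.f b = (HomologicalComplex.singleObjXSelf (.up ℤ) b (K.X b)).hom := by
        simp only [φ, Cocycle.homOf_f, Cocycle.fromSingleMk_coe, Cochain.fromSingleMk_v]
        exact Category.comp_id _
      rw [h₁]
      exact Iso.isIso_hom _
    have hφ₀ : ∀ i, i ≠ b → IsZero (((CochainComplex.singleFunctor C b).obj (K.X b)).X i) :=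
      fun i hi => HomologicalComplex.isZero_single_obj_X _ _ _ _ hi
    let S : ShortComplex (CochainComplex C ℤ) := ShortComplex.mk φ (cokernel.π φ) (by simp)
    have hS : S.Exact := ShortComplex.exact_cokernel φ
    have hS' : ∀ i, (S.map (HomologicalComplex.eval C _ i)).Exact := fun i => hS.map _
    have hepi : ∀ i, Epi ((S.map (HomologicalComplex.eval C _ i)).g) := fun i =>
      inferInstanceAs (Epi ((HomologicalComplex.eval C _ i).map (cokernel.π φ)))
    have h₀ : IsZero ((cokernel φ).X b) := by
      have h₁ : (cokernel.π φ).f b = 0 := by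
        rw [← cancel_epi (φ.f b), ← HomologicalComplex.comp_f, cokernel.condition, comp_zero]
        rfl
      have : Epi ((cokernel.π φ).f b) := hepi b
      rw [IsZero.iff_id_eq_zero, ← cancel_epi ((cokernel.π φ).f b), h₁, zero_comp, zero_comp]
    have h₁ : ∀ i, i ≠ b → IsIso ((cokernel.π φ).f i) := fun i hi => by
      have := (hS' i).mono_g ((hφ₀ i hi).eq_of_src _ _)
      have := hepi i
      exact isIso_of_mono_of_epi (S.map (HomologicalComplex.eval C _ i)).g
    let σ : ∀ i, (S.map (HomologicalComplex.eval C _ i)).Splitting := fun i =>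
      if hi : i = b then .ofIsIsoOfIsZero _ (by subst hi; exact hφ) (by subst hi; exact h₀)
      else .ofIsZeroOfIsIso _ (hφ₀ i hi) (h₁ i hi)
    have hc : ∀ i, i < a ∨ a + d ≤ i → IsZero ((cokernel φ).X i) := fun i hi => by
      by_cases hib : i = b
      · subst hib; exact h₀
      · have := h₁ i hib
        exact (hK i (by push_cast; lia)).of_iso (asIso ((cokernel.π φ).f i)).symm
    have hc' : IsBoundedCpx (cokernel φ) := ⟨a, a + d, fun i hi => hc i (by lia)⟩
    obtain ⟨f, g, k, hT⟩ := exists_dist_of_splitting σ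
      (h₁ := ⟨b, b, fun i hi => hφ₀ i (by lia)⟩) hK' hc'
    refine ExtClosure.ext _ hT (.of _ ⟨K.X b, -b, hP b (by lia) (by lia), by lia, ⟨?_⟩⟩)
      (extClosure_mono ?_ _ (ih _ hc (fun i hi hi' => ?_) hc'))
    · exact (bounded C).fullyFaithfulι.preimageIso (stalkKbShiftIso _ _ _ (by lia)).symm
    · rintro _ ⟨M, n, hM, hn, e⟩
      exact ⟨M, n, hM, by push_cast; lia, e⟩
    · have := h₁ i (by lia)
      exact P.prop_of_iso (asIso ((cokernel.π φ).f i)) (hP i hi (by lia))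

lemma isSplitStalkFunctor_stalkKb : IsSplitStalkFunctor (stalkKb C) where
  map_bijective := map_bijective_stalkKb
  orth M N n hn := orth_ι_iff.1
    (((orth_singleFunctor M N 0 (-n) (by lia))).of_iso_right (stalkKbShiftIso N n (-n) (by lia)).symm)
  generates Z := by
    obtain ⟨X, a, b, hX⟩ := Z
    obtain ⟨K, rfl⟩ := HomotopyCategory.quotient_obj_surjective X
    refine extClosure_mono ?_ _ (extClosure_toKb (P := ⊤) K a (b + 1 - a).toNat
      (fun i hi => hX i (by lia)) (fun _ _ _ => trivial) ⟨a, b, hX⟩)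
    rintro _ ⟨M, n, hM, -, e⟩
    exact ⟨M, n, hM, trivial, e⟩

variable [HasExt.{w} C] (F : ExtSubfunctor.{w} C) [F.EnoughProj]

lemma acyclic_iff_orth (W : Kb C) : F.acyclic.inverseImage (bounded C).ι W ↔
    ∀ Q, F.IsProj Q → ∀ k : ℤ, Orth (((stalkKb C).obj Q)⟦k⟧) W := by
  change F.acyclic ((bounded C).ι.obj W) ↔ _
  rw [F.acyclic_eq_rightOrthogonal]
  refine ⟨fun h Q hQ k => orth_ι_iff.1 fun f => h f ⟨Q, -k, hQ, ⟨stalkKbShiftIso Q k (-k) (by lia)⟩⟩,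
    ?_⟩
  rintro h X f ⟨Q, n, hQ, ⟨e⟩⟩
  exact ((orth_ι_iff.2 (h Q hQ (-n))).of_iso_left (stalkKbShiftIso Q (-n) n (by lia) ≪≫ e.symm)) f

/-- The localization functor to the relative bounded derived category. -/
noncomputable abbrev locDb : Kb C ⥤ F.Db := (F.acyclic.inverseImage (bounded C).ι).trW.Q

/-- The functor sending an object to its stalk complex, in the relative bounded derived category. -/
noncomputable abbrev stalkDb : C ⥤ F.Db := stalkKb C ⋙ locDb F

instance : F.IsProj.IsClosedUnderIsomorphisms where
  of_iso e h := ExtSubfunctor.IsProj.of_iso h e.symm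

lemma isStalkFunctor_stalkDb : IsStalkFunctor F (stalkDb F) :=
  isSplitStalkFunctor_stalkKb.isStalkFunctor (acyclic_iff_orth F) (locDb F)

/-- A complex of `F`-projectives in degrees between `a` and `b` is an iterated extension of
shifted stalks of `F`-projectives. -/
lemma extClosure_toDb (K : CochainComplex C ℤ) (hP : ∀ i, F.IsProj (K.X i)) (a b : ℤ)
    (hK : ∀ i, i < a ∨ b < i → IsZero (K.X i)) :
    ExtClosure (stalks (stalkDb F) F.IsProj (fun n => -b ≤ n ∧ n ≤ -a))
      (F.toDb K ⟨a, b, hK⟩) := by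
  by_cases hab : a ≤ b
  · refine extClosure_map (locDb F) ?_ (extClosure_toKb (P := F.IsProj) K a (b + 1 - a).toNat
      (fun i hi => hK i (by lia)) (fun i _ _ => hP i) ⟨a, b, hK⟩)
    rintro _ ⟨M, n, hM, hn, ⟨e⟩⟩
    exact ⟨M, n, hM, by lia, ⟨(locDb F).mapIso e ≪≫ ((locDb F).commShiftIso n).app _⟩⟩
  · refine extClosure_map (locDb F) ?_ (extClosure_toKb (P := F.IsProj) K a 0
      (fun i hi => hK i (by lia)) (fun i _ _ => hP i) ⟨a, b, hK⟩)
    rintro _ ⟨M, n, hM, hn, ⟨e⟩⟩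
    lia

end

end RelDer

/-! ### Radical complexes, finite length and projective modules. -/

namespace RelDer

open Pretriangulated Triangulated ObjectProperty

section

variable {C : Type*} [Category C] [Preadditive C]

/-- The identity of `Y` is a sum of endomorphisms factoring through `X`. -/
def IsSumThrough (X Y : C) : Prop :=
  ∃ (n : ℕ) (a : Fin n → (Y ⟶ X)) (b : Fin n → (X ⟶ Y)), ∑ i, a i ≫ b i = 𝟙 Y

lemma IsSumThrough.map {D : Type*} [Category D] [Preadditive D] (G : C ⥤ D) [G.Additive] {X Y : C}
    (h : IsSumThrough X Y) : IsSumThrough (G.obj X) (G.obj Y) := by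
  obtain ⟨n, a, b, h⟩ := h
  refine ⟨n, fun i => G.map (a i), fun i => G.map (b i), ?_⟩
  rw [← G.map_id, ← h, G.map_sum]
  exact Finset.sum_congr rfl fun i _ => (G.map_comp _ _).symm

lemma IsSumThrough.of_isInAdd [HasFiniteBiproducts C] {X Y : C} (h : IsInAdd X Y) :
    IsSumThrough X Y := by
  obtain ⟨n, ⟨r⟩⟩ := h
  refine ⟨n, fun i => r.i ≫ biproduct.π _ i, fun i => biproduct.ι (fun _ => X) i ≫ r.r, ?_⟩
  have h₁ : r.i ≫ (∑ i, biproduct.π (fun _ : Fin n => X) i ≫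
      biproduct.ι (fun _ : Fin n => X) i) ≫ r.r = 𝟙 Y := by
    rw [biproduct.total, Category.id_comp, r.retract]
  rw [← h₁, Preadditive.sum_comp, Preadditive.comp_sum]
  exact Finset.sum_congr rfl fun i _ => by simp only [Category.assoc]

/-- Jacobson's identity: if `v` inverts `1 - f g`, then `1 + g v f` inverts `1 - g f`. -/
lemma isIso_one_sub_comm {X Y : C} (f : X ⟶ Y) (g : Y ⟶ X) [IsIso (𝟙 X - f ≫ g)] :
    IsIso (𝟙 Y - g ≫ f) := by
  obtain ⟨v, hv, hv'⟩ := (inferInstance : IsIso (𝟙 X - f ≫ g))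
  rw [Preadditive.sub_comp, Category.id_comp, Category.assoc, sub_eq_iff_eq_add] at hv
  rw [Preadditive.comp_sub, Category.comp_id, sub_eq_iff_eq_add] at hv'
  have h₁ := g ≫= hv =≫ f
  have h₂ := g ≫= hv' =≫ f
  simp only [Category.assoc, Preadditive.comp_add, Preadditive.add_comp,
    Category.id_comp] at h₁ h₂
  refine ⟨𝟙 Y + g ≫ v ≫ f, ?_, ?_⟩
  · simp only [Preadditive.sub_comp, Preadditive.comp_add, Category.id_comp, Category.comp_id,
      Category.assoc]
    calc
      _ = 𝟙 Y + (g ≫ v ≫ f - (g ≫ f + g ≫ f ≫ g ≫ v ≫ f)) := by abel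
      _ = 𝟙 Y := by rw [← h₁, sub_self, add_zero]
  · simp only [Preadditive.comp_sub, Preadditive.add_comp, Category.id_comp, Category.comp_id,
      Category.assoc]
    calc
      _ = 𝟙 Y + (g ≫ v ≫ f - (g ≫ f + g ≫ v ≫ f ≫ g ≫ f)) := by abel
      _ = 𝟙 Y := by rw [← h₂, sub_self, add_zero]

/-- Terms of a complex with radical differential are retracts of the terms of any homotopy
equivalent complex. -/
lemma exists_retract_of_isRadical {T X : CochainComplex C ℤ} (e : HomotopyEquiv T X)
    (hX : ∀ i j, IsRadical (X.d i j)) (i : ℤ) :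
    ∃ (a : X.X i ⟶ T.X i) (b : T.X i ⟶ X.X i), a ≫ b = 𝟙 _ := by
  let h := e.homotopyInvHomId
  have h₁ : (e.inv ≫ e.hom).f i = X.d i (i + 1) ≫ h.hom (i + 1) i +
      h.hom i (i - 1) ≫ X.d (i - 1) i + 𝟙 (X.X i) := by
    rw [h.comm i, dNext_eq (i := i) (i' := i + 1) _ rfl, prevD_eq (j := i) (j' := i - 1) _ (by simp)]
    rfl
  have i₁ : IsIso (𝟙 (X.X i) - X.d i (i + 1) ≫ (-h.hom (i + 1) i)) := hX _ _ _
  let u := 𝟙 (X.X i) - X.d i (i + 1) ≫ (-h.hom (i + 1) i)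
  have i₂ : IsIso (𝟙 _ - X.d (i - 1) i ≫ (inv u ≫ (-h.hom i (i - 1)))) := hX _ _ _
  have i₃ := isIso_one_sub_comm (X.d (i - 1) i) (inv u ≫ (-h.hom i (i - 1)))
  -- The homotopy writes this composite as `1 + d h + h d`, a product of two factors. Radicality of
  -- the outgoing differential inverts `u`; radicality of the incoming one, with
  -- `isIso_one_sub_comm`, inverts the other.
  have h₂ : e.inv.f i ≫ e.hom.f i =
      u ≫ (𝟙 _ - (inv u ≫ (-h.hom i (i - 1))) ≫ X.d (i - 1) i) := by
    rw [← HomologicalComplex.comp_f, h₁, Preadditive.comp_sub, Category.comp_id, Category.assoc,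
      IsIso.hom_inv_id_assoc]
    simp only [u, Preadditive.comp_neg, Preadditive.neg_comp]
    abel
  have : IsIso (e.inv.f i ≫ e.hom.f i) := h₂ ▸ inferInstance
  exact ⟨e.inv.f i, e.hom.f i ≫ inv (e.inv.f i ≫ e.hom.f i), by
    rw [← Category.assoc, IsIso.hom_inv_id]⟩

end

section

variable {D : Type*} [Category D] [Preadditive D]

lemma IsSumThrough.orth_left {X Y Z : D} (h : IsSumThrough X Y) (h₁ : Orth X Z) : Orth Y Z := by
  obtain ⟨n, a, b, h⟩ := h
  intro f
  rw [← Category.id_comp f, ← h, Preadditive.sum_comp]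
  exact Finset.sum_eq_zero fun i _ => by rw [Category.assoc, h₁ (b i ≫ f), comp_zero]

lemma IsSumThrough.orth_right {X Y Z : D} (h : IsSumThrough X Y) (h₁ : Orth Z X) : Orth Z Y := by
  obtain ⟨n, a, b, h⟩ := h
  intro f
  rw [← Category.comp_id f, ← h, Preadditive.comp_sum]
  exact Finset.sum_eq_zero fun i _ => by rw [← Category.assoc, h₁ (f ≫ a i), zero_comp]

end

section

variable {C : Type*} [Category C] [Abelian C] [HasExt.{w} C] (F : ExtSubfunctor.{w} C)

lemma summandSubgroup_le {M N N' : C} (e : M ≅ N ⊞ N') :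
    F.summandSubgroup N ≤ F.summandSubgroup M := by
  refine AddSubgroup.closure_mono ?_
  rintro _ ⟨K, K', ⟨e'⟩, hK, hK', rfl⟩
  exact ⟨K, K' ⊞ N', ⟨e ≪≫ biprod.mapIso e' (Iso.refl _) ≪≫ biprod.associator _ _ _⟩, hK, hK', rfl⟩

/-- If every object has finite length in a suitable sense, the class of an object is a combination
of the classes of its indecomposable summands. -/
lemma cls_mem_summandSubgroup (ℓ : C → ℕ)
    (hℓ : ∀ M N N' : C, Nonempty (M ≅ N ⊞ N') → ¬ IsZero N' → ℓ N < ℓ M) (M : C) :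
    F.cls M ∈ F.summandSubgroup M := by
  induction hn : ℓ M using Nat.strong_induction_on generalizing M with
  | _ n ih =>
    by_cases hP : F.IsProj M
    · rw [F.cls_eq_zero hP]
      exact AddSubgroup.zero_mem _
    by_cases hM : Indecomposable M
    · refine AddSubgroup.subset_closure ⟨M, 0, ⟨⟨biprod.inl, biprod.fst, biprod.inl_fst, ?_⟩⟩, hM,
        hP, rfl⟩
      ext
      simp
    · simp only [Indecomposable, not_and, not_forall, not_or] at hM
      obtain ⟨Y, Z, e, hY, hZ⟩ := hM fun h => hP (ExtSubfunctor.isProj_of_isZero h)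
      have e' := e ≪≫ biprod.braiding _ _
      rw [F.cls_eq_add e]
      exact AddSubgroup.add_mem _
        (summandSubgroup_le F e (ih _ (hn ▸ hℓ _ _ _ ⟨e⟩ hZ) _ rfl))
        (summandSubgroup_le F e' (ih _ (hn ▸ hℓ _ _ _ ⟨e'⟩ hY) _ rfl))

end

section

variable {A : Type u} [Ring A] [IsArtinAlgebra A]

lemma isArtinianRing_of_isArtinAlgebra (A : Type u) [Ring A] [IsArtinAlgebra A] :
    IsArtinianRing A := by
  obtain ⟨R, _, _, _, _⟩ := IsArtinAlgebra.exists_algebra (A := A)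
  exact isArtinian_of_tower R isArtinian_of_fg_of_artinian'

/-- Length drops on proper summands, so `[M] ∈ ⟨M⟩` for every `M`, and a difference `[M] - [N]` lies
in `⟨M ⊞ N⟩`. -/
lemma exists_mem_summandSubgroup (F : ExtSubfunctor.{u + 1} (ModFG A)) (x : F.KGroup) :
    ∃ M, x ∈ F.summandSubgroup M := by
  have := isArtinianRing_of_isArtinAlgebra A
  have hfin (M : ModFG A) : Module.length A M ≠ ⊤ := Module.length_ne_top
  have key := cls_mem_summandSubgroup F (fun M => (Module.length A M).toNat) (by
    rintro M N N' ⟨e⟩ hN'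
    let f : M →ₗ[A] (N × N') :=
      LinearMap.prod (e.hom ≫ biprod.fst).hom.hom (e.hom ≫ biprod.snd).hom.hom
    let g : (N × N') →ₗ[A] M :=
      LinearMap.coprod (biprod.inl ≫ e.inv).hom.hom (biprod.inr ≫ e.inv).hom.hom
    have z₁ : (biprod.inl ≫ e.inv) ≫ e.hom ≫ biprod.fst = 𝟙 N := by simp
    have z₂ : (biprod.inl ≫ e.inv) ≫ e.hom ≫ biprod.snd = (0 : N ⟶ N') := by simp
    have z₃ : (biprod.inr ≫ e.inv) ≫ e.hom ≫ biprod.fst = (0 : N' ⟶ N) := by simp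
    have z₄ : (biprod.inr ≫ e.inv) ≫ e.hom ≫ biprod.snd = 𝟙 N' := by simp
    have z₅ : (e.hom ≫ biprod.fst) ≫ biprod.inl ≫ e.inv +
        (e.hom ≫ biprod.snd) ≫ biprod.inr ≫ e.inv = 𝟙 M := by
      have := e.hom ≫= biprod.total =≫ e.inv
      simpa only [Preadditive.comp_add, Preadditive.add_comp, Category.assoc, Category.id_comp,
        Category.comp_id, e.hom_inv_id] using this
    have gl (x : N) : g (x, 0) = (biprod.inl ≫ e.inv).hom.hom x :=
      (LinearMap.coprod_apply _ _ _).trans (by simp)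
    have gr (x : N') : g (0, x) = (biprod.inr ≫ e.inv).hom.hom x :=
      (LinearMap.coprod_apply _ _ _).trans (by simp)
    have hfg : f ∘ₗ g = LinearMap.id := by
      refine LinearMap.prod_ext (LinearMap.ext fun x => Prod.ext ?_ ?_)
        (LinearMap.ext fun x => Prod.ext ?_ ?_)
      · exact (congr_arg (e.hom ≫ biprod.fst).hom.hom (gl x)).trans
          (congr_arg (fun h => h.hom.hom x) z₁)
      · exact (congr_arg (e.hom ≫ biprod.snd).hom.hom (gl x)).trans
          (congr_arg (fun h => h.hom.hom x) z₂)
      · exact (congr_arg (e.hom ≫ biprod.fst).hom.hom (gr x)).trans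
          (congr_arg (fun h => h.hom.hom x) z₃)
      · exact (congr_arg (e.hom ≫ biprod.snd).hom.hom (gr x)).trans
          (congr_arg (fun h => h.hom.hom x) z₄)
    have hgf : g ∘ₗ f = LinearMap.id := LinearMap.ext fun x =>
      congr_arg (fun h => h.hom.hom x) z₅
    have h₁ : Module.length A M = Module.length A N + Module.length A N' := by
      rw [(LinearEquiv.ofLinearMap f g hfg hgf).length_eq, Module.length_prod]
    have h₂ : Module.length A N' ≠ 0 := fun h₀ => hN' (by
      have := Module.length_eq_zero_iff.1 h₀
      rw [IsZero.iff_id_eq_zero]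
      ext x
      exact Subsingleton.elim _ _)
    rw [h₁, ENat.toNat_add (hfin N) (hfin N')]
    have h₃ : (Module.length A N').toNat ≠ 0 := fun h => h₂ (by
      simpa [hfin N'] using h)
    lia)
  obtain ⟨M, N, rfl⟩ := F.exists_cls_sub_cls x
  exact ⟨M ⊞ N, AddSubgroup.sub_mem _ (summandSubgroup_le F (Iso.refl _) (key M))
    (summandSubgroup_le F (biprod.braiding _ _) (key N))⟩

lemma isProj_self (A : Type u) [Ring A] [IsArtinAlgebra A] :
    (ExtSubfunctor.full (ModFG A)).IsProj (FGModuleCat.of A A) := by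
  intro S hS f
  have : Epi S.g := hS.1.epi_g
  have hg : Function.Surjective S.g.hom.hom :=
    (ModuleCat.epi_iff_surjective _).1
      (inferInstanceAs (Epi ((forget₂ (ModFG A) (ModuleCat A)).map S.g)))
  obtain ⟨g, hg⟩ := Module.projective_lifting_property S.g.hom.hom f.hom.hom hg
  exact ⟨FGModuleCat.ofHom g, FGModuleCat.hom_ext hg⟩

lemma isSumThrough_of_isProj {Q : ModFG A} (hQ : (ExtSubfunctor.full (ModFG A)).IsProj Q) :
    IsSumThrough (FGModuleCat.of A A) Q := by
  obtain ⟨n, p, hp⟩ := Module.Finite.exists_fin' A Q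
  let P : ModFG A := FGModuleCat.of A (Fin n → A)
  let p' : P ⟶ Q := FGModuleCat.ofHom p
  have : Epi p' := ConcreteCategory.epi_of_surjective p' hp
  obtain ⟨g, hg⟩ := hQ (ShortComplex.mk (kernel.ι p') p' (kernel.condition p'))
    ((ExtSubfunctor.isExact_full_iff _).2 (.mk' (ShortComplex.exact_kernel p')
      (inferInstanceAs (Mono (kernel.ι p'))) this)) (𝟙 Q)
  refine ⟨n, fun i => g ≫ FGModuleCat.ofHom (LinearMap.proj i),
    fun i => FGModuleCat.ofHom (LinearMap.single A (fun _ => A) i) ≫ p', ?_⟩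
  dsimp at hg
  rw [← hg]
  have : ∑ i : Fin n, (FGModuleCat.ofHom (LinearMap.proj i) : P ⟶ FGModuleCat.of A A) ≫
      (FGModuleCat.ofHom (LinearMap.single A (fun _ => A) i) : FGModuleCat.of A A ⟶ P) = 𝟙 P := by
    apply (ModuleCat.isFG A).ι.map_injective
    rw [Functor.map_sum]
    ext x : 2
    rw [ModuleCat.hom_sum, LinearMap.sum_apply]
    exact LinearMap.sum_single_apply (φ := fun _ : Fin n => A) x
  have h₁ : g ≫ (∑ i : Fin n, (FGModuleCat.ofHom (LinearMap.proj i) : P ⟶ FGModuleCat.of A A) ≫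
      (FGModuleCat.ofHom (LinearMap.single A (fun _ => A) i) : FGModuleCat.of A A ⟶ P)) ≫ p' =
      g ≫ p' := by rw [this, Category.id_comp]
  simpa [Preadditive.sum_comp, Preadditive.comp_sum] using h₁

end

end RelDer

/-! ### Projective dimension bounds from the tilting complex, and the conclusion. -/

namespace RelDer

open Pretriangulated Triangulated ObjectProperty

section

variable {C : Type*} [Category C] [Abelian C] [HasExt.{w} C] {F : ExtSubfunctor.{w} C}
  [F.EnoughProj] {D : Type*} [Category D] [Preadditive D] [HasZeroObject D] [HasShift D ℤ]
  [∀ n : ℤ, (shiftFunctor D n).Additive] [Pretriangulated D] {s : C ⥤ D} [s.Additive]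
  {C' : Type*} [Category C'] [Abelian C'] [HasExt.{v} C'] {F' : ExtSubfunctor.{v} C'}
  [F'.EnoughProj] {D' : Type*} [Category D'] [Preadditive D'] [HasZeroObject D'] [HasShift D' ℤ]
  [∀ n : ℤ, (shiftFunctor D' n).Additive] [Pretriangulated D'] {s' : C' ⥤ D'} [s'.Additive]

/-- To bound the projective dimension of `X`, it suffices to consider morphisms to the shifts of
a generator `s'(G)` of the projectives. -/
lemma IsStalkFunctor.ple_of_orth (h' : IsStalkFunctor F' s') {G : C'}
    (hG : ∀ Q, F'.IsProj Q → IsSumThrough G Q) {m n : ℤ} {X : D'} (hX : PLE s' n X)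
    (h₀ : ∀ k, m < k → Orth X ((s'.obj G)⟦k⟧)) : PLE s' m X := by
  -- The a priori finite bound `n` starts a descending induction on `k`: a cover of `N` reduces
  -- degree `k` to the generator and to the syzygy in degree `k + 1`.
  have key : ∀ (d : ℕ) (N : C') (k : ℤ), m < k → n < k + d → Orth X ((s'.obj N)⟦k⟧) := fun d => by
    induction d with
    | zero => exact fun N k _ hk => hX N k (by lia)
    | succ d ih =>
      intro N k hm hn
      obtain ⟨K, Q, i, p, w, δ, ε, hE, hQ, hT⟩ := h'.exists_cover_distTriang N k
      exact hT.orth_right (((hG Q hQ).map (s' ⋙ shiftFunctor D' k)).orth_right (h₀ k hm))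
        (ih K (k + 1) (by lia) (by lia))
  exact fun N k hk => key (n - k + 1).toNat N k hk (by lia)

variable {L : D ⥤ D'} {L' : D' ⥤ D} [L.CommShift ℤ] [L.IsTriangulated] [L.Additive]
  [L'.CommShift ℤ] [L'.IsTriangulated] [L'.Additive] {T : D} {G : C'}
  (hG : ∀ Q, F'.IsProj Q → IsSumThrough G Q) (e : L'.obj (s'.obj G) ≅ T)

include hG e

lemma ple_inverse_map_stalk {b : ℤ} (hT : PLE s b T) {Q : C'} (hQ : F'.IsProj Q) :
    PLE s b (L'.obj (s'.obj Q)) := fun N k hk =>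
  ((hG Q hQ).map (s' ⋙ L')).orth_left ((hT N k hk).of_iso_left e.symm)

/-- Maps from `L(Q)` to `G⟦k⟧` correspond to maps from `Q` to `T⟦k⟧`, which vanish for `k > m`.
`ple_of_orth` passes from `G` to all modules, given that the dimension is finite. -/
lemma ple_map_stalk (h : IsStalkFunctor F s) (h' : IsStalkFunctor F' s') (I : IsRetraction L L')
    {m : ℤ} (hT : ExtClosure (stalks s F.IsProj (fun n => -m ≤ n)) T) {Q : C} (hQ : F.IsProj Q)
    (hn : ∃ n, PLE s' n (L.obj (s.obj Q))) : PLE s' m (L.obj (s.obj Q)) := by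
  obtain ⟨n, hn⟩ := hn
  refine h'.ple_of_orth hG hn fun k hk => I.orth_left ?_
  have h₁ : Orth ((s.obj Q)⟦-k⟧) T := orth_extClosure_right hT (by
    rintro _ ⟨N, l, hN, hl, ⟨e'⟩⟩
    exact (h.proj_orth hQ (by lia)).of_iso_right e'.symm)
  have h₂ : Orth (s.obj Q) (T⟦k⟧) := (orth_shift_iff _ _ (-k) 0 k (by lia)).1
    (h₁.of_iso_right ((shiftFunctorZero D ℤ).symm.app T))
  exact h₂.of_iso_right ((shiftFunctor D k).mapIso e.symm ≪≫ (L'.commShiftIso k).symm.app _)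

end

section

variable {C : Type*} [Category C] [Abelian C] [HasExt.{w} C] {F : ExtSubfunctor.{w} C}
  [F.EnoughProj] {D : Type*} [Category D] [Preadditive D] [HasZeroObject D] [HasShift D ℤ]
  [∀ n : ℤ, (shiftFunctor D n).Additive] [Pretriangulated D] {s : C ⥤ D} [s.Additive]
  {C' : Type*} [Category C'] [Abelian C'] [HasExt.{v} C'] {F' : ExtSubfunctor.{v} C'}
  [F'.EnoughProj] {D' : Type*} [Category D'] [Preadditive D'] [HasZeroObject D'] [HasShift D' ℤ]
  [∀ n : ℤ, (shiftFunctor D' n).Additive] [Pretriangulated D'] {s' : C' ⥤ D'} [s'.Additive]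

/-- The two bounds on relative `φ`-dimensions along a triangle equivalence `L`, for an object `T`
with `L(T) ≅ s'(G)` which is built from stalks of projectives in degrees between `-m` and `b`. -/
theorem phiDim_le_and_le [IsTriangulated D] [IsTriangulated D'] (h : IsStalkFunctor F s)
    (h' : IsStalkFunctor F' s') (hx : ∀ x : F.KGroup, ∃ M, x ∈ F.summandSubgroup M)
    (hx' : ∀ x : F'.KGroup, ∃ M, x ∈ F'.summandSubgroup M)
    (hfull : ∀ S : ShortComplex C', S.ShortExact → F'.IsExact S)
    (L : D ⥤ D') [L.CommShift ℤ] [L.IsTriangulated] [L.IsEquivalence] {T : D} {G : C'}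
    (hG : ∀ Q, F'.IsProj Q → IsSumThrough G Q) (ε : L.obj T ≅ s'.obj G) {m b : ℤ} {t : ℕ}
    (hmb : m + b = t) (hT : ExtClosure (stalks s F.IsProj (fun n => -m ≤ n ∧ n ≤ b)) T)
    (hn : ∀ Q, F.IsProj Q → ∃ n, PLE s' n (L.obj (s.obj Q))) :
    F.phiDim ≤ F'.phiDim + t ∧ F'.phiDim ≤ F.phiDim + t + 2 := by
  let E := L.asEquivalence
  let _ : E.functor.CommShift ℤ := ‹L.CommShift ℤ›
  let _ : E.inverse.CommShift ℤ := E.commShiftInverse ℤ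
  have : E.CommShift ℤ := E.commShift_of_functor ℤ
  have : E.IsTriangulated := .mk' E ‹L.IsTriangulated›
  have : E.inverse.IsTriangulated := inferInstance
  have I : IsRetraction L E.inverse := ⟨inferInstance, fun Y => ⟨(E.unitIso.app Y).symm⟩⟩
  have I' : IsRetraction E.inverse L := ⟨inferInstance, fun Y => ⟨E.counitIso.app Y⟩⟩
  let e : E.inverse.obj (s'.obj G) ≅ T := E.inverse.mapIso ε.symm ≪≫ (E.unitIso.app T).symm
  have hb (Q : C') (hQ : F'.IsProj Q) : PLE s b (E.inverse.obj (s'.obj Q)) :=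
    ple_inverse_map_stalk hG e (h.ple_of_extClosure (extClosure_mono (by
      rintro _ ⟨M, n, hM, hn, i⟩
      exact ⟨M, n, hM, hn.2, i⟩) _ hT)) hQ
  have ha (Q : C) (hQ : F.IsProj Q) : PLE s' m (L.obj (s.obj Q)) :=
    ple_map_stalk hG e h h' I (extClosure_mono (by
      rintro _ ⟨M, n, hM, hn, i⟩
      exact ⟨M, n, hM, hn.1, i⟩) _ hT) hQ (hn Q hQ)
  constructor
  -- The target structure is absolute, so approximation by stalks costs nothing: `k = 0`. In the
  -- other direction it is relative, and `k = 2`.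
  · refine phiDim_le_add h h' I I' ha hb hx' t 0 hmb fun n Z hZ => ?_
    rw [Nat.cast_zero, add_zero]
    obtain ⟨P, M, a, b, c, hd, hP⟩ := h'.exists_stalk hfull hZ
    exact ⟨P, M, a, b, c, hd, h'.ple_of_extClosure hP⟩
  · refine (phiDim_le_add h' h I' I hb ha hx t 2 (by lia) fun n Z hZ => ?_).trans
      (by rw [Nat.cast_add, ← add_assoc]; rfl)
    obtain ⟨P, M, a, b, c, hd, hP⟩ := h.exists_stalk_add_two hZ
    exact ⟨P, M, a, b, c, hd, (h.ple_of_extClosure hP).mono (by push_cast; lia)⟩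

end

section

variable {C : Type u} [Category.{v} C] [Abelian C] [HasExt.{w} C] {F : ExtSubfunctor.{w} C}
  [F.EnoughProj] {D : Type*} [Category D] [Preadditive D] [HasZeroObject D] [HasShift D ℤ]
  [∀ n : ℤ, (shiftFunctor D n).Additive] [Pretriangulated D]
  {D' : Type*} [Category D'] [Preadditive D'] [HasZeroObject D'] [HasShift D' ℤ]
  [∀ n : ℤ, (shiftFunctor D' n).Additive] [Pretriangulated D'] {C' : Type*} [Category C'] [Abelian C'] [HasExt.{v'} C']
  {s' : C' ⥤ D'}

/-- Objects whose image has finite projective dimension form a triangulated subcategory. It contains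
`add T`, hence every bounded complex of `F`-projectives, in particular the stalk of `Q`. -/
lemma ExtSubfunctor.IsTilting.exists_ple {T : CochainComplex C ℤ} (hT : F.IsTilting T)
    (q : Kb C ⥤ D) [q.CommShift ℤ] [q.IsTriangulated] (L : D ⥤ D') [L.CommShift ℤ]
    [L.IsTriangulated] {n₀ : ℤ} (h₀ : PLE s' n₀ (L.obj (q.obj (toKb T hT.isBounded)))) {Q : C}
    (hQ : F.IsProj Q) : ∃ n, PLE s' n (L.obj ((stalkKb C ⋙ q).obj Q)) := by
  let Λ : Kb C ⥤ D' := q ⋙ L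
  -- `generates` speaks of subcategories of the unbounded homotopy category, so the condition is
  -- transported there through bounded representatives.
  let 𝒬 : ObjectProperty (HomotopyCategory C (ComplexShape.up ℤ)) :=
    fun X => ∃ Y : Kb C, Nonempty ((bounded C).ι.obj Y ≅ X) ∧ ∃ n, PLE s' n (Λ.obj Y)
  have i₁ : 𝒬.IsClosedUnderIsomorphisms :=
    ⟨fun e ⟨Y, ⟨e'⟩, hY⟩ => ⟨Y, ⟨e' ≪≫ e⟩, hY⟩⟩
  have i₂ : 𝒬.ContainsZero := ⟨⟨(bounded C).ι.obj 0, (bounded C).ι.map_isZero (isZero_zero _),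
    0, ⟨Iso.refl _⟩, 0, fun N k _ f => (Λ.map_isZero (isZero_zero _)).eq_of_src _ _⟩⟩
  have i₃ : 𝒬.IsStableUnderShift ℤ := ⟨fun k => ⟨fun X ⟨Y, ⟨e⟩, n, hY⟩ =>
    ⟨Y⟦k⟧, ⟨((bounded C).ι.commShiftIso k).app Y ≪≫ (shiftFunctor _ k).mapIso e⟩, n + k,
      (hY.shift k _ rfl).of_iso ((Λ.commShiftIso k).symm.app Y)⟩⟩⟩
  have i₄ : 𝒬.IsTriangulatedClosed₂ := .mk' fun Θ hΘ ⟨Y₁, ⟨e₁⟩, n₁, h₁⟩ ⟨Y₃, ⟨e₃⟩, n₃, h₃⟩ => by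
    obtain ⟨X₂, hX₂, ⟨e₂⟩⟩ := (bounded C).isoClosure.ext_of_isTriangulatedClosed₂ Θ hΘ
      ⟨_, Y₁.property, ⟨e₁.symm⟩⟩ ⟨_, Y₃.property, ⟨e₃.symm⟩⟩
    let Y₂ : Kb C := ⟨X₂, hX₂⟩
    let e₂' : (bounded C).ι.obj Y₂ ≅ Θ.obj₂ := e₂.symm
    have hd : Dist (e₁.hom ≫ Θ.mor₁ ≫ e₂'.inv) (e₂'.hom ≫ Θ.mor₂ ≫ e₃.inv)
        (e₃.hom ≫ Θ.mor₃ ≫ e₁.inv⟦(1 : ℤ)⟧') :=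
      Dist.of_iso (f := Θ.mor₁) (g := Θ.mor₂) (h := Θ.mor₃) hΘ e₁ e₂' e₃ (by simp) (by simp)
        (by simp [← Functor.map_comp])
    obtain ⟨f, g, k, hd'⟩ := exists_dist_of_dist_ι hd
    refine ⟨Y₂, ⟨e₂'⟩, max n₁ n₃, fun N k hk => (hd'.map Λ).orth_left (h₁ N k ?_) (h₃ N k ?_)⟩
    · exact lt_of_le_of_lt (le_max_left _ _) hk
    · exact lt_of_le_of_lt (le_max_right _ _) hk
  have i₅ : 𝒬.IsTriangulated := { }
  obtain ⟨Y, ⟨e⟩, n, hY⟩ := hT.generates 𝒬 (fun K hK _ hK' => by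
    refine ⟨toKb K hK, ⟨Iso.refl _⟩, n₀, fun N k hk => ?_⟩
    have h₁ : IsSumThrough (toKb T hT.isBounded) (toKb K hK) := by
      obtain ⟨l, a, b, hab⟩ := IsSumThrough.of_isInAdd hK'
      choose a' ha' using fun i => (bounded C).ι.map_surjective (X := toKb K hK)
        (Y := toKb T hT.isBounded) (a i)
      choose b' hb' using fun i => (bounded C).ι.map_surjective (X := toKb T hT.isBounded)
        (Y := toKb K hK) (b i)
      refine ⟨l, a', b', (bounded C).ι.map_injective ?_⟩
      rw [Functor.map_sum, CategoryTheory.Functor.map_id]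
      exact (Finset.sum_congr rfl fun i _ => ((bounded C).ι.map_comp _ _).trans
        (congr_arg₂ (· ≫ ·) (ha' i) (hb' i))).trans hab
    exact (h₁.map Λ).orth_left (h₀ N k hk)) _ (isBoundedCpx_single Q) (fun i => by
      by_cases hi : i = 0
      · subst hi
        exact hQ.of_iso (HomologicalComplex.singleObjXSelf (ComplexShape.up ℤ) 0 Q)
      · exact isProj_of_isZero (HomologicalComplex.isZero_single_obj_X _ _ _ _ hi))
  exact ⟨n, hY.of_iso (Λ.mapIso ((bounded C).fullyFaithfulι.preimageIso
    (Y := (stalkKb C).obj Q) e))⟩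

end

end RelDer

theorem theorem5p7 {A : Type u} [Ring A] [RelDer.IsArtinAlgebra A]
    {B : Type v} [Ring B] [RelDer.IsArtinAlgebra B]
    (F : RelDer.ExtSubfunctor (RelDer.ModFG A)) [F.EnoughProj] [F.EnoughInj]
    (hF : F.IsOfFiniteType)
    (L : F.Db ⥤ (RelDer.ExtSubfunctor.full (RelDer.ModFG B)).Db) [L.CommShift ℤ]
    [L.IsTriangulated] [L.IsEquivalence]
    (T : CochainComplex (RelDer.ModFG A) ℤ) (hT : F.IsTilting T)
    (hLT : Nonempty (L.obj (F.toDb T hT.isBounded) ≅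
      (RelDer.ExtSubfunctor.full (RelDer.ModFG B)).toDb
        ((HomologicalComplex.single (RelDer.ModFG B) (ComplexShape.up ℤ) 0).obj
          (FGModuleCat.of B B))
        (RelDer.isBoundedCpx_single _)))
    (t : ℕ) (ht : RelDer.HasTermLength T t) :
    F.phiDim ≤ (RelDer.ExtSubfunctor.full (RelDer.ModFG B)).phiDim + t ∧
      (RelDer.ExtSubfunctor.full (RelDer.ModFG B)).phiDim ≤ F.phiDim + t + 2 := by
  obtain ⟨X, ⟨e⟩, hrad, m, -, -, hX⟩ := ht
  obtain ⟨ε⟩ := hLT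
  have h := RelDer.isStalkFunctor_stalkDb F
  have h' := RelDer.isStalkFunctor_stalkDb (RelDer.ExtSubfunctor.full (RelDer.ModFG B))
  -- The radical representative has `F`-projective terms, being termwise a retract of `T`. Its range
  -- of degrees then gives the constants `m` and `t - m`, whose sum is `t`.
  have hXP (i : ℤ) : F.IsProj (X.X i) := by
    obtain ⟨a, b, hab⟩ := RelDer.exists_retract_of_isRadical e hrad i
    exact (hT.isProj i).of_retract a b hab
  have hTX : RelDer.ExtClosure (RelDer.stalks (RelDer.stalkDb F) F.IsProj
      (fun n => -m ≤ n ∧ n ≤ -(m - t))) (F.toDb T hT.isBounded) :=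
    ObjectProperty.prop_of_iso _ ((RelDer.locDb F).mapIso
      ((RelDer.bounded _).fullyFaithfulι.preimageIso (X := RelDer.toKb X ⟨m - t, m, hX⟩)
        (Y := RelDer.toKb T hT.isBounded) (HomotopyCategory.isoOfHomotopyEquiv e.symm)))
      (RelDer.extClosure_toDb F X hXP (m - t) m hX)
  -- `L(T)` is the stalk of the projective module `B`, hence the starting bound `0`.
  have hn (Q : RelDer.ModFG A) (hQ : F.IsProj Q) := hT.exists_ple (RelDer.locDb F) L (n₀ := 0)
    (RelDer.PLE.of_iso (fun N k hk => h'.orth _ N (RelDer.isProj_self B) k hk.ne') ε.symm) hQ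
  exact RelDer.phiDim_le_and_le h h' (RelDer.exists_mem_summandSubgroup F)
    (RelDer.exists_mem_summandSubgroup _)
    (fun S hS => (RelDer.ExtSubfunctor.isExact_full_iff S).2 hS) L
    (fun Q hQ => RelDer.isSumThrough_of_isProj hQ) ε (by lia) hTX hn
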